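/- Theorem 2. Consider $\min_{w\in\mathbb R^{d_0}}F(w)$, $F=f_K\circ\cdots\circ f_1$, with $K\ge1$, $f_i:\mathbb R^{d_{i-1}}\to\mathbb R^{d_i}$ differentiable and $d_K=1$. Each $f_i$ is $L_f$-Lipschitz, and its Jacobian $\nabla f_i$ is $L_J$-Lipschitz in operator norm. Level $i$ has a stochastic oracle $f_i(x;\xi),\nabla f_i(x;\xi)$, $\xi\sim\mathcal D_i$, which is unbiased for $f_i(x),\nabla f_i(x)$, has variances at most $\sigma_f^2,\sigma_J^2$, and satisfies $\mathbb E\|f_i(x;\xi)-f_i(y;\xi)\|^2\le\mathcal L_f^2\|x-y\|^2$ and $\mathbb E\|\nabla f_i(x;\xi)-\nabla f_i(y;\xi)\|^2\le\mathcal L_J^2\|x-y\|^2$ (Euclidean, i.e. Frobenius, norms of matrices in the variance and in the last bound). Let $F_*=\inf F>-\infty$ and $F(w_1)-F_*\le\Delta_F$ for the initial point $w_1$. SMVR with constant step size $\eta$, parameter $c$, length $T$ and input $(w_1,(u_1^i)_i,(v_1^i)_i)$ puts $\beta=c\eta^2$ and, for $1\le t<T$, $w_{t+1}=w_t-\eta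 v_t$, where $v_t$ is the gradient vector that the chain rule gives for the Jacobians $v_t^1,\dots,v_t^K$. Then $u_{t+1}^0=w_{t+1}$ and, for $i=1,\dots,K$, with a fresh sample $\xi=\xi_{t+1}^i\sim\mathcal D_i$, $$u_{t+1}^i=(1-\beta)u_t^i+\beta f_i(u_{t+1}^{i-1};\xi)+(1-\beta)\big(f_i(u_{t+1}^{i-1};\xi)-f_i(u_t^{i-1};\xi)\big),$$ $$v_{t+1}^i=\Pi_{L_f}\big[(1-\beta)v_t^i+\beta\nabla f_i(u_{t+1}^{i-1};\xi)+(1-\beta)\big(\nabla f_i(u_{t+1}^{i-1};\xi)-\nabla f_i(u_t^{i-1};\xi)\big)\big],$$ where $\Pi_{L_f}$ is the Euclidean (Frobenius) projection onto the matrices of operator norm at most $L_f$. It returns $(w_\tau,u_\tau,v_\tau)$, $\tau$ uniform on $\{1,\dots,T\}$. All samples and all indices $\tau$ are mutually independent. Stage-wise SMVR runs stages $s=1,\dots,S$ of SMVR. Stage 1 starts at $w_1$ with $u_1^0=w_1$, $u_1^i=f_i(u_1^{i-1};\xi_1^i)$, $v_1^i=\nabla f_i(u_1^{i-1};\xi_1^i)$;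 each later stage starts at the output of the stage before. With a constant $L_1$, the parameters are $\epsilon_s=\frac{8L_1}{\mu2^{s-1}}$, $L_2=64L_1^2$, $c=16L_1^2$, $\beta_1=\frac1{2L_1}$, $\beta_s=\frac{\mu\epsilon_{s-1}}{L_2}$ for $s\ge2$, step size $\eta_s=\sqrt{\beta_s/c}$, length $T_1=\max\{4L_1K(\sigma_f^2+\sigma_J^2),2\sqrt{2L_1}\Delta_F\}$ and $T_s=\max\big\{\frac{4L_2^{3/2}}{\mu\epsilon_{s-1}},\frac{4L_2}{\mu^{3/2}\sqrt{\epsilon_{s-1}}}\big\}$ for $s\ge2$, and $S=\log_2(2\epsilon_1/\epsilon)$; the $T_s$ and $S$ are rounded up to positive integers. Claim. There is $L_0>0$, depending only on $K,L_f,L_J,\sigma_f,\sigma_J,\mathcal L_f,\mathcal L_J$, and for every $L_1\ge L_0$ there is a constant $C$, depending only on these numbers, $L_1$ and $\Delta_F$, with the following property. Let $\mu>0$, and let $F$ satisfy the $\mu$-PL inequality $2\mu(F(w)-F_*)\le\|\nabla F(w)\|^2$ at all points $w$ of a set $W\subseteq\mathbb R^{d_0}$ ($W=\mathbb R^{d_0}$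 is allowed). Let $0<\epsilon\le\mu$, and suppose that almost surely the iterates $w_t$ of the stages $1,\dots,S$ lie in $W$ (no condition if $W=\mathbb R^{d_0}$). Then the output $w_S$ of Stage-wise SMVR is $\epsilon$-optimal, $\mathbb E[F(w_S)-F_*]\le\epsilon$, and the number of samples used, counted as $K\sum_{s=1}^ST_s$, is at most $C\max\{1,\frac1{\mu\epsilon}\}$, i.e. the sample complexity is $\mathcal O(1/(\mu\epsilon))$. -/

import Mathlib

open MeasureTheory ProbabilityTheory
open scoped NNReal ENNReal

noncomputable section

/-- The Euclidean space of dimension `n`. -/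
abbrev Vec (n : ℕ) : Type := EuclideanSpace ℝ (Fin n)

/-- Squared Euclidean norm of the matrix of a linear map (sum of the squares of its entries). The
norm `‖A‖` of `A : Vec m →L[ℝ] Vec n` is, as always in Mathlib, the operator norm. -/
def frobSq {m n : ℕ} (A : Vec m →L[ℝ] Vec n) : ℝ :=
  ∑ j, ‖A (EuclideanSpace.single j 1)‖ ^ 2

/-- `P` is a point of the ball `{‖Q‖ ≤ L}` at minimal Euclidean distance from `A`. The ball is the
one that contains the Jacobians of all `L`-Lipschitz maps. -/
def IsProjBall {m n : ℕ} (L : ℝ≥0) (A P : Vec m →L[ℝ] Vec n) : Prop :=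
  ‖P‖ ≤ L ∧ ∀ Q : Vec m →L[ℝ] Vec n, ‖Q‖ ≤ L → frobSq (P - A) ≤ frobSq (Q - A)

theorem frobSq_eq_zero {m n : ℕ} {A : Vec m →L[ℝ] Vec n} (h : frobSq A ≤ 0) : A = 0 := by
  have h0 : frobSq A = 0 := le_antisymm h (Finset.sum_nonneg fun _ _ => sq_nonneg _)
  have h1 := (Finset.sum_eq_zero_iff_of_nonneg (fun _ _ => sq_nonneg _)).1 h0
  have h2 : (A : Vec m →ₗ[ℝ] Vec n) = 0 := by
    refine (EuclideanSpace.basisFun (Fin m) ℝ).toBasis.ext fun j => ?_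
    have := h1 j (Finset.mem_univ j)
    simpa using this
  exact ContinuousLinearMap.coe_injective h2

theorem frobSq_parallelogram {m n : ℕ} (A B : Vec m →L[ℝ] Vec n) :
    4 * frobSq ((1 / 2 : ℝ) • (A + B)) + frobSq (A - B) = 2 * frobSq A + 2 * frobSq B := by
  simp only [frobSq, Finset.mul_sum, ← Finset.sum_add_distrib]
  refine Finset.sum_congr rfl fun j _ => ?_
  have := parallelogram_law_with_norm ℝ (A (EuclideanSpace.single j 1))
    (B (EuclideanSpace.single j 1))
  simp only [smul_apply, add_apply,
    sub_apply, norm_smul]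
  norm_num
  nlinarith

/-- The projection is well defined. -/
theorem existsUnique_isProjBall {m n : ℕ} (L : ℝ≥0) (A : Vec m →L[ℝ] Vec n) :
    ∃! P, IsProjBall L A P := by
  have hc : Continuous fun Q : Vec m →L[ℝ] Vec n => frobSq (Q - A) := by
    unfold frobSq
    fun_prop
  have hne : (Metric.closedBall (0 : Vec m →L[ℝ] Vec n) L).Nonempty := ⟨0, by simp⟩
  have : ProperSpace (Vec m →L[ℝ] Vec n) := FiniteDimensional.proper ℝ _
  obtain ⟨P, hP, hmin⟩ := (isCompact_closedBall (0 : Vec m →L[ℝ] Vec n) L).exists_isMinOn hne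
    hc.continuousOn
  have hP1 : IsProjBall L A P :=
    ⟨by simpa using hP, fun Q hQ => hmin (by simpa using hQ)⟩
  refine ⟨P, hP1, fun Q hQ => ?_⟩
  have hmid : ‖(1 / 2 : ℝ) • (Q + P)‖ ≤ L := by
    rw [norm_smul]
    have := norm_add_le Q P
    have h1 := hQ.1
    have h2 := hP1.1
    norm_num
    linarith
  have e := frobSq_parallelogram (Q - A) (P - A)
  have e1 : (1 / 2 : ℝ) • (Q - A + (P - A)) = (1 / 2 : ℝ) • (Q + P) - A := by
    module
  rw [e1, sub_sub_sub_cancel_right] at e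
  have h3 := hQ.2 _ hmid
  have h4 := hP1.2 _ hmid
  exact sub_eq_zero.1 (frobSq_eq_zero (by linarith))

/-- The projection `Π_L` of a Jacobian onto the ball of radius `L`. -/
def projBall {m n : ℕ} (L : ℝ≥0) (A : Vec m →L[ℝ] Vec n) : Vec m →L[ℝ] Vec n :=
  (existsUnique_isProjBall L A).choose

section Problem

variable {d : ℕ → ℕ}

/-- `f (n-1) ∘ ⋯ ∘ f 0`. Levels are numbered from `0`; only the levels `i < K` matter below. -/
def compose (f : (i : ℕ) → Vec (d i) → Vec (d (i + 1))) (w : Vec (d 0)) : (n : ℕ) → Vec (d n)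
  | 0 => w
  | n + 1 => f n (compose f w n)

/-- The objective `F = f (K-1) ∘ ⋯ ∘ f 0`, whose last level takes values in `ℝ¹`. -/
def objective (K : ℕ) (hd : d K = 1) (f : (i : ℕ) → Vec (d i) → Vec (d (i + 1)))
    (w : Vec (d 0)) : ℝ :=
  compose f w K (Fin.cast hd.symm 0)

/-- `V (n-1) ∘ ⋯ ∘ V 0`. -/
def jacProd (V : (i : ℕ) → Vec (d i) →L[ℝ] Vec (d (i + 1))) : (n : ℕ) → Vec (d 0) →L[ℝ] Vec (d n)
  | 0 => ContinuousLinearMap.id ℝ _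
  | n + 1 => (V n).comp (jacProd V n)

/-- The gradient vector given by the chain rule from the Jacobians `V i` of the levels. -/
def chainGrad (K : ℕ) (hd : d K = 1) (V : (i : ℕ) → Vec (d i) →L[ℝ] Vec (d (i + 1))) : Vec (d 0) :=
  ContinuousLinearMap.adjoint (jacProd V K) (EuclideanSpace.single (Fin.cast hd.symm 0) 1)

variable {Ξ : ℕ → Type*} [∀ i, MeasurableSpace (Ξ i)]

/-- The standing assumptions. `val i x ξ` and `jac i x ξ` are the answers `f_i(x; ξ)` and
`∇f_i(x; ξ)` of the stochastic oracle of level `i`, and `D i` is the law of a sample of level `i`. -/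
structure Assumptions (K : ℕ) (Lf LJ σf σJ ℓf ℓJ : ℝ≥0)
    (f : (i : ℕ) → Vec (d i) → Vec (d (i + 1)))
    (val : (i : ℕ) → Vec (d i) → Ξ i → Vec (d (i + 1)))
    (jac : (i : ℕ) → Vec (d i) → Ξ i → Vec (d i) →L[ℝ] Vec (d (i + 1)))
    (D : (i : ℕ) → Measure (Ξ i)) : Prop where
  measurable_val : ∀ i < K, Measurable fun p : Vec (d i) × Ξ i => val i p.1 p.2
  measurable_jac : ∀ i < K, Measurable fun p : Vec (d i) × Ξ i => jac i p.1 p.2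
  differentiable : ∀ i < K, Differentiable ℝ (f i)
  lipschitz : ∀ i < K, LipschitzWith Lf (f i)
  lipschitz_jacobian : ∀ i < K, LipschitzWith LJ (fderiv ℝ (f i))
  unbiased_val : ∀ i < K, ∀ x, ∫ ξ, val i x ξ ∂(D i) = f i x
  unbiased_jac : ∀ i < K, ∀ x, ∫ ξ, jac i x ξ ∂(D i) = fderiv ℝ (f i) x
  variance_val : ∀ i < K, ∀ x,
    ∫⁻ ξ, ENNReal.ofReal (‖val i x ξ - f i x‖ ^ 2) ∂(D i) ≤ ENNReal.ofReal (σf ^ 2)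
  variance_jac : ∀ i < K, ∀ x,
    ∫⁻ ξ, ENNReal.ofReal (frobSq (jac i x ξ - fderiv ℝ (f i) x)) ∂(D i) ≤ ENNReal.ofReal (σJ ^ 2)
  meanSq_val : ∀ i < K, ∀ x y,
    ∫⁻ ξ, ENNReal.ofReal (‖val i x ξ - val i y ξ‖ ^ 2) ∂(D i) ≤
      ENNReal.ofReal (ℓf ^ 2 * ‖x - y‖ ^ 2)
  meanSq_jac : ∀ i < K, ∀ x y,
    ∫⁻ ξ, ENNReal.ofReal (frobSq (jac i x ξ - jac i y ξ)) ∂(D i) ≤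
      ENNReal.ofReal (ℓJ ^ 2 * ‖x - y‖ ^ 2)

/-- The `μ`-PL inequality for `F` at the points of `W`, where `F_* = inf F` over the whole space. For
`W = univ` this is the usual `μ`-PL condition. -/
def PLOn {n : ℕ} (μ : ℝ) (F : Vec n → ℝ) (W : Set (Vec n)) : Prop :=
  ∀ w ∈ W, 2 * μ * (F w - ⨅ x, F x) ≤ ‖gradient F w‖ ^ 2

/-! ### The algorithm -/

/-- The state of the algorithm at a time step: `u 0` is the iterate `w_t`, `u (i+1)` estimates the
value and `v i` the Jacobian of level `i` at `u i`. -/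
structure State (d : ℕ → ℕ) where
  u : (i : ℕ) → Vec (d i)
  v : (i : ℕ) → Vec (d i) →L[ℝ] Vec (d (i + 1))

/-- Function value estimators of the very first time step. -/
def initU (val : (i : ℕ) → Vec (d i) → Ξ i → Vec (d (i + 1))) (w : Vec (d 0))
    (x : (i : ℕ) → Ξ i) : (i : ℕ) → Vec (d i)
  | 0 => w
  | i + 1 => val i (initU val w x i) (x i)

/-- The very first time step: plain evaluation of the oracles at the samples `x`. -/
def initState (val : (i : ℕ) → Vec (d i) → Ξ i → Vec (d (i + 1)))
    (jac : (i : ℕ) → Vec (d i) → Ξ i → Vec (d i) →L[ℝ] Vec (d (i + 1)))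
    (w : Vec (d 0)) (x : (i : ℕ) → Ξ i) : State d where
  u := initU val w x
  v := fun i => jac i (initU val w x i) (x i)

/-- Nested variance reduced estimators of the function values at the new iterate `w`. -/
def nextU (val : (i : ℕ) → Vec (d i) → Ξ i → Vec (d (i + 1))) (β : ℝ)
    (X : State d) (w : Vec (d 0)) (x : (i : ℕ) → Ξ i) : (i : ℕ) → Vec (d i)
  | 0 => w
  | i + 1 => (1 - β) • X.u (i + 1) + β • val i (nextU val β X w x i) (x i) +
      (1 - β) • (val i (nextU val β X w x i) (x i) - val i (X.u i) (x i))

/-- From one time step to the next: the weight update `w - η • v`, then, with `β = c η²` and the new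
samples `x`, the estimators of all levels, the Jacobians being projected. -/
def step (K : ℕ) (hd : d K = 1) (Lf : ℝ≥0)
    (val : (i : ℕ) → Vec (d i) → Ξ i → Vec (d (i + 1)))
    (jac : (i : ℕ) → Vec (d i) → Ξ i → Vec (d i) →L[ℝ] Vec (d (i + 1)))
    (c η : ℝ) (X : State d) (x : (i : ℕ) → Ξ i) : State d :=
  let β := c * η ^ 2
  let U := nextU val β X (X.u 0 - η • chainGrad K hd X.v) x
  { u := U
    v := fun i => projBall Lf ((1 - β) • X.v i + β • jac i (U i) (x i) +
      (1 - β) • (jac i (U i) (x i) - jac i (X.u i) (x i))) }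

/-- The trajectory of SMVR with constant step size `η`, started at `X`, which is the state at the
first time step (index `0`); `x t i` is the sample of level `i` at time index `t`. -/
def smvr (K : ℕ) (hd : d K = 1) (Lf : ℝ≥0)
    (val : (i : ℕ) → Vec (d i) → Ξ i → Vec (d (i + 1)))
    (jac : (i : ℕ) → Vec (d i) → Ξ i → Vec (d i) →L[ℝ] Vec (d (i + 1)))
    (c η : ℝ) (X : State d) (x : ℕ → (i : ℕ) → Ξ i) : ℕ → State d
  | 0 => X
  | t + 1 => step K hd Lf val jac c η (smvr K hd Lf val jac c η X x t) (x (t + 1))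

/-- The state in which stage `s` (counted from `0`) starts; for `s + 1` this is the output of
stage `s`, i.e. its state at the time index `τ s`. Here `η s` is the step size of stage `s` and
`x s t i` the sample of level `i` at time index `t` of stage `s`. -/
def stagewise (K : ℕ) (hd : d K = 1) (Lf : ℝ≥0)
    (val : (i : ℕ) → Vec (d i) → Ξ i → Vec (d (i + 1)))
    (jac : (i : ℕ) → Vec (d i) → Ξ i → Vec (d i) →L[ℝ] Vec (d (i + 1)))
    (c : ℝ) (η : ℕ → ℝ) (w : Vec (d 0)) (x : ℕ → ℕ → (i : ℕ) → Ξ i) (τ : ℕ → ℕ) : ℕ → State d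
  | 0 => initState val jac w (x 0 0)
  | s + 1 => smvr K hd Lf val jac c (η s) (stagewise K hd Lf val jac c η w x τ s) (x s) (τ s)

/-- The iterate (weight vector) at time index `t` of stage `s`. -/
def iterate (K : ℕ) (hd : d K = 1) (Lf : ℝ≥0)
    (val : (i : ℕ) → Vec (d i) → Ξ i → Vec (d (i + 1)))
    (jac : (i : ℕ) → Vec (d i) → Ξ i → Vec (d i) →L[ℝ] Vec (d (i + 1)))
    (c : ℝ) (η : ℕ → ℝ) (w : Vec (d 0)) (x : ℕ → ℕ → (i : ℕ) → Ξ i) (τ : ℕ → ℕ)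
    (s t : ℕ) : Vec (d 0) :=
  (smvr K hd Lf val jac c (η s) (stagewise K hd Lf val jac c η w x τ s) (x s) t).u 0

/-- The randomness of the algorithm: the samples `ξ s t i` of law `D i` and the output indices
`τ s`, uniform on the `T s` time indices of stage `s`, are all mutually independent. -/
structure IsSampling {Ω : Type*} [MeasurableSpace Ω] (P : Measure Ω) (K : ℕ)
    (D : (i : ℕ) → Measure (Ξ i)) (T : ℕ → ℕ)
    (ξ : ℕ → ℕ → (i : ℕ) → Ω → Ξ i) (τ : ℕ → Ω → ℕ) : Prop where
  measurable_sample : ∀ s t, ∀ i < K, Measurable (ξ s t i)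
  law_sample : ∀ s t, ∀ i < K, P.map (ξ s t i) = D i
  measurable_index : ∀ s, Measurable (τ s)
  uniform_index : ∀ s, ∀ t < T s, P {ω | τ s ω = t} = (T s : ℝ≥0∞)⁻¹
  indep : iIndep (Sum.elim
    (fun p : ℕ × ℕ × Fin K =>
      MeasurableSpace.comap (ξ p.1 p.2.1 p.2.2) (inferInstance : MeasurableSpace (Ξ p.2.2)))
    (fun s : ℕ => MeasurableSpace.comap (τ s) ⊤)) P

end Problem

/-! ### The parameters; stage `s + 1` has index `s` -/

/-- `ε_{s+1} = ε_1 / 2^s` with `ε_1 = 8 L₁ / μ`. -/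
def epsStage (L₁ μ : ℝ) (s : ℕ) : ℝ := 8 * L₁ / μ / 2 ^ s

/-- `L₂ = 64 L₁²`. -/
def Ltwo (L₁ : ℝ) : ℝ := 64 * L₁ ^ 2

/-- The constant `c = 16 L₁²`. -/
def cParam (L₁ : ℝ) : ℝ := 16 * L₁ ^ 2

def betaStage (L₁ μ : ℝ) : ℕ → ℝ
  | 0 => 1 / (2 * L₁)
  | s + 1 => μ * epsStage L₁ μ s / Ltwo L₁

/-- The step sizes. -/
def etaStage (L₁ μ : ℝ) (s : ℕ) : ℝ := √(betaStage L₁ μ s / cParam L₁)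

/-- The numbers of time steps, rounded up to positive integers. -/
def lenStage (K : ℕ) (σf σJ Δ : ℝ≥0) (L₁ μ : ℝ) : ℕ → ℕ
  | 0 => max 1 ⌈max (4 * L₁ * K * ((σf : ℝ) ^ 2 + (σJ : ℝ) ^ 2)) (2 * √(2 * L₁) * Δ)⌉₊
  | s + 1 => ⌈max (4 * Ltwo L₁ ^ (3 / 2 : ℝ) / (μ * epsStage L₁ μ s))
      (4 * Ltwo L₁ / (μ ^ (3 / 2 : ℝ) * √(epsStage L₁ μ s)))⌉₊

/-- The number of stages `log₂ (2 ε_1 / ε)`, rounded up to a positive integer. -/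
def numStages (L₁ μ ε : ℝ) : ℕ := max 1 ⌈Real.logb 2 (2 * epsStage L₁ μ 0 / ε)⌉₊

/-- The number of samples: one per level and time step. (The first time step of a restarted stage
keeps the estimators it is given, so that the true count is slightly smaller.) -/
def numSamples (K : ℕ) (σf σJ Δ : ℝ≥0) (L₁ μ ε : ℝ) : ℕ :=
  K * ∑ s ∈ Finset.range (numStages L₁ μ ε), lenStage K σf σJ Δ L₁ μ s

end

/-! Two quantities are followed along the iterates: the optimality gap g = F(w) - F_*, and the total
squared estimation error Φ (`sqError`), which compares each value and Jacobian estimator with the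
truth at the estimated input of its level. Since the levels and their Jacobians are Lipschitz and
projected Jacobians are bounded, the gradient estimate v satisfies ‖v - ∇F(w)‖² ≤ E Φ with E =
`errConst` (`norm_chainGrad_sub_gradient_sq_le`).

An estimator update multiplies the old error by 1 - β and adds centred noise, whose second moment is
of order β² times the variance plus the squared movement of the input
(`lintegral_norm_update_sub_sq_le`). The movement of one level is the input movement of the next
(`movement_le`). For small β this closes, in expectation, to Φ' ≤ (1 - β/2) Φ + S β² + M η² ‖v‖²
(`sqError_step`). On the other side, `descent` gives g' + η/2 ‖∇F‖² + η/4 ‖v‖² ≤ g + η/2 ‖v - ∇F‖².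
Adding 2E/(cη) times the first inequality to the second cancels both the movement and the gradient
error, because c ≥ 16 E M (`lyapunov_step`).

Telescoping over T steps and using the PL inequality bounds the average of the expectation of μ g +
Φ by (g₀/η + 2E Φ₀/β)/T + 2 E S β, up to an initial correction (`sum_potential_le`). An independent
uniform output index realises this average (`integral_random_index`). The first stage brings it
below 8 L₁ (`first_stage_le`). If the parts are at most q at the start of a later stage, then β of
order q, η of order √q and the prescribed length make it at most q/2 at the output
(`later_stage_le`). The error must be halved together with the gap, because the next stage inherits
the estimators.

The correction comes from the initial Jacobians, which are not projected, so that the bound by E Φ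
may fail for them. The failure `excess` vanishes after any step, but survives if the output index is
0; hence it is a part of `potential`. Its initial mean is finite by a level by level second moment
bound (`init_jacProd`).

The lengths of the later stages grow like 2^s + 2^(s/2)/μ, so the last stage dominates, where 2^s is
of order 1/(μ ε). The assumption ε ≤ μ makes the second contribution of order 1/(μ ε) as well
(`numSamples_le`). -/

noncomputable section

set_option linter.unusedSectionVars false

/-! ### The Euclidean structure on matrices and the projection onto the operator norm ball -/

/-- A linear map as the vector of its columns; the norm of the target is the Frobenius norm. -/
def frobPi (m n : ℕ) : (Vec m →L[ℝ] Vec n) →L[ℝ] PiLp 2 (fun _ : Fin m => Vec n) :=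
  (PiLp.continuousLinearEquiv 2 ℝ fun _ : Fin m => Vec n).symm.toContinuousLinearMap ∘L
    ContinuousLinearMap.pi fun j => ContinuousLinearMap.apply ℝ (Vec n) (EuclideanSpace.single j 1)

/-- Matrices carry the operator norm; this moves Frobenius estimates to an inner product space,
where the Hilbert space lemmas apply. -/
theorem norm_frobPi_sq {m n : ℕ} (A : Vec m →L[ℝ] Vec n) : ‖frobPi m n A‖ ^ 2 = frobSq A := by
  rw [PiLp.norm_sq_eq_of_L2]
  rfl

theorem frobSq_nonneg {m n : ℕ} (A : Vec m →L[ℝ] Vec n) : 0 ≤ frobSq A :=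
  Finset.sum_nonneg fun _ _ => sq_nonneg _

theorem norm_sq_le_frobSq {m n : ℕ} (A : Vec m →L[ℝ] Vec n) : ‖A‖ ^ 2 ≤ frobSq A := by
  have h : ‖A‖ ≤ √(frobSq A) := by
    refine A.opNorm_le_bound (Real.sqrt_nonneg _) fun x => ?_
    have hx : A x = ∑ j, x j • A (EuclideanSpace.single j 1) := by
      conv_lhs => rw [← (EuclideanSpace.basisFun (Fin m) ℝ).sum_repr x]
      simp
    rw [hx]
    calc ‖∑ j, x j • A (EuclideanSpace.single j 1)‖
        ≤ ∑ j, |x j| * ‖A (EuclideanSpace.single j 1)‖ := by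
          refine (norm_sum_le _ _).trans (le_of_eq ?_)
          simp [norm_smul]
      _ ≤ √(∑ j, |x j| ^ 2) * √(∑ j, ‖A (EuclideanSpace.single j 1)‖ ^ 2) :=
          Real.sum_mul_le_sqrt_mul_sqrt _ _ _
      _ = √(frobSq A) * ‖x‖ := by
          rw [EuclideanSpace.norm_eq, mul_comm]
          simp [frobSq]
  calc ‖A‖ ^ 2 ≤ √(frobSq A) ^ 2 := by gcongr
    _ = frobSq A := Real.sq_sqrt (frobSq_nonneg A)

theorem frobSq_le_mul_norm_sq {m n : ℕ} (A : Vec m →L[ℝ] Vec n) : frobSq A ≤ m * ‖A‖ ^ 2 := by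
  calc frobSq A ≤ ∑ _j : Fin m, ‖A‖ ^ 2 := by
        refine Finset.sum_le_sum fun j _ => ?_
        have := A.le_opNorm (EuclideanSpace.single j 1)
        gcongr
        simpa using this
    _ = m * ‖A‖ ^ 2 := by simp

theorem isProjBall_projBall {m n : ℕ} (L : ℝ≥0) (A : Vec m →L[ℝ] Vec n) :
    IsProjBall L A (projBall L A) :=
  (existsUnique_isProjBall L A).choose_spec.1

theorem norm_projBall_le {m n : ℕ} (L : ℝ≥0) (A : Vec m →L[ℝ] Vec n) : ‖projBall L A‖ ≤ L :=
  (isProjBall_projBall L A).1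

/-- The variational inequality of a projection: moving from P towards B stays in the convex ball, so
the squared distance to A cannot decrease to first order. -/
theorem IsProjBall.inner_nonneg {m n : ℕ} {L : ℝ≥0} {A P B : Vec m →L[ℝ] Vec n}
    (h : IsProjBall L A P) (hB : ‖B‖ ≤ L) :
    0 ≤ inner ℝ (frobPi m n (P - A)) (frobPi m n (B - P)) := by
  by_contra! hneg
  set a := inner ℝ (frobPi m n (P - A)) (frobPi m n (B - P)) with ha
  set b := frobSq (B - P)
  have hb : 0 ≤ b := frobSq_nonneg _
  have key : ∀ θ : ℝ, 0 ≤ θ → θ ≤ 1 → 0 ≤ 2 * θ * a + θ ^ 2 * b := by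
    intro θ h0 h1
    have hQ : ‖(1 - θ) • P + θ • B‖ ≤ L := by
      calc ‖(1 - θ) • P + θ • B‖ ≤ ‖(1 - θ) • P‖ + ‖θ • B‖ := norm_add_le _ _
        _ = (1 - θ) * ‖P‖ + θ * ‖B‖ := by
            rw [norm_smul, norm_smul, Real.norm_of_nonneg h0, Real.norm_of_nonneg (by linarith)]
        _ ≤ (1 - θ) * L + θ * L := by
            have := h.1
            have : 0 ≤ 1 - θ := by linarith
            gcongr
        _ = L := by ring
    have h2 := h.2 _ hQ
    have e : (1 - θ) • P + θ • B - A = (P - A) + θ • (B - P) := by module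
    rw [e, ← norm_frobPi_sq, ← norm_frobPi_sq, map_add, map_smul, norm_add_sq_real, inner_smul_right,
      norm_smul, mul_pow, norm_frobPi_sq (B - P), Real.norm_eq_abs, sq_abs] at h2
    linarith
  -- With this θ one has θ b ≤ -a, hence 2 a + θ b ≤ a < 0, against `key`.
  have hθ : 0 < -a / (-a + b) := by apply div_pos <;> linarith
  have hθ1 : -a / (-a + b) ≤ 1 := by rw [div_le_one (by linarith)]; linarith
  have h3 := key _ hθ.le hθ1
  set θ := -a / (-a + b) with hθd
  have h4 : θ * (-a + b) = -a := by rw [hθd, div_mul_cancel₀ _ (by linarith)]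
  have h5 : 2 * θ * a + θ ^ 2 * b = θ * (2 * a + θ * b) := by ring
  have h6 : θ * b ≤ -a := by nlinarith
  nlinarith

/-- Split a - b as (p - q) plus a remainder. Twice their inner product is the sum of the two
variational inequalities, each tested with the other projection. -/
theorem projBall_nonexpansive {m n : ℕ} (L : ℝ≥0) (A B : Vec m →L[ℝ] Vec n) :
    frobSq (projBall L A - projBall L B) ≤ frobSq (A - B) := by
  have h1 := (isProjBall_projBall L A).inner_nonneg (norm_projBall_le L B)
  have h2 := (isProjBall_projBall L B).inner_nonneg (norm_projBall_le L A)
  rw [← norm_frobPi_sq, ← norm_frobPi_sq]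
  set φ := frobPi m n
  simp only [map_sub] at *
  set a := φ A
  set b := φ B
  set p := φ (projBall L A)
  set q := φ (projBall L B)
  have e : ‖a - b‖ ^ 2 = ‖p - q‖ ^ 2 + ‖(a - b) - (p - q)‖ ^ 2 + 2 * inner ℝ (p - a) (q - p)
      + 2 * inner ℝ (q - b) (p - q) := by
    have e1 : a - b = (p - q) + ((a - b) - (p - q)) := by abel
    conv_lhs => rw [e1, norm_add_sq_real]
    have e2 : inner ℝ (q - b) (p - q) = - inner ℝ (q - b) (q - p) := by
      rw [← inner_neg_right]; congr 1; abel
    have e3 : inner ℝ (p - q) ((a - b) - (p - q))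
      = inner ℝ (p - a) (q - p) - inner ℝ (q - b) (q - p) := by
      rw [← inner_sub_left, real_inner_comm]
      rw [← inner_neg_neg]; congr 1 <;> abel
    rw [e3, e2]; ring
  nlinarith [sq_nonneg ‖(a - b) - (p - q)‖]

theorem projBall_of_norm_le {m n : ℕ} {L : ℝ≥0} {B : Vec m →L[ℝ] Vec n} (hB : ‖B‖ ≤ L) :
    projBall L B = B := by
  have h := (isProjBall_projBall L B).2 B hB
  rw [sub_self] at h
  have h0 : frobSq (0 : Vec m →L[ℝ] Vec n) = 0 := by simp [frobSq]
  exact sub_eq_zero.1 (frobSq_eq_zero (h.trans h0.le))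

/-- The true Jacobian lies in the ball and is its own projection, so projecting an estimator never
increases its error. -/
theorem frobSq_projBall_sub_le {m n : ℕ} {L : ℝ≥0} (A : Vec m →L[ℝ] Vec n)
    {B : Vec m →L[ℝ] Vec n} (hB : ‖B‖ ≤ L) : frobSq (projBall L A - B) ≤ frobSq (A - B) := by
  conv_lhs => rw [← projBall_of_norm_le hB]
  exact projBall_nonexpansive L A B

theorem continuous_projBall {m n : ℕ} (L : ℝ≥0) :
    Continuous (projBall L : (Vec m →L[ℝ] Vec n) → Vec m →L[ℝ] Vec n) := by
  refine (LipschitzWith.of_dist_le_mul (K := Real.toNNReal √m) fun A B => ?_).continuous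
  rw [dist_eq_norm, dist_eq_norm, Real.coe_toNNReal _ (Real.sqrt_nonneg _)]
  refine (sq_le_sq₀ (norm_nonneg _) (by positivity)).1 ?_
  rw [mul_pow, Real.sq_sqrt (by positivity)]
  exact (norm_sq_le_frobSq _).trans ((projBall_nonexpansive L A B).trans (frobSq_le_mul_norm_sq _))

theorem continuous_frobSq {m n : ℕ} : Continuous (frobSq : (Vec m →L[ℝ] Vec n) → ℝ) := by
  unfold frobSq
  fun_prop

/-! ### The chain rule for the composition, and its stability -/

section Chain

variable {d : ℕ → ℕ}

/-- The Jacobians of the levels along the exact evaluation of the composition at `w`. -/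
def levelJac (f : (i : ℕ) → Vec (d i) → Vec (d (i + 1))) (w : Vec (d 0)) (i : ℕ) :
    Vec (d i) →L[ℝ] Vec (d (i + 1)) :=
  fderiv ℝ (f i) (compose f w i)

/-- Sensitivity of the chain rule gradient to errors in the values and Jacobians of the levels. -/
def gradConst (K : ℕ) (Lf LJ : ℝ≥0) : ℝ := K * (1 + LJ) * (1 + Lf) ^ (2 * K)

theorem gradConst_nonneg (K : ℕ) (Lf LJ : ℝ≥0) : 0 ≤ gradConst K Lf LJ := by
  unfold gradConst; positivity

theorem hasFDerivAt_compose {K : ℕ} {f : (i : ℕ) → Vec (d i) → Vec (d (i + 1))}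
    (hf : ∀ i < K, Differentiable ℝ (f i)) (w : Vec (d 0)) :
    ∀ n ≤ K, HasFDerivAt (fun w => compose f w n) (jacProd (levelJac f w) n) w
  | 0, _ => hasFDerivAt_id w
  | n + 1, h =>
    ((hf n h (compose f w n)).hasFDerivAt).comp w (hasFDerivAt_compose hf w n (by omega))

theorem inner_chainGrad (K : ℕ) (hd : d K = 1) (V : (i : ℕ) → Vec (d i) →L[ℝ] Vec (d (i + 1)))
    (x : Vec (d 0)) : inner ℝ (chainGrad K hd V) x = jacProd V K x (Fin.cast hd.symm 0) := by
  unfold chainGrad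
  rw [ContinuousLinearMap.adjoint_inner_left, EuclideanSpace.inner_single_left]
  simp

theorem hasGradientAt_objective {K : ℕ} (hd : d K = 1)
    {f : (i : ℕ) → Vec (d i) → Vec (d (i + 1))}
    (hf : ∀ i < K, Differentiable ℝ (f i)) (w : Vec (d 0)) :
    HasGradientAt (objective K hd f) (chainGrad K hd (levelJac f w)) w := by
  rw [hasGradientAt_iff_hasFDerivAt]
  have h : HasFDerivAt (objective K hd f) _ w :=
    (EuclideanSpace.proj (𝕜 := ℝ) (Fin.cast hd.symm 0)).hasFDerivAt.comp w
      (hasFDerivAt_compose hf w K le_rfl)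
  refine h.congr_fderiv ?_
  ext x
  rw [InnerProductSpace.toDual_apply_apply, inner_chainGrad]
  rfl

theorem gradient_objective {K : ℕ} (hd : d K = 1) {f : (i : ℕ) → Vec (d i) → Vec (d (i + 1))}
    (hf : ∀ i < K, Differentiable ℝ (f i)) (w : Vec (d 0)) :
    gradient (objective K hd f) w = chainGrad K hd (levelJac f w) :=
  (hasGradientAt_objective hd hf w).gradient

theorem norm_chainGrad_sub_le (K : ℕ) (hd : d K = 1)
    (V V' : (i : ℕ) → Vec (d i) →L[ℝ] Vec (d (i + 1))) :
    ‖chainGrad K hd V - chainGrad K hd V'‖ ≤ ‖jacProd V K - jacProd V' K‖ := by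
  unfold chainGrad
  rw [← sub_apply, ← map_sub]
  refine (ContinuousLinearMap.le_opNorm _ _).trans ?_
  rw [LinearIsometryEquiv.norm_map]
  simp

theorem norm_chainGrad_le (K : ℕ) (hd : d K = 1)
    (V : (i : ℕ) → Vec (d i) →L[ℝ] Vec (d (i + 1))) : ‖chainGrad K hd V‖ ≤ ‖jacProd V K‖ := by
  unfold chainGrad
  refine (ContinuousLinearMap.le_opNorm _ _).trans ?_
  rw [LinearIsometryEquiv.norm_map]
  simp

theorem norm_jacProd_le {K : ℕ} {Lf : ℝ≥0} {V : (i : ℕ) → Vec (d i) →L[ℝ] Vec (d (i + 1))}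
    (hV : ∀ i < K, ‖V i‖ ≤ Lf) : ∀ n ≤ K, ‖jacProd V n‖ ≤ Lf ^ n
  | 0, _ => by simpa [jacProd] using ContinuousLinearMap.norm_id_le
  | n + 1, h => by
    rw [jacProd, pow_succ, mul_comm]
    refine (ContinuousLinearMap.opNorm_comp_le _ _).trans ?_
    have := hV n h
    have := norm_jacProd_le hV n (by omega)
    gcongr

theorem norm_levelJac_le {K : ℕ} {Lf : ℝ≥0} {f : (i : ℕ) → Vec (d i) → Vec (d (i + 1))}
    (hL : ∀ i < K, LipschitzWith Lf (f i)) (w : Vec (d 0)) : ∀ i < K, ‖levelJac f w i‖ ≤ Lf :=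
  fun i hi => norm_fderiv_le_of_lipschitz ℝ (hL i hi)

/-- Makes the squared gradient integrable along the trajectory without any moment bound on the
iterates. -/
theorem norm_gradient_objective_le {K : ℕ} (hd : d K = 1) {Lf : ℝ≥0}
    {f : (i : ℕ) → Vec (d i) → Vec (d (i + 1))}
    (hf : ∀ i < K, Differentiable ℝ (f i)) (hL : ∀ i < K, LipschitzWith Lf (f i)) (w : Vec (d 0)) :
    ‖gradient (objective K hd f) w‖ ≤ Lf ^ K := by
  rw [gradient_objective hd hf]
  exact (norm_chainGrad_le K hd _).trans (norm_jacProd_le (norm_levelJac_le hL w) K le_rfl)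

/-- Total error of estimated values `u` and Jacobians `v` of the first `n` levels. -/
def defect (f : (i : ℕ) → Vec (d i) → Vec (d (i + 1))) (X : State d) (n : ℕ) : ℝ :=
  ∑ i ∈ Finset.range n, (‖X.u (i + 1) - f i (X.u i)‖ + ‖X.v i - fderiv ℝ (f i) (X.u i)‖)

theorem defect_succ (f : (i : ℕ) → Vec (d i) → Vec (d (i + 1))) (X : State d) (n : ℕ) :
    defect f X (n + 1) =
      defect f X n + (‖X.u (n + 1) - f n (X.u n)‖ + ‖X.v n - fderiv ℝ (f n) (X.u n)‖) :=
  Finset.sum_range_succ _ _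

theorem defect_nonneg (f : (i : ℕ) → Vec (d i) → Vec (d (i + 1))) (X : State d) (n : ℕ) :
    0 ≤ defect f X n :=
  Finset.sum_nonneg fun _ _ => by positivity

/-- The deviation at a level is its own estimation error plus `Lf` times the deviation one level
below. The base point `w` is free, so that one bound serves both for estimation errors and for the
Lipschitz continuity of the gradient. -/
theorem norm_sub_compose_le {K : ℕ} {Lf : ℝ≥0} {f : (i : ℕ) → Vec (d i) → Vec (d (i + 1))}
    (hL : ∀ i < K, LipschitzWith Lf (f i)) (X : State d) (w : Vec (d 0)) :
    ∀ n ≤ K, ‖X.u n - compose f w n‖ ≤ (1 + Lf : ℝ) ^ n * (‖X.u 0 - w‖ + defect f X n)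
  | 0, _ => by simp [compose, defect]
  | n + 1, h => by
    have ih := norm_sub_compose_le hL X w n (by omega)
    have h1 := (hL n h).norm_sub_le (X.u n) (compose f w n)
    set e := ‖X.u (n + 1) - f n (X.u n)‖ with he
    have h2 : ‖X.u (n + 1) - compose f w (n + 1)‖ ≤ e + Lf * ‖X.u n - compose f w n‖ := by
      refine (norm_sub_le_norm_sub_add_norm_sub _ (f n (X.u n)) _).trans ?_
      simp only [compose]
      gcongr
    have h3 : defect f X (n + 1) = defect f X n + (e + ‖X.v n - fderiv ℝ (f n) (X.u n)‖) :=
      defect_succ f X n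
    have h4 : (1 : ℝ) ≤ (1 + Lf : ℝ) ^ (n + 1) := one_le_pow₀ (by simp)
    have h5 : 0 ≤ ‖X.u 0 - w‖ + defect f X n := by
      have := defect_nonneg f X n; positivity
    have h6 : (Lf : ℝ) * (1 + Lf : ℝ) ^ n ≤ (1 + Lf : ℝ) ^ (n + 1) := by
      rw [pow_succ, mul_comm]; gcongr; simp
    calc ‖X.u (n + 1) - compose f w (n + 1)‖ ≤ e + Lf * ‖X.u n - compose f w n‖ := h2
      _ ≤ 1 * e + Lf * ((1 + Lf : ℝ) ^ n * (‖X.u 0 - w‖ + defect f X n)) := by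
          rw [one_mul]; gcongr
      _ ≤ (1 + Lf : ℝ) ^ (n + 1) * e +
          (1 + Lf : ℝ) ^ (n + 1) * (‖X.u 0 - w‖ + defect f X n) := by
          rw [← mul_assoc]; gcongr
      _ ≤ (1 + Lf : ℝ) ^ (n + 1) * (‖X.u 0 - w‖ + defect f X (n + 1)) := by
          rw [h3, ← mul_add]
          refine mul_le_mul_of_nonneg_left ?_ (by positivity)
          linarith [norm_nonneg (X.v n - fderiv ℝ (f n) (X.u n))]

theorem norm_jacProd_sub_le {K : ℕ} {Lf LJ : ℝ≥0} {f : (i : ℕ) → Vec (d i) → Vec (d (i + 1))}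
    (hL : ∀ i < K, LipschitzWith Lf (f i)) (hJ : ∀ i < K, LipschitzWith LJ (fderiv ℝ (f i)))
    (X : State d) (hV : ∀ i < K, ‖X.v i‖ ≤ Lf) (w : Vec (d 0)) :
    ∀ n ≤ K, ‖jacProd X.v n - jacProd (levelJac f w) n‖ ≤
      n * (1 + LJ) * (1 + Lf : ℝ) ^ (2 * n) * (‖X.u 0 - w‖ + defect f X n)
  | 0, _ => by simp [jacProd]
  | n + 1, h => by
    have ih := norm_jacProd_sub_le hL hJ X hV w n (by omega)
    have ha := norm_sub_compose_le hL X w n (by omega)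
    have hP := norm_jacProd_le (norm_levelJac_le hL w) n (by omega)
    set ζ := ‖X.v n - fderiv ℝ (f n) (X.u n)‖ with hζ
    set S := ‖X.u 0 - w‖ + defect f X n with hS
    set S' := ‖X.u 0 - w‖ + defect f X (n + 1) with hS'
    have h3 : S' = S + (‖X.u (n + 1) - f n (X.u n)‖ + ζ) := by
      rw [hS', hS, defect_succ]; ring
    have hS0 : 0 ≤ S := by rw [hS]; have := defect_nonneg f X n; positivity
    have hSζ : S + ζ ≤ S' := by rw [h3]; linarith [norm_nonneg (X.u (n + 1) - f n (X.u n))]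
    have hζ0 : 0 ≤ ζ := norm_nonneg _
    have hΛ : (1 : ℝ) ≤ 1 + Lf := by simp
    have hdiff : ‖X.v n - levelJac f w n‖ ≤ (1 + LJ) * (1 + Lf : ℝ) ^ n * S' := by
      have h1 : ‖X.v n - levelJac f w n‖ ≤ ζ + LJ * ‖X.u n - compose f w n‖ := by
        refine (norm_sub_le_norm_sub_add_norm_sub _ (fderiv ℝ (f n) (X.u n)) _).trans ?_
        have := (hJ n h).norm_sub_le (X.u n) (compose f w n)
        rw [levelJac]
        gcongr
      have h4 : (1 : ℝ) ≤ (1 + Lf : ℝ) ^ n := one_le_pow₀ hΛ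
      calc ‖X.v n - levelJac f w n‖ ≤ 1 * ζ + LJ * ((1 + Lf : ℝ) ^ n * S) := by
            rw [one_mul]; refine h1.trans ?_; gcongr
        _ ≤ ((1 + LJ) * (1 + Lf : ℝ) ^ n) * ζ + (1 + LJ) * ((1 + Lf : ℝ) ^ n * S) := by
            gcongr
            · exact one_le_mul_of_one_le_of_one_le (by simp) h4
            · simp
        _ = (1 + LJ) * (1 + Lf : ℝ) ^ n * (S + ζ) := by ring
        _ ≤ _ := by gcongr
    -- Telescoping of the product. The bound on the estimated Jacobian is needed in the first term;
    -- the exact product in the second is bounded by the Lipschitz constants.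
    have e : jacProd X.v (n + 1) - jacProd (levelJac f w) (n + 1) =
        (X.v n).comp (jacProd X.v n - jacProd (levelJac f w) n) +
          (X.v n - levelJac f w n).comp (jacProd (levelJac f w) n) := by
      ext x; simp [jacProd]
    rw [e]
    calc _ ≤ ‖X.v n‖ * ‖jacProd X.v n - jacProd (levelJac f w) n‖ +
          ‖X.v n - levelJac f w n‖ * ‖jacProd (levelJac f w) n‖ :=
        (norm_add_le _ _).trans (add_le_add (ContinuousLinearMap.opNorm_comp_le _ _)
          (ContinuousLinearMap.opNorm_comp_le _ _))
      _ ≤ (1 + Lf) ^ 2 * (n * (1 + LJ) * (1 + Lf : ℝ) ^ (2 * n) * S') +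
          (1 + LJ) * (1 + Lf : ℝ) ^ n * S' * ((1 + Lf) ^ n * (1 + Lf) ^ 2) := by
        have := hV n h
        have h7 : (1 + Lf : ℝ) ≤ (1 + Lf : ℝ) ^ 2 := by nlinarith
        have h8 : ‖X.v n‖ ≤ (1 + Lf : ℝ) ^ 2 := by linarith
        have h9 : (Lf : ℝ) ^ n ≤ (1 + Lf : ℝ) ^ n * (1 + Lf) ^ 2 := by
          calc (Lf : ℝ) ^ n ≤ (1 + Lf : ℝ) ^ n * 1 := by
                rw [mul_one]; gcongr; simp
            _ ≤ _ := by gcongr; exact one_le_pow₀ hΛ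
        have h10 : ‖jacProd X.v n - jacProd (levelJac f w) n‖ ≤
            n * (1 + LJ) * (1 + Lf : ℝ) ^ (2 * n) * S' :=
          ih.trans (by gcongr; linarith)
        have hS'0 : 0 ≤ S' := by linarith
        gcongr
        exact hP.trans h9
      _ = _ := by push_cast; ring

theorem norm_chainGrad_sub_gradient_le {K : ℕ} (hd : d K = 1) {Lf LJ : ℝ≥0}
    {f : (i : ℕ) → Vec (d i) → Vec (d (i + 1))} (hf : ∀ i < K, Differentiable ℝ (f i))
    (hL : ∀ i < K, LipschitzWith Lf (f i)) (hJ : ∀ i < K, LipschitzWith LJ (fderiv ℝ (f i)))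
    (X : State d) (hV : ∀ i < K, ‖X.v i‖ ≤ Lf) (w : Vec (d 0)) :
    ‖chainGrad K hd X.v - gradient (objective K hd f) w‖ ≤
      gradConst K Lf LJ * (‖X.u 0 - w‖ + defect f X K) := by
  rw [gradient_objective hd hf]
  exact (norm_chainGrad_sub_le K hd _ _).trans (norm_jacProd_sub_le hL hJ X hV w K le_rfl)

/-- The exact evaluation at `w'` is a state without defect, so comparing it with `w` leaves only the
displacement. -/
theorem norm_gradient_sub_gradient_le {K : ℕ} (hd : d K = 1) {Lf LJ : ℝ≥0}
    {f : (i : ℕ) → Vec (d i) → Vec (d (i + 1))} (hf : ∀ i < K, Differentiable ℝ (f i))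
    (hL : ∀ i < K, LipschitzWith Lf (f i)) (hJ : ∀ i < K, LipschitzWith LJ (fderiv ℝ (f i)))
    (w w' : Vec (d 0)) :
    ‖gradient (objective K hd f) w' - gradient (objective K hd f) w‖ ≤
      gradConst K Lf LJ * ‖w' - w‖ := by
  have h := norm_chainGrad_sub_gradient_le hd hf hL hJ ⟨compose f w', levelJac f w'⟩
    (norm_levelJac_le hL w') w
  have h0 : defect f ⟨compose f w', levelJac f w'⟩ K = 0 := by
    simp [defect, compose, levelJac]
  rw [h0, add_zero] at h
  rwa [gradient_objective hd hf w']

/-- The total squared estimation error of a state. -/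
def sqError (K : ℕ) (f : (i : ℕ) → Vec (d i) → Vec (d (i + 1))) (X : State d) : ℝ :=
  ∑ i ∈ Finset.range K,
    (‖X.u (i + 1) - f i (X.u i)‖ ^ 2 + frobSq (X.v i - fderiv ℝ (f i) (X.u i)))

theorem sqError_nonneg (K : ℕ) (f : (i : ℕ) → Vec (d i) → Vec (d (i + 1))) (X : State d) :
    0 ≤ sqError K f X :=
  Finset.sum_nonneg fun _ _ => add_nonneg (sq_nonneg _) (frobSq_nonneg _)

theorem defect_sq_le (K : ℕ) (f : (i : ℕ) → Vec (d i) → Vec (d (i + 1))) (X : State d) :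
    defect f X K ^ 2 ≤ 2 * K * sqError K f X := by
  refine sq_sum_le_card_mul_sum_sq.trans ?_
  rw [Finset.card_range, mul_comm (2 : ℝ), mul_assoc, sqError, Finset.mul_sum (a := (2 : ℝ))]
  gcongr with i
  refine add_sq_le.trans ?_
  gcongr
  exact norm_sq_le_frobSq _

/-- Constant of the bound of the squared gradient error by the squared estimation error. -/
def errConst (K : ℕ) (Lf LJ : ℝ≥0) : ℝ := 2 + 2 * K * gradConst K Lf LJ ^ 2

/-- The summand 2 of the constant is there so that half of `errConst * sqError` dominates `sqError`
when the potential is summed. -/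
theorem two_le_errConst (K : ℕ) (Lf LJ : ℝ≥0) : 2 ≤ errConst K Lf LJ := by
  have := gradConst_nonneg K Lf LJ
  unfold errConst
  have : 0 ≤ 2 * K * gradConst K Lf LJ ^ 2 := by positivity
  linarith

theorem norm_chainGrad_sub_gradient_sq_le {K : ℕ} (hd : d K = 1) {Lf LJ : ℝ≥0}
    {f : (i : ℕ) → Vec (d i) → Vec (d (i + 1))} (hf : ∀ i < K, Differentiable ℝ (f i))
    (hL : ∀ i < K, LipschitzWith Lf (f i)) (hJ : ∀ i < K, LipschitzWith LJ (fderiv ℝ (f i)))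
    (X : State d) (hV : ∀ i < K, ‖X.v i‖ ≤ Lf) :
    ‖chainGrad K hd X.v - gradient (objective K hd f) (X.u 0)‖ ^ 2 ≤
      errConst K Lf LJ * sqError K f X := by
  have h := norm_chainGrad_sub_gradient_le hd hf hL hJ X hV (X.u 0)
  rw [sub_self, norm_zero, zero_add] at h
  calc _ ≤ (gradConst K Lf LJ * defect f X K) ^ 2 := by gcongr
    _ = gradConst K Lf LJ ^ 2 * defect f X K ^ 2 := by ring
    _ ≤ gradConst K Lf LJ ^ 2 * (2 * K * sqError K f X) := by gcongr; exact defect_sq_le K f X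
    _ ≤ _ := by
      have := sqError_nonneg K f X
      unfold errConst
      nlinarith

/-- A gradient step on a function with Lipschitz gradient decreases it, up to the error of the
gradient estimate. -/
theorem descent {E : Type*} [NormedAddCommGroup E] [InnerProductSpace ℝ E] [CompleteSpace E]
    {F : E → ℝ} (hF : Differentiable ℝ F) {L : ℝ} (hL0 : 0 ≤ L)
    (hL : ∀ x y, ‖gradient F y - gradient F x‖ ≤ L * ‖y - x‖)
    {η : ℝ} (hη : 0 ≤ η) (hηL : η * L ≤ 1 / 4) (w v : E) :
    F (w - η • v) + η / 2 * ‖gradient F w‖ ^ 2 + η / 4 * ‖v‖ ^ 2 ≤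
      F w + η / 2 * ‖v - gradient F w‖ ^ 2 := by
  set g := gradient F w with hg
  have hgrad : ∀ x y, inner ℝ (gradient F x) y = fderiv ℝ F x y := by
    intro x y
    have := (hF x).hasGradientAt.hasFDerivAt.fderiv
    rw [this]; rfl
  have hfd : ∀ x ∈ segment ℝ w (w - η • v), ‖fderiv ℝ F x - fderiv ℝ F w‖ ≤ L * ‖η • v‖ := by
    intro x hx
    refine ContinuousLinearMap.opNorm_le_bound _ (by positivity) fun y => ?_
    rw [sub_apply, ← hgrad, ← hgrad, ← inner_sub_left]
    refine (norm_inner_le_norm _ _).trans ?_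
    gcongr
    refine (hL w x).trans ?_
    gcongr
    have := norm_sub_le_of_mem_segment hx
    simpa using this
  -- The mean value inequality for F minus its linearisation at w. The remainder is L η² ‖v‖²
  -- instead of half of it, which η L ≤ 1/4 affords.
  have h := (convex_segment w (w - η • v)).norm_image_sub_le_of_norm_fderiv_le'
    (fun x _ => hF x) hfd (left_mem_segment ℝ _ _) (right_mem_segment ℝ _ _)
  rw [← hgrad, ← hg] at h
  have e1 : w - η • v - w = -(η • v) := by abel
  rw [e1, inner_neg_right, inner_smul_right, norm_neg, norm_smul, Real.norm_of_nonneg hη] at h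
  have h1 := (abs_le.1 ((Real.norm_eq_abs _).symm.le.trans h)).2
  -- Polarisation turns -η ⟨g, v⟩ into η/2 (‖v - g‖² - ‖v‖² - ‖g‖²); the remainder uses up half of
  -- the term with ‖v‖².
  have h2 := norm_sub_sq_real v g
  rw [real_inner_comm] at h2
  have h3 : L * (η * ‖v‖) * (η * ‖v‖) ≤ η / 4 * ‖v‖ ^ 2 := by
    have : η * (η * L) * ‖v‖ ^ 2 ≤ η * (1 / 4) * ‖v‖ ^ 2 := by gcongr
    nlinarith
  nlinarith

end Chain

/-! ### Mean square error of one update of a variance reduced estimator -/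

section Oracle

/-- The oracle bounds are stated for extended nonnegative integrals, so that finiteness is part of
them; this recovers Bochner integrability. -/
theorem integrable_of_lintegral_ofReal_le {Ω : Type*} [MeasurableSpace Ω] {P : Measure Ω}
    {h : Ω → ℝ} (hm : Measurable h) (h0 : ∀ ω, 0 ≤ h ω) {b : ℝ}
    (hb : ∫⁻ ω, ENNReal.ofReal (h ω) ∂P ≤ ENNReal.ofReal b) : Integrable h P := by
  refine ⟨hm.aestronglyMeasurable, ?_⟩
  rw [hasFiniteIntegral_iff_ofReal (.of_forall h0)]
  exact hb.trans_lt ENNReal.ofReal_lt_top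

theorem integral_le_of_lintegral_ofReal_le {Ω : Type*} [MeasurableSpace Ω] {P : Measure Ω}
    {h : Ω → ℝ} (hm : Measurable h) (h0 : ∀ ω, 0 ≤ h ω) {b : ℝ} (hb0 : 0 ≤ b)
    (hb : ∫⁻ ω, ENNReal.ofReal (h ω) ∂P ≤ ENNReal.ofReal b) : ∫ ω, h ω ∂P ≤ b := by
  rw [integral_eq_lintegral_of_nonneg_ae (.of_forall h0) hm.aestronglyMeasurable]
  exact ENNReal.toReal_le_of_le_ofReal hb0 hb

variable {Ξ : Type*} [MeasurableSpace Ξ] {D : Measure Ξ} [IsProbabilityMeasure D]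
  {H : Type*} [NormedAddCommGroup H] [InnerProductSpace ℝ H]

theorem norm_add_sq_le_two (a b : H) : ‖a + b‖ ^ 2 ≤ 2 * ‖a‖ ^ 2 + 2 * ‖b‖ ^ 2 := by
  have := parallelogram_law_with_norm ℝ a b
  nlinarith [sq_nonneg ‖a - b‖]

theorem integral_norm_const_add_sq [CompleteSpace H] {Z : Ξ → H} (hZ : MemLp Z 2 D) (a : H) :
    ∫ x, ‖a + Z x‖ ^ 2 ∂D =
      ‖a‖ ^ 2 + 2 * inner ℝ a (∫ x, Z x ∂D) + ∫ x, ‖Z x‖ ^ 2 ∂D := by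
  have h1 : Integrable Z D := hZ.integrable one_le_two
  have h2 : Integrable (fun x => ‖Z x‖ ^ 2) D := (memLp_two_iff_integrable_sq_norm hZ.1).1 hZ
  have h3 : Integrable (fun x => inner ℝ a (Z x)) D := h1.const_inner a
  simp_rw [norm_add_sq_real]
  rw [integral_add (by fun_prop) h2, integral_add (by fun_prop) (by fun_prop),
    integral_const_mul, integral_inner h1]
  simp

theorem integral_norm_sub_mean_sq_le [CompleteSpace H] {Z : Ξ → H} (hZ : MemLp Z 2 D) :
    ∫ x, ‖Z x - ∫ y, Z y ∂D‖ ^ 2 ∂D ≤ ∫ x, ‖Z x‖ ^ 2 ∂D := by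
  have h := integral_norm_const_add_sq hZ (-∫ y, Z y ∂D)
  simp_rw [neg_add_eq_sub] at h
  rw [h, inner_neg_left, real_inner_self_eq_norm_sq, norm_neg]
  nlinarith [sq_nonneg ‖∫ y, Z y ∂D‖]

theorem norm_combination_sq_le {β : ℝ} (hβ0 : 0 ≤ β) (hβ1 : β ≤ 1) (a b : H) :
    ‖β • a + (1 - β) • b‖ ^ 2 ≤ 2 * β ^ 2 * ‖a‖ ^ 2 + 2 * ‖b‖ ^ 2 := by
  refine (norm_add_sq_le_two _ _).trans ?_
  rw [norm_smul, norm_smul, mul_pow, mul_pow, Real.norm_eq_abs, Real.norm_eq_abs, sq_abs, sq_abs]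
  have h : (1 - β) ^ 2 ≤ 1 := by nlinarith
  have := mul_le_mul_of_nonneg_right h (sq_nonneg ‖b‖)
  linarith

theorem lintegral_norm_const_add_sq_le [CompleteSpace H] {N : Ξ → H} (hN : MemLp N 2 D)
    (h0 : ∫ x, N x ∂D = 0) {b : ℝ} (hb : ∫ x, ‖N x‖ ^ 2 ∂D ≤ b) (a : H) :
    ∫⁻ x, ENNReal.ofReal (‖a + N x‖ ^ 2) ∂D ≤ ENNReal.ofReal (‖a‖ ^ 2 + b) := by
  have mX : MemLp (fun x => a + N x) 2 D := (memLp_const a).add hN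
  rw [← ofReal_integral_eq_lintegral_ofReal ((memLp_two_iff_integrable_sq_norm mX.1).1 mX)
    (.of_forall fun _ => sq_nonneg _)]
  refine ENNReal.ofReal_le_ofReal ?_
  rw [integral_norm_const_add_sq hN, h0, inner_zero_right]
  linarith

theorem integral_norm_noise_sq_le {A B : Ξ → H} (mA : MemLp A 2 D) (mB : MemLp B 2 D)
    {s r : ℝ} (hs : ∫ x, ‖A x‖ ^ 2 ∂D ≤ s) (hr : ∫ x, ‖B x‖ ^ 2 ∂D ≤ r)
    {β : ℝ} (hβ0 : 0 ≤ β) (hβ1 : β ≤ 1) :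
    ∫ x, ‖β • A x + (1 - β) • B x‖ ^ 2 ∂D ≤ 2 * β ^ 2 * s + 2 * r := by
  have sqI : ∀ {Z : Ξ → H}, MemLp Z 2 D → Integrable (fun x => ‖Z x‖ ^ 2) D :=
    fun hZ => (memLp_two_iff_integrable_sq_norm hZ.1).1 hZ
  have mN : MemLp (fun x => β • A x + (1 - β) • B x) 2 D :=
    (mA.const_smul β).add (mB.const_smul (1 - β))
  have iA : Integrable (fun x => 2 * β ^ 2 * ‖A x‖ ^ 2) D := (sqI mA).const_mul _
  have iB : Integrable (fun x => 2 * ‖B x‖ ^ 2) D := (sqI mB).const_mul _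
  calc _ ≤ ∫ x, (2 * β ^ 2 * ‖A x‖ ^ 2 + 2 * ‖B x‖ ^ 2) ∂D :=
        integral_mono (sqI mN) (iA.add iB) fun x => norm_combination_sq_le hβ0 hβ1 _ _
    _ = 2 * β ^ 2 * ∫ x, ‖A x‖ ^ 2 ∂D + 2 * ∫ x, ‖B x‖ ^ 2 ∂D := by
        rw [integral_add iA iB, integral_const_mul, integral_const_mul]
    _ ≤ _ := by gcongr

theorem memLp_two_of_lintegral_le {E : Type*} [NormedAddCommGroup E] [MeasurableSpace E]
    [BorelSpace E] [SecondCountableTopology E] {Z : Ξ → E} (hZ : Measurable Z) {a : E} {b : ℝ}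
    (hb : ∫⁻ x, ENNReal.ofReal (‖Z x - a‖ ^ 2) ∂D ≤ ENNReal.ofReal b) : MemLp Z 2 D := by
  have h1 : MemLp (fun x => Z x - a) 2 D :=
    (memLp_two_iff_integrable_sq_norm (hZ.sub_const a).aestronglyMeasurable).2
      (integrable_of_lintegral_ofReal_le (by fun_prop) (fun _ => sq_nonneg _) hb)
  have e : Z = (fun x => Z x - a) + fun _ => a := by ext; simp
  rw [e]
  exact h1.add (memLp_const a)

variable [MeasurableSpace H] [BorelSpace H] [SecondCountableTopology H]

/-- The new error is (1 - β)(p - g₀) plus β (G₁ - g₁) + (1 - β)((G₁ - G₀) - (g₁ - g₀)), which has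
mean zero, so no cross term appears. Using the same sample at both points makes the second noise
term as small as the movement of the input. -/
theorem lintegral_norm_update_sub_sq_le [CompleteSpace H] {G₀ G₁ : Ξ → H} (hG₀ : Measurable G₀)
    (hG₁ : Measurable G₁) {g₀ g₁ : H} (h₀ : ∫ x, G₀ x ∂D = g₀) (h₁ : ∫ x, G₁ x ∂D = g₁)
    {s r : ℝ} (hs : 0 ≤ s) (hr : 0 ≤ r)
    (hs₀ : ∫⁻ x, ENNReal.ofReal (‖G₀ x - g₀‖ ^ 2) ∂D ≤ ENNReal.ofReal s)
    (hs₁ : ∫⁻ x, ENNReal.ofReal (‖G₁ x - g₁‖ ^ 2) ∂D ≤ ENNReal.ofReal s)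
    (hrD : ∫⁻ x, ENNReal.ofReal (‖G₁ x - G₀ x‖ ^ 2) ∂D ≤ ENNReal.ofReal r)
    {β : ℝ} (hβ0 : 0 ≤ β) (hβ1 : β ≤ 1) (p : H) :
    ∫⁻ x, ENNReal.ofReal (‖(1 - β) • p + β • G₁ x + (1 - β) • (G₁ x - G₀ x) - g₁‖ ^ 2) ∂D ≤
      ENNReal.ofReal ((1 - β) * ‖p - g₀‖ ^ 2 + 2 * β ^ 2 * s + 2 * r) := by
  have m₀ := memLp_two_of_lintegral_le hG₀ hs₀
  have m₁ := memLp_two_of_lintegral_le hG₁ hs₁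
  have i₀ : Integrable G₀ D := m₀.integrable one_le_two
  have i₁ : Integrable G₁ D := m₁.integrable one_le_two
  have mZ : MemLp (fun x => G₁ x - G₀ x) 2 D := m₁.sub m₀
  have eZ : ∫ x, (G₁ x - G₀ x) ∂D = g₁ - g₀ := by rw [integral_sub i₁ i₀, h₀, h₁]
  have mA : MemLp (fun x => G₁ x - g₁) 2 D := m₁.sub (memLp_const _)
  have mB : MemLp (fun x => (G₁ x - G₀ x) - (g₁ - g₀)) 2 D := mZ.sub (memLp_const _)
  have iA : Integrable (fun x => β • (G₁ x - g₁)) D := (mA.integrable one_le_two).smul β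
  have iB : Integrable (fun x => (1 - β) • ((G₁ x - G₀ x) - (g₁ - g₀))) D :=
    (mB.integrable one_le_two).smul (1 - β)
  have eN : ∫ x, (β • (G₁ x - g₁) + (1 - β) • ((G₁ x - G₀ x) - (g₁ - g₀))) ∂D = 0 := by
    rw [integral_add iA iB, integral_smul, integral_smul, integral_sub i₁ (integrable_const _), h₁,
      integral_sub (mZ.integrable one_le_two) (integrable_const _), eZ]
    simp
  have bA : ∫ x, ‖G₁ x - g₁‖ ^ 2 ∂D ≤ s :=
    integral_le_of_lintegral_ofReal_le (by fun_prop) (fun _ => sq_nonneg _) hs hs₁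
  have bB : ∫ x, ‖(G₁ x - G₀ x) - (g₁ - g₀)‖ ^ 2 ∂D ≤ r := by
    rw [← eZ]
    exact (integral_norm_sub_mean_sq_le mZ).trans
      (integral_le_of_lintegral_ofReal_le (by fun_prop) (fun _ => sq_nonneg _) hr hrD)
  have h := lintegral_norm_const_add_sq_le ((mA.const_smul β).add (mB.const_smul (1 - β))) eN
    (integral_norm_noise_sq_le mA mB bA bB hβ0 hβ1) ((1 - β) • (p - g₀))
  have e : ∀ x, (1 - β) • p + β • G₁ x + (1 - β) • (G₁ x - G₀ x) - g₁ = (1 - β) • (p - g₀) +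
      (β • (G₁ x - g₁) + (1 - β) • ((G₁ x - G₀ x) - (g₁ - g₀))) := by
    intro x; module
  simp_rw [e]
  refine h.trans (ENNReal.ofReal_le_ofReal ?_)
  rw [norm_smul, mul_pow, Real.norm_eq_abs, sq_abs, add_assoc]
  gcongr
  -- This is (1 - β)² ≤ 1 - β for β in [0, 1].
  nlinarith

/-- The estimator moves by (G₁ - G₀) + β ((G₀ - g₀) - (p - g₀)). The factor β² in front of the old
error is what later lets the contraction absorb it. -/
theorem lintegral_norm_update_sub_self_sq_le {G₀ G₁ : Ξ → H} (hG₀ : Measurable G₀) (hG₁ : Measurable G₁) {g₀ : H}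
    {s r : ℝ} (hs : 0 ≤ s) (hr : 0 ≤ r)
    (hs₀ : ∫⁻ x, ENNReal.ofReal (‖G₀ x - g₀‖ ^ 2) ∂D ≤ ENNReal.ofReal s)
    (hrD : ∫⁻ x, ENNReal.ofReal (‖G₁ x - G₀ x‖ ^ 2) ∂D ≤ ENNReal.ofReal r)
    (β : ℝ) (p : H) :
    ∫⁻ x, ENNReal.ofReal (‖(1 - β) • p + β • G₁ x + (1 - β) • (G₁ x - G₀ x) - p‖ ^ 2) ∂D ≤
      ENNReal.ofReal (2 * r + 4 * β ^ 2 * (s + ‖p - g₀‖ ^ 2)) := by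
  have h : ∀ x, ‖(1 - β) • p + β • G₁ x + (1 - β) • (G₁ x - G₀ x) - p‖ ^ 2 ≤
      2 * ‖G₁ x - G₀ x‖ ^ 2 + (4 * β ^ 2 * ‖G₀ x - g₀‖ ^ 2 + 4 * β ^ 2 * ‖p - g₀‖ ^ 2) := by
    intro x
    have e : (1 - β) • p + β • G₁ x + (1 - β) • (G₁ x - G₀ x) - p =
        (G₁ x - G₀ x) + β • ((G₀ x - g₀) + -(p - g₀)) := by module
    rw [e]
    refine (norm_add_sq_le_two _ _).trans ?_
    have h1 := norm_add_sq_le_two (G₀ x - g₀) (-(p - g₀))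
    rw [norm_neg] at h1
    rw [norm_smul, mul_pow, Real.norm_eq_abs, sq_abs]
    nlinarith [mul_le_mul_of_nonneg_left h1 (sq_nonneg β)]
  have iZ := integrable_of_lintegral_ofReal_le (by fun_prop) (fun _ => sq_nonneg _) hrD
  have iA := integrable_of_lintegral_ofReal_le (by fun_prop) (fun _ => sq_nonneg _) hs₀
  have bZ := integral_le_of_lintegral_ofReal_le (by fun_prop) (fun _ => sq_nonneg _) hr hrD
  have bA := integral_le_of_lintegral_ofReal_le (by fun_prop) (fun _ => sq_nonneg _) hs hs₀
  refine (lintegral_mono fun x => ENNReal.ofReal_le_ofReal (h x)).trans ?_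
  have iS : Integrable (fun x => 4 * β ^ 2 * ‖G₀ x - g₀‖ ^ 2 + 4 * β ^ 2 * ‖p - g₀‖ ^ 2) D :=
    (iA.const_mul _).add (integrable_const _)
  have iT : Integrable (fun x => 2 * ‖G₁ x - G₀ x‖ ^ 2 +
      (4 * β ^ 2 * ‖G₀ x - g₀‖ ^ 2 + 4 * β ^ 2 * ‖p - g₀‖ ^ 2)) D := (iZ.const_mul _).add iS
  rw [← ofReal_integral_eq_lintegral_ofReal iT (.of_forall fun _ => by positivity)]
  refine ENNReal.ofReal_le_ofReal ?_
  rw [integral_add (iZ.const_mul _) iS, integral_add (iA.const_mul _) (integrable_const _),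
    integral_const_mul, integral_const_mul]
  simp only [integral_const, probReal_univ, one_smul]
  have : 4 * β ^ 2 * ∫ x, ‖G₀ x - g₀‖ ^ 2 ∂D ≤ 4 * β ^ 2 * s := by gcongr
  linarith

end Oracle

/-! ### Expectations of functions of fresh samples and of random indices -/

section Probability

variable {Ω : Type*} {m : MeasurableSpace Ω} {mΩ : MeasurableSpace Ω} {P : Measure Ω}
  [IsProbabilityMeasure P]

/-- Independence makes the joint law a product, and Tonelli integrates out the fresh sample with the
past frozen. -/
theorem lintegral_fresh (hm : m ≤ mΩ) {Ξ 𝓨 : Type*} [mΞ : MeasurableSpace Ξ]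
    [MeasurableSpace 𝓨] {ξ : Ω → Ξ}
    (hξ : Measurable ξ) (hind : Indep m (mΞ.comap ξ) P) {Y : Ω → 𝓨} (hY : Measurable[m] Y)
    {h : 𝓨 × Ξ → ℝ≥0∞} (hh : Measurable h) :
    ∫⁻ ω, h (Y ω, ξ ω) ∂P = ∫⁻ ω, ∫⁻ x, h (Y ω, x) ∂(P.map ξ) ∂P := by
  have hY' : Measurable Y := hY.mono hm le_rfl
  have hI : IndepFun Y ξ P :=
    (IndepFun_iff_Indep _ _ _).2 (indep_of_indep_of_le_left hind hY.comap_le)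
  have h1 := (indepFun_iff_map_prod_eq_prod_map_map hY'.aemeasurable hξ.aemeasurable).1 hI
  have : IsProbabilityMeasure (P.map ξ) := Measure.isProbabilityMeasure_map hξ.aemeasurable
  calc ∫⁻ ω, h (Y ω, ξ ω) ∂P = ∫⁻ z, h z ∂(P.map fun ω => (Y ω, ξ ω)) :=
        (lintegral_map hh (hY'.prodMk hξ)).symm
    _ = ∫⁻ y, ∫⁻ x, h (y, x) ∂(P.map ξ) ∂(P.map Y) := by
        rw [h1, lintegral_prod _ hh.aemeasurable]
    _ = _ := lintegral_map hh.lintegral_prod_right' hY'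

/-- If `B` dominates the conditional expectation of a nonnegative function of the past and of a fresh
sample, then it dominates it in expectation. -/
theorem integral_fresh_le (hm : m ≤ mΩ) {Ξ 𝓨 : Type*} [mΞ : MeasurableSpace Ξ]
    [MeasurableSpace 𝓨] {ξ : Ω → Ξ} {D : Measure Ξ} (hD : P.map ξ = D)
    (hξ : Measurable ξ) (hind : Indep m (mΞ.comap ξ) P) {Y : Ω → 𝓨} (hY : Measurable[m] Y)
    {h : 𝓨 × Ξ → ℝ} (hh : Measurable h) (h0 : ∀ z, 0 ≤ h z) {B : Ω → ℝ} (hB : Integrable B P)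
    (hB0 : ∀ ω, 0 ≤ B ω)
    (hle : ∀ ω, ∫⁻ x, ENNReal.ofReal (h (Y ω, x)) ∂D ≤ ENNReal.ofReal (B ω)) :
    Integrable (fun ω => h (Y ω, ξ ω)) P ∧ ∫ ω, h (Y ω, ξ ω) ∂P ≤ ∫ ω, B ω ∂P := by
  have hb : ∫⁻ ω, ENNReal.ofReal (h (Y ω, ξ ω)) ∂P ≤ ENNReal.ofReal (∫ ω, B ω ∂P) := by
    rw [lintegral_fresh hm hξ hind hY (h := fun z => ENNReal.ofReal (h z)) (by fun_prop), hD,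
      ofReal_integral_eq_lintegral_ofReal hB (.of_forall hB0)]
    exact lintegral_mono hle
  have hmeas : Measurable fun ω => h (Y ω, ξ ω) :=
    hh.comp ((hY.mono hm le_rfl).prodMk hξ)
  exact ⟨integrable_of_lintegral_ofReal_le hmeas (fun _ => h0 _) hb,
    integral_le_of_lintegral_ofReal_le hmeas (fun _ => h0 _) (integral_nonneg hB0) hb⟩

theorem ae_index_lt {T : ℕ} (hT : 0 < T) {τ : Ω → ℕ} (hτ : Measurable τ)
    (hunif : ∀ t < T, P {ω | τ ω = t} = (T : ℝ≥0∞)⁻¹) : ∀ᵐ ω ∂P, τ ω < T := by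
  have h1 : P {ω | τ ω < T} = 1 := by
    have e : {ω | τ ω < T} = ⋃ t ∈ Finset.range T, {ω | τ ω = t} := by
      ext ω; simp
    rw [e, measure_biUnion_finset]
    · rw [Finset.sum_congr rfl fun t ht => hunif t (Finset.mem_range.1 ht)]
      simp only [Finset.sum_const, Finset.card_range, nsmul_eq_mul]
      exact ENNReal.mul_inv_cancel (by exact_mod_cast hT.ne') (by simp)
    · intro a _ b _ hab
      refine Set.disjoint_left.2 fun ω h1 h2 => hab ?_
      simp only [Set.mem_ofPred_eq] at h1 h2
      omega
    · exact fun t _ => hτ (measurableSet_singleton t)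
  exact (mem_ae_iff_prob_eq_one (hτ measurableSet_Iio)).2 h1

/-- The expectation at an independent uniform index is the average of the expectations. -/
theorem integral_random_index {T : ℕ} (hT : 0 < T) {τ : Ω → ℕ} (hτ : Measurable τ)
    (hunif : ∀ t < T, P {ω | τ ω = t} = (T : ℝ≥0∞)⁻¹)
    (hind : Indep m (MeasurableSpace.comap τ ⊤) P) {g : ℕ → Ω → ℝ}
    (hg : ∀ t, Measurable[m] (g t)) (hgi : ∀ t < T, Integrable (g t) P) :
    Integrable (fun ω => g (τ ω) ω) P ∧
      T * ∫ ω, g (τ ω) ω ∂P = ∑ t ∈ Finset.range T, ∫ ω, g t ω ∂P := by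
  set I : ℕ → Ω → ℝ := fun t ω => ({t} : Set ℕ).indicator (fun _ => (1 : ℝ)) (τ ω) with hI
  have hIm : ∀ t, Measurable (I t) := fun t =>
    (measurable_const.indicator (measurableSet_singleton t)).comp hτ
  have hII : ∀ t, Integrable (I t) P := by
    intro t
    refine Integrable.of_bound (hIm t).aestronglyMeasurable 1 (.of_forall fun ω => ?_)
    by_cases h : τ ω = t <;> simp [hI, h]
  have hIe : ∀ t < T, ∫ ω, I t ω ∂P = (T : ℝ)⁻¹ := by
    intro t ht
    have e : I t = ({ω | τ ω = t} : Set Ω).indicator fun _ => (1 : ℝ) := by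
      ext ω
      by_cases h : τ ω = t <;> simp [hI, h]
    have hs : MeasurableSet {ω | τ ω = t} := hτ (measurableSet_singleton t)
    rw [e, integral_indicator_const _ hs, measureReal_def, hunif t ht]
    simp
  have hIn : ∀ t, IndepFun (I t) (g t) P := by
    intro t
    refine (IndepFun_iff_Indep _ _ _).2 (indep_of_indep_of_le_left
      (indep_of_indep_of_le_right hind.symm (hg t).comap_le) ?_)
    have h1 : Measurable[MeasurableSpace.comap τ ⊤] (I t) :=
      (@measurable_from_top ℕ ℝ _ (({t} : Set ℕ).indicator fun _ => (1 : ℝ))).comp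
        (comap_measurable τ)
    exact h1.comap_le
  have hprod : ∀ t < T, Integrable (I t * g t) P := fun t ht =>
    (hIn t).integrable_mul (hII t) (hgi t ht)
  -- Almost surely the value at the random index is a finite sum of products of an index indicator
  -- and `g t`, whose factors are independent.
  have hae : (fun ω => g (τ ω) ω) =ᵐ[P] fun ω => ∑ t ∈ Finset.range T, (I t * g t) ω := by
    filter_upwards [ae_index_lt hT hτ hunif] with ω hω
    rw [Finset.sum_eq_single (τ ω)]
    · simp [hI]
    · intro b _ hb
      simp [hI, Ne.symm hb]
    · intro h
      exact absurd (Finset.mem_range.2 hω) h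
  have hsum : Integrable (fun ω => ∑ t ∈ Finset.range T, (I t * g t) ω) P :=
    integrable_finsetSum _ fun t ht => hprod t (Finset.mem_range.1 ht)
  refine ⟨hsum.congr hae.symm, ?_⟩
  rw [integral_congr_ae hae, integral_finsetSum _ fun t ht => hprod t (Finset.mem_range.1 ht),
    Finset.mul_sum]
  refine Finset.sum_congr rfl fun t ht => ?_
  have ht := Finset.mem_range.1 ht
  rw [(hIn t).integral_mul_eq_mul_integral (hIm t).aestronglyMeasurable (hgi t ht).1, hIe t ht,
    ← mul_assoc, mul_inv_cancel₀ (by positivity), one_mul]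

end Probability

/-! ### One time step: propagation of the estimation errors through the levels -/

section Step

instance secondCountableTopology_clm (m n : ℕ) : SecondCountableTopology (Vec m →L[ℝ] Vec n) :=
  have : ProperSpace (Vec m →L[ℝ] Vec n) := FiniteDimensional.proper ℝ _
  secondCountable_of_proper

/-- The Hilbert space bound, applied to the columns: `frobPi` is continuous and linear, so it
commutes with the means. -/
theorem lintegral_frobSq_update_sub_le {Ξ : Type*} [MeasurableSpace Ξ] {D : Measure Ξ}
    [IsProbabilityMeasure D] {m n : ℕ} {G₀ G₁ : Ξ → Vec m →L[ℝ] Vec n} (hG₀ : Measurable G₀)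
    (hG₁ : Measurable G₁) {g₀ g₁ : Vec m →L[ℝ] Vec n} (h₀ : ∫ x, G₀ x ∂D = g₀)
    (h₁ : ∫ x, G₁ x ∂D = g₁) {s r : ℝ} (hs : 0 ≤ s) (hr : 0 ≤ r)
    (hs₀ : ∫⁻ x, ENNReal.ofReal (frobSq (G₀ x - g₀)) ∂D ≤ ENNReal.ofReal s)
    (hs₁ : ∫⁻ x, ENNReal.ofReal (frobSq (G₁ x - g₁)) ∂D ≤ ENNReal.ofReal s)
    (hrD : ∫⁻ x, ENNReal.ofReal (frobSq (G₁ x - G₀ x)) ∂D ≤ ENNReal.ofReal r)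
    {β : ℝ} (hβ0 : 0 ≤ β) (hβ1 : β ≤ 1) (p : Vec m →L[ℝ] Vec n) :
    ∫⁻ x, ENNReal.ofReal (frobSq ((1 - β) • p + β • G₁ x + (1 - β) • (G₁ x - G₀ x) - g₁)) ∂D ≤
      ENNReal.ofReal ((1 - β) * frobSq (p - g₀) + 2 * β ^ 2 * s + 2 * r) := by
  have hint : ∀ {G : Ξ → Vec m →L[ℝ] Vec n} {g : Vec m →L[ℝ] Vec n}, Measurable G →
      ∫⁻ x, ENNReal.ofReal (frobSq (G x - g)) ∂D ≤ ENNReal.ofReal s → Integrable G D := by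
    intro G g hG hb
    refine (memLp_two_of_lintegral_le hG (a := g) (b := s) ?_).integrable one_le_two
    exact (lintegral_mono fun x => ENNReal.ofReal_le_ofReal (norm_sq_le_frobSq _)).trans hb
  set φ := frobPi m n
  simp only [← norm_frobPi_sq, map_sub, map_add, map_smul] at *
  refine lintegral_norm_update_sub_sq_le (φ.continuous.measurable.comp hG₀)
    (φ.continuous.measurable.comp hG₁) ?_ ?_ hs hr hs₀ hs₁ hrD hβ0 hβ1 (φ p)
  · exact (φ.integral_comp_comm (hint hG₀ hs₀)).trans (congrArg φ h₀)
  · exact (φ.integral_comp_comm (hint hG₁ hs₁)).trans (congrArg φ h₁)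

variable {d : ℕ → ℕ} {Ω : Type*}

/-- The components of the random state `X` that belong to the levels below `K` are
`m`-measurable. -/
structure MeasState (m : MeasurableSpace Ω) (K : ℕ) (X : Ω → State d) : Prop where
  u : ∀ i ≤ K, Measurable[m] fun ω => (X ω).u i
  v : ∀ i < K, Measurable[m] fun ω => (X ω).v i

theorem MeasState.mono {m m' : MeasurableSpace Ω} {K : ℕ} {X : Ω → State d}
    (h : MeasState m K X) (hm : m ≤ m') : MeasState m' K X :=
  ⟨fun i hi => (h.u i hi).mono hm le_rfl, fun i hi => (h.v i hi).mono hm le_rfl⟩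

theorem measurable_jacProd {m : MeasurableSpace Ω} {K : ℕ}
    {V : Ω → (i : ℕ) → Vec (d i) →L[ℝ] Vec (d (i + 1))}
    (hV : ∀ i < K, Measurable[m] fun ω => V ω i) :
    ∀ n ≤ K, Measurable[m] fun ω => jacProd (V ω) n
  | 0, _ => measurable_const
  | n + 1, h => by
    have hc : Continuous fun q : (Vec (d n) →L[ℝ] Vec (d (n + 1))) × (Vec (d 0) →L[ℝ] Vec (d n)) =>
        q.1.comp q.2 := by fun_prop
    exact hc.measurable.comp ((hV n h).prodMk (measurable_jacProd hV n (by omega)))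

theorem measurable_chainGrad {m : MeasurableSpace Ω} {K : ℕ} (hd : d K = 1)
    {V : Ω → (i : ℕ) → Vec (d i) →L[ℝ] Vec (d (i + 1))}
    (hV : ∀ i < K, Measurable[m] fun ω => V ω i) :
    Measurable[m] fun ω => chainGrad K hd (V ω) := by
  have hc : Continuous fun A : Vec (d 0) →L[ℝ] Vec (d K) =>
      ContinuousLinearMap.adjoint A (EuclideanSpace.single (Fin.cast hd.symm 0) (1 : ℝ)) := by
    have := (ContinuousLinearMap.adjoint (𝕜 := ℝ) (E := Vec (d 0)) (F := Vec (d K))).continuous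
    fun_prop
  exact hc.measurable.comp (measurable_jacProd hV K le_rfl)

variable {Ξ : ℕ → Type*} [∀ i, MeasurableSpace (Ξ i)]

/-- The samples `x i`, `i < K`, are successively drawn from the laws `D i`: the sample `x i` is
independent of the history `𝓗 i`, which comprises `𝓗 0` and the samples of lower levels. -/
structure FreshSamples {mΩ : MeasurableSpace Ω} (P : Measure Ω) (K : ℕ) (D : (i : ℕ) → Measure (Ξ i))
    (𝓗 : ℕ → MeasurableSpace Ω) (x : (i : ℕ) → Ω → Ξ i) : Prop where
  le : ∀ i ≤ K, 𝓗 i ≤ mΩ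
  mono : ∀ i < K, 𝓗 i ≤ 𝓗 (i + 1)
  measurable : ∀ i < K, Measurable[𝓗 (i + 1)] (x i)
  law : ∀ i < K, P.map (x i) = D i
  indep : ∀ i < K, Indep (𝓗 i) (MeasurableSpace.comap (x i) inferInstance) P

theorem FreshSamples.measurable' {mΩ : MeasurableSpace Ω} {P : Measure Ω} {K : ℕ}
    {D : (i : ℕ) → Measure (Ξ i)} {𝓗 : ℕ → MeasurableSpace Ω} {x : (i : ℕ) → Ω → Ξ i}
    (h : FreshSamples P K D 𝓗 x) {i : ℕ} (hi : i < K) : Measurable (x i) :=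
  (h.measurable i hi).mono (h.le _ hi) le_rfl

theorem FreshSamples.zero_le {mΩ : MeasurableSpace Ω} {P : Measure Ω} {K : ℕ}
    {D : (i : ℕ) → Measure (Ξ i)} {𝓗 : ℕ → MeasurableSpace Ω} {x : (i : ℕ) → Ω → Ξ i}
    (h : FreshSamples P K D 𝓗 x) : ∀ i ≤ K, 𝓗 0 ≤ 𝓗 i
  | 0, _ => le_rfl
  | i + 1, hi => (h.zero_le i (by omega)).trans (h.mono i hi)

variable {K : ℕ} {Lf LJ σf σJ ℓf ℓJ : ℝ≥0} {f : (i : ℕ) → Vec (d i) → Vec (d (i + 1))}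
  {val : (i : ℕ) → Vec (d i) → Ξ i → Vec (d (i + 1))}
  {jac : (i : ℕ) → Vec (d i) → Ξ i → Vec (d i) →L[ℝ] Vec (d (i + 1))}
  {D : (i : ℕ) → Measure (Ξ i)}

theorem Assumptions.measurable_fun (hA : Assumptions K Lf LJ σf σJ ℓf ℓJ f val jac D) {i : ℕ}
    (hi : i < K) : Measurable (f i) :=
  (hA.lipschitz i hi).continuous.measurable

theorem Assumptions.measurable_fderiv (hA : Assumptions K Lf LJ σf σJ ℓf ℓJ f val jac D) {i : ℕ}
    (hi : i < K) : Measurable (fderiv ℝ (f i)) :=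
  (hA.lipschitz_jacobian i hi).continuous.measurable

variable {mΩ : MeasurableSpace Ω} {P : Measure Ω} {𝓗 : ℕ → MeasurableSpace Ω}
  {x : (i : ℕ) → Ω → Ξ i} {X : Ω → State d} {w : Ω → Vec (d 0)} {β : ℝ}

/-- The new value entering level i involves only samples of lower levels, so the sample of level i
is still fresh when both oracle calls are made. -/
theorem measurable_nextU (hA : Assumptions K Lf LJ σf σJ ℓf ℓJ f val jac D)
    (hx : FreshSamples P K D 𝓗 x) (hX : MeasState (𝓗 0) K X) (hw : Measurable[𝓗 0] w) :
    ∀ i ≤ K, Measurable[𝓗 i] fun ω => nextU val β (X ω) (w ω) (fun i => x i ω) i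
  | 0, _ => hw
  | i + 1, hi => by
    have h0 := (measurable_nextU hA hx hX hw i (by omega)).mono (hx.mono i hi) le_rfl
    have h1 := (hX.u (i + 1) hi).mono (hx.zero_le _ hi) le_rfl
    have h2 := (hX.u i (by omega)).mono (hx.zero_le _ hi) le_rfl
    have h3 := (hA.measurable_val i hi).comp (h0.prodMk (hx.measurable i hi))
    have h4 := (hA.measurable_val i hi).comp (h2.prodMk (hx.measurable i hi))
    exact ((h1.const_smul (1 - β)).add (h3.const_smul β)).add ((h3.sub h4).const_smul (1 - β))

theorem FreshSamples.le_last (hx : FreshSamples P K D 𝓗 x) {i j : ℕ} (hij : i ≤ j) (hj : j ≤ K) :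
    𝓗 i ≤ 𝓗 j := by
  induction j, hij using Nat.le_induction with
  | base => exact le_rfl
  | succ k _ ih => exact (ih (by omega)).trans (hx.mono k hj)

theorem measurable_nextV {m : MeasurableSpace Ω}
    (hA : Assumptions K Lf LJ σf σJ ℓf ℓJ f val jac D) {i : ℕ} (hi : i < K)
    {u U : Ω → Vec (d i)} {v : Ω → Vec (d i) →L[ℝ] Vec (d (i + 1))} {y : Ω → Ξ i}
    (hu : Measurable[m] u) (hU : Measurable[m] U) (hv : Measurable[m] v) (hy : Measurable[m] y)
    (β : ℝ) : Measurable[m] fun ω => projBall Lf ((1 - β) • v ω + β • jac i (U ω) (y ω) +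
      (1 - β) • (jac i (U ω) (y ω) - jac i (u ω) (y ω))) := by
  have hj := hA.measurable_jac i hi
  have h3 := hj.comp (hU.prodMk hy)
  have h4 := hj.comp (hu.prodMk hy)
  exact (continuous_projBall Lf).measurable.comp
    (((hv.const_smul (1 - β)).add (h3.const_smul β)).add ((h3.sub h4).const_smul (1 - β)))

theorem measState_step (hA : Assumptions K Lf LJ σf σJ ℓf ℓJ f val jac D) (hd : d K = 1)
    (hx : FreshSamples P K D 𝓗 x) (hX : MeasState (𝓗 0) K X) (c η : ℝ) :
    MeasState (𝓗 K) K fun ω => step K hd Lf val jac c η (X ω) (fun i => x i ω) := by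
  have hw : Measurable[𝓗 0] fun ω => (X ω).u 0 - η • chainGrad K hd (X ω).v :=
    (hX.u 0 (by omega)).sub ((measurable_chainGrad hd hX.v).const_smul η)
  have hU := measurable_nextU (β := c * η ^ 2) hA hx hX hw
  constructor
  · intro i hi
    exact (hU i hi).mono (hx.le_last hi le_rfl) le_rfl
  · intro i hi
    exact measurable_nextV hA hi ((hX.u i hi.le).mono (hx.le_last (Nat.zero_le K) le_rfl) le_rfl)
      ((hU i hi.le).mono (hx.le_last hi.le le_rfl) le_rfl)
      ((hX.v i hi).mono (hx.le_last (Nat.zero_le K) le_rfl) le_rfl)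
      ((hx.measurable i hi).mono (hx.le_last hi le_rfl) le_rfl) (c * η ^ 2)

variable [IsProbabilityMeasure P] [∀ i, IsProbabilityMeasure (D i)]

theorem integral_affine {a b : Ω → ℝ} (ha : Integrable a P) (hb : Integrable b P) (p q r : ℝ) :
    Integrable (fun ω => p * a ω + q + r * b ω) P ∧
      ∫ ω, (p * a ω + q + r * b ω) ∂P = p * ∫ ω, a ω ∂P + q + r * ∫ ω, b ω ∂P := by
  have h1 : Integrable (fun ω => p * a ω) P := ha.const_mul p
  have h2 : Integrable (fun ω => r * b ω) P := hb.const_mul r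
  have h3 : Integrable (fun ω => p * a ω + q) P := h1.add (integrable_const q)
  refine ⟨h3.add h2, ?_⟩
  rw [integral_add h3 h2, integral_add h1 (integrable_const q), integral_const_mul,
    integral_const_mul]
  simp

/-- Errors of the function values: new estimation error and movement of one level. -/
theorem value_level (hA : Assumptions K Lf LJ σf σJ ℓf ℓJ f val jac D)
    (hx : FreshSamples P K D 𝓗 x) (hX : MeasState (𝓗 0) K X) (hw : Measurable[𝓗 0] w)
    (hβ0 : 0 ≤ β) (hβ1 : β ≤ 1) {i : ℕ} (hi : i < K) {U : (i : ℕ) → Ω → Vec (d i)}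
    (hU : U = fun i ω => nextU val β (X ω) (w ω) (fun i => x i ω) i)
    (he : Integrable (fun ω => ‖(X ω).u (i + 1) - f i ((X ω).u i)‖ ^ 2) P)
    (hδ : Integrable (fun ω => ‖U i ω - (X ω).u i‖ ^ 2) P) :
    (Integrable (fun ω => ‖U (i + 1) ω - f i (U i ω)‖ ^ 2) P ∧
      ∫ ω, ‖U (i + 1) ω - f i (U i ω)‖ ^ 2 ∂P ≤
        (1 - β) * ∫ ω, ‖(X ω).u (i + 1) - f i ((X ω).u i)‖ ^ 2 ∂P + 2 * β ^ 2 * σf ^ 2 +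
          2 * ℓf ^ 2 * ∫ ω, ‖U i ω - (X ω).u i‖ ^ 2 ∂P) ∧
    (Integrable (fun ω => ‖U (i + 1) ω - (X ω).u (i + 1)‖ ^ 2) P ∧
      ∫ ω, ‖U (i + 1) ω - (X ω).u (i + 1)‖ ^ 2 ∂P ≤
        2 * ℓf ^ 2 * ∫ ω, ‖U i ω - (X ω).u i‖ ^ 2 ∂P +
          4 * β ^ 2 * (σf ^ 2 + ∫ ω, ‖(X ω).u (i + 1) - f i ((X ω).u i)‖ ^ 2 ∂P)) := by
  have hUm : Measurable[𝓗 i] (U i) := by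
    rw [hU]; exact measurable_nextU hA hx hX hw i hi.le
  have h1 := (hX.u (i + 1) hi).mono (hx.zero_le i hi.le) le_rfl
  have h2 := (hX.u i hi.le).mono (hx.zero_le i hi.le) le_rfl
  have hY := (hUm.prodMk h2).prodMk h1
  have hval := hA.measurable_val i hi
  have hvx : ∀ y, Measurable (val i y) := fun y => hval.of_uncurry_left
  have hf := hA.measurable_fun hi
  have hUe : ∀ ω, U (i + 1) ω = (1 - β) • (X ω).u (i + 1) + β • val i (U i ω) (x i ω) +
      (1 - β) • (val i (U i ω) (x i ω) - val i ((X ω).u i) (x i ω)) := by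
    intro ω; rw [hU]; rfl
  -- The update as a function of the past (new input, old input, old estimator) and of the fresh
  -- sample.
  set N : ((Vec (d i) × Vec (d i)) × Vec (d (i + 1))) × Ξ i → Vec (d (i + 1)) := fun z =>
    (1 - β) • z.1.2 + β • val i z.1.1.1 z.2 + (1 - β) • (val i z.1.1.1 z.2 - val i z.1.1.2 z.2)
    with hN
  have hN' : Measurable N := by
    have a1 : Measurable fun z : ((Vec (d i) × Vec (d i)) × Vec (d (i + 1))) × Ξ i =>
        val i z.1.1.1 z.2 := hval.comp (by fun_prop : Measurable fun z :
          ((Vec (d i) × Vec (d i)) × Vec (d (i + 1))) × Ξ i => (z.1.1.1, z.2))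
    have a2 : Measurable fun z : ((Vec (d i) × Vec (d i)) × Vec (d (i + 1))) × Ξ i =>
        val i z.1.1.2 z.2 := hval.comp (by fun_prop : Measurable fun z :
          ((Vec (d i) × Vec (d i)) × Vec (d (i + 1))) × Ξ i => (z.1.1.2, z.2))
    rw [hN]; fun_prop
  have hσ : (0 : ℝ) ≤ (σf : ℝ) ^ 2 := by positivity
  have hβ' : 0 ≤ 1 - β := by linarith
  refine ⟨?_, ?_⟩
  · have key := integral_fresh_le (hx.le i hi.le) (hx.law i hi) (hx.measurable' hi)
      (hx.indep i hi) hY (h := fun z => ‖N z - f i z.1.1.1‖ ^ 2) (by fun_prop)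
      (fun _ => sq_nonneg _)
      (B := fun ω => (1 - β) * ‖(X ω).u (i + 1) - f i ((X ω).u i)‖ ^ 2 + 2 * β ^ 2 * σf ^ 2 +
        2 * ℓf ^ 2 * ‖U i ω - (X ω).u i‖ ^ 2)
      (integral_affine he hδ _ _ _).1 (fun ω => by positivity)
      (fun ω => by
        rw [mul_assoc 2 ((ℓf : ℝ) ^ 2)]
        exact lintegral_norm_update_sub_sq_le (hvx _) (hvx _) (hA.unbiased_val i hi _)
            (hA.unbiased_val i hi _) hσ (by positivity) (hA.variance_val i hi _)
            (hA.variance_val i hi _) (hA.meanSq_val i hi _ _) hβ0 hβ1 _)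
    rw [(integral_affine he hδ _ _ _).2] at key
    simp only [hN, ← hUe] at key
    exact key
  · have key := integral_fresh_le (hx.le i hi.le) (hx.law i hi) (hx.measurable' hi)
      (hx.indep i hi) hY (h := fun z => ‖N z - z.1.2‖ ^ 2) (by fun_prop)
      (fun _ => sq_nonneg _)
      (B := fun ω => 4 * β ^ 2 * ‖(X ω).u (i + 1) - f i ((X ω).u i)‖ ^ 2 + 4 * β ^ 2 * σf ^ 2 +
        2 * ℓf ^ 2 * ‖U i ω - (X ω).u i‖ ^ 2)
      (integral_affine he hδ _ _ _).1 (fun ω => by positivity)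
      (fun ω => (lintegral_norm_update_sub_self_sq_le (hvx _) (hvx _) hσ (by positivity)
        (hA.variance_val i hi _) (hA.meanSq_val i hi _ _) β _).trans_eq (by congr 1; ring))
    rw [(integral_affine he hδ _ _ _).2] at key
    simp only [hN, ← hUe] at key
    exact ⟨key.1, key.2.trans (le_of_eq (by ring))⟩

/-- Error of the Jacobian estimator of one level after an update. -/
theorem jacobian_level (hA : Assumptions K Lf LJ σf σJ ℓf ℓJ f val jac D)
    (hx : FreshSamples P K D 𝓗 x) (hX : MeasState (𝓗 0) K X) (hw : Measurable[𝓗 0] w)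
    (hβ0 : 0 ≤ β) (hβ1 : β ≤ 1) {i : ℕ} (hi : i < K) {U : (i : ℕ) → Ω → Vec (d i)}
    (hU : U = fun i ω => nextU val β (X ω) (w ω) (fun i => x i ω) i)
    {V : Ω → Vec (d i) →L[ℝ] Vec (d (i + 1))}
    (hV : V = fun ω => projBall Lf ((1 - β) • (X ω).v i + β • jac i (U i ω) (x i ω) +
      (1 - β) • (jac i (U i ω) (x i ω) - jac i ((X ω).u i) (x i ω))))
    (he : Integrable (fun ω => frobSq ((X ω).v i - fderiv ℝ (f i) ((X ω).u i))) P)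
    (hδ : Integrable (fun ω => ‖U i ω - (X ω).u i‖ ^ 2) P) :
    Integrable (fun ω => frobSq (V ω - fderiv ℝ (f i) (U i ω))) P ∧
      ∫ ω, frobSq (V ω - fderiv ℝ (f i) (U i ω)) ∂P ≤
        (1 - β) * ∫ ω, frobSq ((X ω).v i - fderiv ℝ (f i) ((X ω).u i)) ∂P + 2 * β ^ 2 * σJ ^ 2 +
          2 * ℓJ ^ 2 * ∫ ω, ‖U i ω - (X ω).u i‖ ^ 2 ∂P := by
  have hUm : Measurable[𝓗 i] (U i) := by
    rw [hU]; exact measurable_nextU hA hx hX hw i hi.le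
  have h1 := (hX.v i hi).mono (hx.zero_le i hi.le) le_rfl
  have h2 := (hX.u i hi.le).mono (hx.zero_le i hi.le) le_rfl
  have hY := (hUm.prodMk h2).prodMk h1
  have hjac := hA.measurable_jac i hi
  have hjx : ∀ y, Measurable (jac i y) := fun y => hjac.of_uncurry_left
  have hf := hA.measurable_fderiv hi
  set N : ((Vec (d i) × Vec (d i)) × (Vec (d i) →L[ℝ] Vec (d (i + 1)))) × Ξ i →
      Vec (d i) →L[ℝ] Vec (d (i + 1)) := fun z =>
    (1 - β) • z.1.2 + β • jac i z.1.1.1 z.2 + (1 - β) • (jac i z.1.1.1 z.2 - jac i z.1.1.2 z.2)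
    with hN
  have hN' : Measurable N := by
    have a1 : Measurable fun z : ((Vec (d i) × Vec (d i)) × (Vec (d i) →L[ℝ] Vec (d (i + 1)))) × Ξ i
        => jac i z.1.1.1 z.2 := hjac.comp (by fun_prop : Measurable fun z :
          ((Vec (d i) × Vec (d i)) × (Vec (d i) →L[ℝ] Vec (d (i + 1)))) × Ξ i => (z.1.1.1, z.2))
    have a2 : Measurable fun z : ((Vec (d i) × Vec (d i)) × (Vec (d i) →L[ℝ] Vec (d (i + 1)))) × Ξ i
        => jac i z.1.1.2 z.2 := hjac.comp (by fun_prop : Measurable fun z :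
          ((Vec (d i) × Vec (d i)) × (Vec (d i) →L[ℝ] Vec (d (i + 1)))) × Ξ i => (z.1.1.2, z.2))
    rw [hN]; fun_prop
  have hp := (continuous_projBall (m := d i) (n := d (i + 1)) Lf).measurable
  have hq := (continuous_frobSq (m := d i) (n := d (i + 1))).measurable
  have hσ : (0 : ℝ) ≤ (σJ : ℝ) ^ 2 := by positivity
  have hβ' : 0 ≤ 1 - β := by linarith
  have key := integral_fresh_le (hx.le i hi.le) (hx.law i hi) (hx.measurable' hi)
    (hx.indep i hi) hY (h := fun z => frobSq (projBall Lf (N z) - fderiv ℝ (f i) z.1.1.1))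
    (by fun_prop) (fun _ => frobSq_nonneg _)
    (B := fun ω => (1 - β) * frobSq ((X ω).v i - fderiv ℝ (f i) ((X ω).u i)) +
      2 * β ^ 2 * σJ ^ 2 + 2 * ℓJ ^ 2 * ‖U i ω - (X ω).u i‖ ^ 2)
    (integral_affine he hδ _ _ _).1
    (fun ω => by
      have := frobSq_nonneg ((X ω).v i - fderiv ℝ (f i) ((X ω).u i))
      positivity)
    -- The projection is discarded before taking means, since the nonlinear map would destroy
    -- unbiasedness.
    (fun ω => (lintegral_mono fun ξ => ENNReal.ofReal_le_ofReal (frobSq_projBall_sub_le _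
        (norm_fderiv_le_of_lipschitz ℝ (hA.lipschitz i hi)))).trans
      ((lintegral_frobSq_update_sub_le (hjx _) (hjx _) (hA.unbiased_jac i hi _)
        (hA.unbiased_jac i hi _) hσ (by positivity) (hA.variance_jac i hi _)
        (hA.variance_jac i hi _) (hA.meanSq_jac i hi _ _) hβ0 hβ1 _).trans_eq
        (by rw [mul_assoc 2 ((ℓJ : ℝ) ^ 2)])))
  rw [(integral_affine he hδ _ _ _).2] at key
  rw [hV]
  exact key

end Step

/-! ### One time step: the errors summed over the levels -/

section StepBounds

/-- Contribution of a squared step length to the squared estimation error. -/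
def moveConst (K : ℕ) (ℓf ℓJ : ℝ≥0) : ℝ :=
  2 * ((ℓf : ℝ) ^ 2 + ℓJ ^ 2) * K * (4 * (1 + 2 * (ℓf : ℝ) ^ 2) ^ K)

/-- Contribution of the sampling noise to the squared estimation error. -/
def noiseConst (K : ℕ) (σf σJ ℓf ℓJ : ℝ≥0) : ℝ :=
  2 * K * ((σf : ℝ) ^ 2 + σJ ^ 2) + moveConst K ℓf ℓJ * K * σf ^ 2

theorem moveConst_nonneg (K : ℕ) (ℓf ℓJ : ℝ≥0) : 0 ≤ moveConst K ℓf ℓJ := by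
  unfold moveConst; positivity

theorem noiseConst_nonneg (K : ℕ) (σf σJ ℓf ℓJ : ℝ≥0) : 0 ≤ noiseConst K σf σJ ℓf ℓJ := by
  have := moveConst_nonneg K ℓf ℓJ
  unfold noiseConst; positivity

/-- Unrolling the linear recursion over the levels; every coefficient is at most 4 (1 + 2a)^i. -/
theorem movement_le {K : ℕ} {δ e : ℕ → ℝ} {a s β : ℝ} (ha : 0 ≤ a) (hs : 0 ≤ s)
    (hδ0 : 0 ≤ δ 0) (he : ∀ i, 0 ≤ e i)
    (h : ∀ i < K, δ (i + 1) ≤ 2 * a * δ i + 4 * β ^ 2 * (s + e i)) :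
    ∀ i ≤ K, δ i ≤ 4 * (1 + 2 * a) ^ i * (δ 0 + β ^ 2 * ∑ j ∈ Finset.range i, (s + e j))
  | 0, _ => by simp; linarith
  | i + 1, hi => by
    have ih := movement_le ha hs hδ0 he h i (by omega)
    have h1 : (1 : ℝ) ≤ (1 + 2 * a) ^ (i + 1) := one_le_pow₀ (by linarith)
    have h2 : 0 ≤ β ^ 2 * (s + e i) := by have := he i; positivity
    have h3 : 0 ≤ δ 0 + β ^ 2 * ∑ j ∈ Finset.range i, (s + e j) := by
      have : 0 ≤ ∑ j ∈ Finset.range i, (s + e j) :=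
        Finset.sum_nonneg fun j _ => add_nonneg hs (he j)
      positivity
    rw [Finset.sum_range_succ]
    calc δ (i + 1) ≤ 2 * a * δ i + 4 * (1 * (β ^ 2 * (s + e i))) := (h i hi).trans_eq (by ring)
      _ ≤ 2 * a * (4 * (1 + 2 * a) ^ i * (δ 0 + β ^ 2 * ∑ j ∈ Finset.range i, (s + e j))) +
          4 * ((1 + 2 * a) ^ (i + 1) * (β ^ 2 * (s + e i))) := by gcongr
      _ ≤ (1 + 2 * a) * (4 * (1 + 2 * a) ^ i * (δ 0 + β ^ 2 * ∑ j ∈ Finset.range i, (s + e j))) +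
          4 * ((1 + 2 * a) ^ (i + 1) * (β ^ 2 * (s + e i))) := by
          have : 2 * a ≤ 1 + 2 * a := by linarith
          gcongr
      _ = _ := by ring

/-- The old errors return through the movements with a total weight of at most M β², where M is
`moveConst`. As M β ≤ 1/2, this costs only half of the contraction, and 1 - β becomes 1 - β/2. -/
theorem sum_errors_le {K : ℕ} {δ e e' b b' : ℕ → ℝ} {β : ℝ} {σf σJ ℓf ℓJ : ℝ≥0}
    (hβ : moveConst K ℓf ℓJ * β ≤ 1 / 2) (hβ0 : 0 ≤ β)
    (hδ0 : 0 ≤ δ 0) (he : ∀ i, 0 ≤ e i) (hb : ∀ i, 0 ≤ b i)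
    (h : ∀ i < K, δ (i + 1) ≤ 2 * ℓf ^ 2 * δ i + 4 * β ^ 2 * (σf ^ 2 + e i))
    (he' : ∀ i < K, e' i ≤ (1 - β) * e i + 2 * β ^ 2 * σf ^ 2 + 2 * ℓf ^ 2 * δ i)
    (hb' : ∀ i < K, b' i ≤ (1 - β) * b i + 2 * β ^ 2 * σJ ^ 2 + 2 * ℓJ ^ 2 * δ i) :
    ∑ i ∈ Finset.range K, (e' i + b' i) ≤ (1 - β / 2) * ∑ i ∈ Finset.range K, (e i + b i) +
      noiseConst K σf σJ ℓf ℓJ * β ^ 2 + moveConst K ℓf ℓJ * δ 0 := by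
  set Φ := ∑ i ∈ Finset.range K, (e i + b i) with hΦ
  set M : ℝ := 4 * (1 + 2 * (ℓf : ℝ) ^ 2) ^ K with hM
  set R : ℝ := M * (δ 0 + β ^ 2 * (K * σf ^ 2 + Φ)) with hR
  have hδ : ∀ i < K, δ i ≤ R := by
    intro i hi
    refine (movement_le (by positivity) (by positivity) hδ0 he h i hi.le).trans ?_
    have h1 : ∑ j ∈ Finset.range i, ((σf : ℝ) ^ 2 + e j) ≤ K * σf ^ 2 + Φ := by
      calc ∑ j ∈ Finset.range i, ((σf : ℝ) ^ 2 + e j)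
          ≤ ∑ j ∈ Finset.range K, ((σf : ℝ) ^ 2 + e j) :=
            Finset.sum_le_sum_of_subset_of_nonneg (Finset.range_mono hi.le)
              fun j _ _ => add_nonneg (by positivity) (he j)
        _ ≤ ∑ j ∈ Finset.range K, ((σf : ℝ) ^ 2 + (e j + b j)) :=
            Finset.sum_le_sum fun j _ => by have := hb j; linarith
        _ = _ := by rw [Finset.sum_add_distrib]; simp [hΦ]
    have h2 : (0 : ℝ) ≤ ∑ j ∈ Finset.range i, ((σf : ℝ) ^ 2 + e j) :=
      Finset.sum_nonneg fun j _ => add_nonneg (by positivity) (he j)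
    rw [hR, hM]
    gcongr
    linarith [sq_nonneg (ℓf : ℝ)]
  have hsum : ∑ i ∈ Finset.range K, (e' i + b' i) ≤ ∑ i ∈ Finset.range K,
      ((1 - β) * (e i + b i) + (2 * β ^ 2 * (σf ^ 2 + σJ ^ 2) + 2 * (ℓf ^ 2 + ℓJ ^ 2) * R)) := by
    refine Finset.sum_le_sum fun i hi => ?_
    have hi := Finset.mem_range.1 hi
    have h1 := mul_le_mul_of_nonneg_left (hδ i hi) (sq_nonneg (ℓf : ℝ))
    have h2 := mul_le_mul_of_nonneg_left (hδ i hi) (sq_nonneg (ℓJ : ℝ))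
    linarith [he' i hi, hb' i hi]
  refine hsum.trans ?_
  rw [Finset.sum_add_distrib, ← Finset.mul_sum, ← hΦ]
  simp only [Finset.sum_const, Finset.card_range, nsmul_eq_mul]
  have hΦ0 : 0 ≤ Φ := Finset.sum_nonneg fun i _ => add_nonneg (he i) (hb i)
  have e1 : (K : ℝ) * (2 * β ^ 2 * (σf ^ 2 + σJ ^ 2) + 2 * (ℓf ^ 2 + ℓJ ^ 2) * R) =
      noiseConst K σf σJ ℓf ℓJ * β ^ 2 + moveConst K ℓf ℓJ * δ 0 +
        moveConst K ℓf ℓJ * β ^ 2 * Φ := by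
    rw [hR, hM, noiseConst, moveConst]; ring
  have h3 : moveConst K ℓf ℓJ * β * (β * Φ) ≤ 1 / 2 * (β * Φ) := by gcongr
  nlinarith

variable {d : ℕ → ℕ} {Ω : Type*} {Ξ : ℕ → Type*} [∀ i, MeasurableSpace (Ξ i)]
  {K : ℕ} {Lf LJ σf σJ ℓf ℓJ : ℝ≥0} {f : (i : ℕ) → Vec (d i) → Vec (d (i + 1))}
  {val : (i : ℕ) → Vec (d i) → Ξ i → Vec (d (i + 1))}
  {jac : (i : ℕ) → Vec (d i) → Ξ i → Vec (d i) →L[ℝ] Vec (d (i + 1))}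
  {D : (i : ℕ) → Measure (Ξ i)}

theorem measurable_level_value {m : MeasurableSpace Ω} {X : Ω → State d}
    (hA : Assumptions K Lf LJ σf σJ ℓf ℓJ f val jac D) (hX : MeasState m K X) {i : ℕ} (hi : i < K) :
    Measurable[m] fun ω => ‖(X ω).u (i + 1) - f i ((X ω).u i)‖ ^ 2 :=
  (((hX.u (i + 1) hi).sub ((hA.measurable_fun hi).comp (hX.u i hi.le))).norm).pow_const 2

theorem measurable_level_jacobian {m : MeasurableSpace Ω} {X : Ω → State d}
    (hA : Assumptions K Lf LJ σf σJ ℓf ℓJ f val jac D) (hX : MeasState m K X) {i : ℕ} (hi : i < K) :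
    Measurable[m] fun ω => frobSq ((X ω).v i - fderiv ℝ (f i) ((X ω).u i)) :=
  continuous_frobSq.measurable.comp
    ((hX.v i hi).sub ((hA.measurable_fderiv hi).comp (hX.u i hi.le)))

theorem measurable_sqError {m : MeasurableSpace Ω} {X : Ω → State d}
    (hA : Assumptions K Lf LJ σf σJ ℓf ℓJ f val jac D) (hX : MeasState m K X) :
    Measurable[m] fun ω => sqError K f (X ω) := by
  unfold sqError
  refine Finset.measurable_fun_sum _ fun i hi => ?_
  have hi := Finset.mem_range.1 hi
  exact (measurable_level_value hA hX hi).add (measurable_level_jacobian hA hX hi)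

variable {mΩ : MeasurableSpace Ω} {P : Measure Ω} {X : Ω → State d}

theorem integrable_of_nonneg_of_le {g h : Ω → ℝ} (hh : Integrable h P) (hg : Measurable g)
    (h0 : ∀ ω, 0 ≤ g ω) (hle : ∀ ω, g ω ≤ h ω) : Integrable g P :=
  hh.mono' hg.aestronglyMeasurable (.of_forall fun ω => by
    rw [Real.norm_of_nonneg (h0 ω)]; exact hle ω)

theorem integrable_level_value (hA : Assumptions K Lf LJ σf σJ ℓf ℓJ f val jac D)
    (hX : MeasState mΩ K X) (hI : Integrable (fun ω => sqError K f (X ω)) P) {i : ℕ} (hi : i < K) :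
    Integrable (fun ω => ‖(X ω).u (i + 1) - f i ((X ω).u i)‖ ^ 2) P := by
  refine integrable_of_nonneg_of_le hI (measurable_level_value hA hX hi) (fun _ => sq_nonneg _)
    fun ω => ?_
  refine le_trans ?_ (Finset.single_le_sum
    (fun j _ => add_nonneg (sq_nonneg ‖(X ω).u (j + 1) - f j ((X ω).u j)‖)
      (frobSq_nonneg ((X ω).v j - fderiv ℝ (f j) ((X ω).u j)))) (Finset.mem_range.2 hi))
  have := frobSq_nonneg ((X ω).v i - fderiv ℝ (f i) ((X ω).u i))
  linarith

theorem integrable_level_jacobian (hA : Assumptions K Lf LJ σf σJ ℓf ℓJ f val jac D)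
    (hX : MeasState mΩ K X) (hI : Integrable (fun ω => sqError K f (X ω)) P) {i : ℕ} (hi : i < K) :
    Integrable (fun ω => frobSq ((X ω).v i - fderiv ℝ (f i) ((X ω).u i))) P := by
  refine integrable_of_nonneg_of_le hI (measurable_level_jacobian hA hX hi)
    (fun _ => frobSq_nonneg _) fun ω => ?_
  refine le_trans ?_ (Finset.single_le_sum
    (fun j _ => add_nonneg (sq_nonneg ‖(X ω).u (j + 1) - f j ((X ω).u j)‖)
      (frobSq_nonneg ((X ω).v j - fderiv ℝ (f j) ((X ω).u j)))) (Finset.mem_range.2 hi))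
  have := sq_nonneg ‖(X ω).u (i + 1) - f i ((X ω).u i)‖
  linarith

theorem integral_sqError
    (he : ∀ i < K, Integrable (fun ω => ‖(X ω).u (i + 1) - f i ((X ω).u i)‖ ^ 2) P)
    (hb : ∀ i < K, Integrable (fun ω => frobSq ((X ω).v i - fderiv ℝ (f i) ((X ω).u i))) P) :
    Integrable (fun ω => sqError K f (X ω)) P ∧
    ∫ ω, sqError K f (X ω) ∂P = ∑ i ∈ Finset.range K,
      (∫ ω, ‖(X ω).u (i + 1) - f i ((X ω).u i)‖ ^ 2 ∂P +
        ∫ ω, frobSq ((X ω).v i - fderiv ℝ (f i) ((X ω).u i)) ∂P) := by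
  have hi : ∀ i ∈ Finset.range K, Integrable (fun ω => ‖(X ω).u (i + 1) - f i ((X ω).u i)‖ ^ 2 +
      frobSq ((X ω).v i - fderiv ℝ (f i) ((X ω).u i))) P := fun i hi =>
    (he i (Finset.mem_range.1 hi)).add (hb i (Finset.mem_range.1 hi))
  unfold sqError
  refine ⟨integrable_finsetSum _ hi, ?_⟩
  rw [integral_finsetSum _ hi]
  exact Finset.sum_congr rfl fun i hi =>
    integral_add (he i (Finset.mem_range.1 hi)) (hb i (Finset.mem_range.1 hi))

variable [IsProbabilityMeasure P] [∀ i, IsProbabilityMeasure (D i)]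
  {𝓗 : ℕ → MeasurableSpace Ω} {x : (i : ℕ) → Ω → Ξ i}

/-- The estimation error contracts in one time step, up to noise and movement. -/
theorem sqError_step (hA : Assumptions K Lf LJ σf σJ ℓf ℓJ f val jac D) (hd : d K = 1)
    (hx : FreshSamples P K D 𝓗 x) (hX : MeasState (𝓗 0) K X) {c η : ℝ} (hβ0 : 0 ≤ c * η ^ 2)
    (hβ1 : c * η ^ 2 ≤ 1) (hβ : moveConst K ℓf ℓJ * (c * η ^ 2) ≤ 1 / 2)
    (hI : Integrable (fun ω => sqError K f (X ω)) P)
    (hv : Integrable (fun ω => ‖chainGrad K hd (X ω).v‖ ^ 2) P) :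
    Integrable (fun ω => sqError K f (step K hd Lf val jac c η (X ω) fun i => x i ω)) P ∧
      ∫ ω, sqError K f (step K hd Lf val jac c η (X ω) fun i => x i ω) ∂P ≤
        (1 - c * η ^ 2 / 2) * ∫ ω, sqError K f (X ω) ∂P +
          noiseConst K σf σJ ℓf ℓJ * (c * η ^ 2) ^ 2 +
            moveConst K ℓf ℓJ * (η ^ 2 * ∫ ω, ‖chainGrad K hd (X ω).v‖ ^ 2 ∂P) := by
  have hX' := hX.mono (hx.le 0 (Nat.zero_le K))
  have he : ∀ i < K, _ := fun i hi => integrable_level_value hA hX' hI hi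
  have hb : ∀ i < K, _ := fun i hi => integrable_level_jacobian hA hX' hI hi
  set w : Ω → Vec (d 0) := fun ω => (X ω).u 0 - η • chainGrad K hd (X ω).v with hwdef
  have hw : Measurable[𝓗 0] w :=
    (hX.u 0 (by omega)).sub ((measurable_chainGrad hd hX.v).const_smul η)
  set U : (i : ℕ) → Ω → Vec (d i) :=
    fun i ω => nextU val (c * η ^ 2) (X ω) (w ω) (fun i => x i ω) i with hU
  have hδ0 : ∀ ω, ‖U 0 ω - (X ω).u 0‖ ^ 2 = η ^ 2 * ‖chainGrad K hd (X ω).v‖ ^ 2 := by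
    intro ω
    have e : U 0 ω - (X ω).u 0 = -(η • chainGrad K hd (X ω).v) := by
      simp [hU, nextU, hwdef]
    rw [e, norm_neg, norm_smul, mul_pow, Real.norm_eq_abs, sq_abs]
  -- Integrability of the movement climbs from level to level, starting with the weight step η v.
  have hδ : ∀ i ≤ K, Integrable (fun ω => ‖U i ω - (X ω).u i‖ ^ 2) P := by
    intro i
    induction i with
    | zero => intro _; simp_rw [hδ0]; exact hv.const_mul _
    | succ i ih =>
      intro hi
      exact (value_level hA hx hX hw hβ0 hβ1 hi hU (he i hi) (ih (by omega))).2.1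
  have hval := fun i (hi : i < K) =>
    value_level hA hx hX hw hβ0 hβ1 hi hU (he i hi) (hδ i hi.le)
  have hjac := fun i (hi : i < K) =>
    jacobian_level hA hx hX hw hβ0 hβ1 hi hU rfl (hb i hi) (hδ i hi.le)
  have hnew := integral_sqError (P := P) (K := K) (f := f)
    (X := fun ω => step K hd Lf val jac c η (X ω) fun i => x i ω)
    (fun i hi => (hval i hi).1.1) (fun i hi => (hjac i hi).1)
  refine ⟨hnew.1, ?_⟩
  rw [hnew.2, (integral_sqError he hb).2]
  have e0 : η ^ 2 * ∫ ω, ‖chainGrad K hd (X ω).v‖ ^ 2 ∂P = ∫ ω, ‖U 0 ω - (X ω).u 0‖ ^ 2 ∂P := by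
    simp_rw [hδ0]; rw [integral_const_mul]
  rw [e0]
  exact sum_errors_le (δ := fun i => ∫ ω, ‖U i ω - (X ω).u i‖ ^ 2 ∂P) hβ hβ0
    (integral_nonneg fun _ => sq_nonneg _)
    (fun i => integral_nonneg fun _ => sq_nonneg _)
    (fun i => integral_nonneg fun _ => frobSq_nonneg _)
    (fun i hi => (hval i hi).2.2) (fun i hi => (hval i hi).1.2) (fun i hi => (hjac i hi).2)

end StepBounds

/-! ### Decrease of the optimality gap, and the average potential along a stage -/

section Stage

variable {d : ℕ → ℕ}

/-- The optimality gap. -/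
def optGap (K : ℕ) (hd : d K = 1) (f : (i : ℕ) → Vec (d i) → Vec (d (i + 1))) (w : Vec (d 0)) : ℝ :=
  objective K hd f w - ⨅ w, objective K hd f w

/-- The part of the squared gradient error that the estimation errors do not account for. It vanishes
if the Jacobian estimators have been projected. -/
def excess (K : ℕ) (hd : d K = 1) (Lf LJ : ℝ≥0) (f : (i : ℕ) → Vec (d i) → Vec (d (i + 1)))
    (X : State d) : ℝ :=
  max 0 (‖chainGrad K hd X.v - gradient (objective K hd f) (X.u 0)‖ ^ 2 -
    errConst K Lf LJ * sqError K f X)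

theorem optGap_nonneg {K : ℕ} {hd : d K = 1} {f : (i : ℕ) → Vec (d i) → Vec (d (i + 1))}
    (hb : BddBelow (Set.range (objective K hd f))) (w : Vec (d 0)) : 0 ≤ optGap K hd f w :=
  sub_nonneg.2 (ciInf_le hb w)

theorem excess_nonneg (K : ℕ) (hd : d K = 1) (Lf LJ : ℝ≥0)
    (f : (i : ℕ) → Vec (d i) → Vec (d (i + 1))) (X : State d) : 0 ≤ excess K hd Lf LJ f X :=
  le_max_left _ _

theorem norm_sub_gradient_sq_le (K : ℕ) (hd : d K = 1) (Lf LJ : ℝ≥0)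
    (f : (i : ℕ) → Vec (d i) → Vec (d (i + 1))) (X : State d) :
    ‖chainGrad K hd X.v - gradient (objective K hd f) (X.u 0)‖ ^ 2 ≤
      errConst K Lf LJ * sqError K f X + excess K hd Lf LJ f X := by
  have := le_max_right 0 (‖chainGrad K hd X.v - gradient (objective K hd f) (X.u 0)‖ ^ 2 -
    errConst K Lf LJ * sqError K f X)
  unfold excess
  linarith

theorem excess_le (K : ℕ) (hd : d K = 1) (Lf LJ : ℝ≥0)
    (f : (i : ℕ) → Vec (d i) → Vec (d (i + 1))) (X : State d) : excess K hd Lf LJ f X ≤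
      ‖chainGrad K hd X.v - gradient (objective K hd f) (X.u 0)‖ ^ 2 := by
  refine max_le (sq_nonneg _) (sub_le_self _ ?_)
  have := two_le_errConst K Lf LJ
  have := sqError_nonneg K f X
  positivity

variable {Ω : Type*} {Ξ : ℕ → Type*} [∀ i, MeasurableSpace (Ξ i)]
  {K : ℕ} {Lf LJ σf σJ ℓf ℓJ : ℝ≥0} {f : (i : ℕ) → Vec (d i) → Vec (d (i + 1))}
  {val : (i : ℕ) → Vec (d i) → Ξ i → Vec (d (i + 1))}
  {jac : (i : ℕ) → Vec (d i) → Ξ i → Vec (d i) →L[ℝ] Vec (d (i + 1))}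
  {D : (i : ℕ) → Measure (Ξ i)}

/-- A step ends with a projection, which supplies the norm bounds behind the gradient estimate. Only
an unprojected initial state can have positive excess. -/
theorem excess_step (hA : Assumptions K Lf LJ σf σJ ℓf ℓJ f val jac D) (hd : d K = 1) (c η : ℝ)
    (X : State d) (x : (i : ℕ) → Ξ i) :
    excess K hd Lf LJ f (step K hd Lf val jac c η X x) = 0 := by
  refine max_eq_left (sub_nonpos.2 ?_)
  exact norm_chainGrad_sub_gradient_sq_le hd hA.differentiable hA.lipschitz hA.lipschitz_jacobian _
    fun i _ => norm_projBall_le Lf _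

theorem Assumptions.differentiable_objective (hA : Assumptions K Lf LJ σf σJ ℓf ℓJ f val jac D)
    (hd : d K = 1) : Differentiable ℝ (objective K hd f) := fun w =>
  (hasGradientAt_objective hd hA.differentiable w).differentiableAt

theorem Assumptions.measurable_gradient (hA : Assumptions K Lf LJ σf σJ ℓf ℓJ f val jac D)
    (hd : d K = 1) : Measurable (gradient (objective K hd f)) := by
  refine (LipschitzWith.of_dist_le_mul (K := ⟨_, gradConst_nonneg K Lf LJ⟩) fun w' w => ?_)
    |>.continuous.measurable
  rw [dist_eq_norm, dist_eq_norm]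
  exact norm_gradient_sub_gradient_le hd hA.differentiable hA.lipschitz hA.lipschitz_jacobian w w'

theorem Assumptions.optGap_step_le (hA : Assumptions K Lf LJ σf σJ ℓf ℓJ f val jac D)
    (hd : d K = 1) {η : ℝ} (hη : 0 ≤ η) (hηL : η * gradConst K Lf LJ ≤ 1 / 4) (c : ℝ) (X : State d)
    (x : (i : ℕ) → Ξ i) :
    optGap K hd f ((step K hd Lf val jac c η X x).u 0) +
        η / 2 * ‖gradient (objective K hd f) (X.u 0)‖ ^ 2 + η / 4 * ‖chainGrad K hd X.v‖ ^ 2 ≤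
      optGap K hd f (X.u 0) +
        η / 2 * (errConst K Lf LJ * sqError K f X + excess K hd Lf LJ f X) := by
  have h := descent (hA.differentiable_objective hd) (gradConst_nonneg K Lf LJ)
    (fun w w' => norm_gradient_sub_gradient_le hd hA.differentiable hA.lipschitz
      hA.lipschitz_jacobian w w') hη hηL (X.u 0) (chainGrad K hd X.v)
  have h1 := mul_le_mul_of_nonneg_left (norm_sub_gradient_sq_le K hd Lf LJ f X)
    (show 0 ≤ η / 2 by positivity)
  have e : (step K hd Lf val jac c η X x).u 0 = X.u 0 - η • chainGrad K hd X.v := rfl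
  rw [e]
  unfold optGap
  linarith

section Measurability

variable {m : MeasurableSpace Ω} {X : Ω → State d}

theorem measurable_optGap (hA : Assumptions K Lf LJ σf σJ ℓf ℓJ f val jac D) (hd : d K = 1)
    (hX : MeasState m K X) : Measurable[m] fun ω => optGap K hd f ((X ω).u 0) :=
  ((hA.differentiable_objective hd).continuous.measurable.comp (hX.u 0 (Nat.zero_le K))).sub_const _

theorem measurable_norm_gradient (hA : Assumptions K Lf LJ σf σJ ℓf ℓJ f val jac D) (hd : d K = 1)
    (hX : MeasState m K X) : Measurable[m] fun ω => ‖gradient (objective K hd f) ((X ω).u 0)‖ ^ 2 :=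
  ((hA.measurable_gradient hd).comp (hX.u 0 (Nat.zero_le K))).norm.pow_const 2

theorem measurable_excess (hA : Assumptions K Lf LJ σf σJ ℓf ℓJ f val jac D) (hd : d K = 1)
    (hX : MeasState m K X) : Measurable[m] fun ω => excess K hd Lf LJ f (X ω) :=
  measurable_const.max (((((measurable_chainGrad hd hX.v).sub
    ((hA.measurable_gradient hd).comp (hX.u 0 (Nat.zero_le K)))).norm).pow_const 2).sub
      ((measurable_sqError hA hX).const_mul _))

end Measurability

variable {mΩ : MeasurableSpace Ω} {P : Measure Ω}

/-- Integrability of the three quantities that are tracked along the trajectory. -/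
structure IntState (K : ℕ) (hd : d K = 1) (Lf LJ : ℝ≥0)
    (f : (i : ℕ) → Vec (d i) → Vec (d (i + 1))) (P : Measure Ω) (X : Ω → State d) : Prop where
  optGap : Integrable (fun ω => optGap K hd f ((X ω).u 0)) P
  sqError : Integrable (fun ω => sqError K f (X ω)) P
  excess : Integrable (fun ω => excess K hd Lf LJ f (X ω)) P

variable [IsProbabilityMeasure P] [∀ i, IsProbabilityMeasure (D i)] {X : Ω → State d}

theorem integrable_norm_gradient (hA : Assumptions K Lf LJ σf σJ ℓf ℓJ f val jac D) (hd : d K = 1)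
    (hX : MeasState mΩ K X) :
    Integrable (fun ω => ‖gradient (objective K hd f) ((X ω).u 0)‖ ^ 2) P :=
  integrable_of_nonneg_of_le (integrable_const (((Lf : ℝ) ^ K) ^ 2))
    (measurable_norm_gradient hA hd hX) (fun _ => sq_nonneg _) fun ω => by
      have := norm_gradient_objective_le hd hA.differentiable hA.lipschitz ((X ω).u 0)
      gcongr

/-- Splits v into the bounded gradient and the gradient error, since the initial Jacobians have no
uniform bound. -/
theorem integrable_norm_chainGrad (hA : Assumptions K Lf LJ σf σJ ℓf ℓJ f val jac D) (hd : d K = 1)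
    (hX : MeasState mΩ K X) (hI : IntState K hd Lf LJ f P X) :
    Integrable (fun ω => ‖chainGrad K hd (X ω).v‖ ^ 2) P := by
  refine integrable_of_nonneg_of_le (((integrable_norm_gradient hA hd hX).const_mul 2).add
    (((hI.sqError.const_mul (errConst K Lf LJ)).add hI.excess).const_mul 2))
    ((measurable_chainGrad hd hX.v).norm.pow_const 2) (fun _ => sq_nonneg _) fun ω => ?_
  have h := norm_add_sq_le_two (gradient (objective K hd f) ((X ω).u 0))
    (chainGrad K hd (X ω).v - gradient (objective K hd f) ((X ω).u 0))
  rw [add_sub_cancel] at h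
  have := norm_sub_gradient_sq_le K hd Lf LJ f (X ω)
  simp only [Pi.add_apply]
  linarith

theorem optGap_step (hA : Assumptions K Lf LJ σf σJ ℓf ℓJ f val jac D) (hd : d K = 1)
    (hbdd : BddBelow (Set.range (objective K hd f)))
    (hX : MeasState mΩ K X) (hI : IntState K hd Lf LJ f P X)
    {x : (i : ℕ) → Ω → Ξ i} {c η : ℝ} (hη : 0 ≤ η) (hηL : η * gradConst K Lf LJ ≤ 1 / 4)
    (hX' : MeasState mΩ K fun ω => step K hd Lf val jac c η (X ω) fun i => x i ω) :
    Integrable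
        (fun ω => optGap K hd f ((step K hd Lf val jac c η (X ω) fun i => x i ω).u 0)) P ∧
      ∫ ω, optGap K hd f ((step K hd Lf val jac c η (X ω) fun i => x i ω).u 0) ∂P +
          η / 2 * ∫ ω, ‖gradient (objective K hd f) ((X ω).u 0)‖ ^ 2 ∂P +
            η / 4 * ∫ ω, ‖chainGrad K hd (X ω).v‖ ^ 2 ∂P ≤
        ∫ ω, optGap K hd f ((X ω).u 0) ∂P + η / 2 * (errConst K Lf LJ *
          ∫ ω, sqError K f (X ω) ∂P + ∫ ω, excess K hd Lf LJ f (X ω) ∂P) := by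
  have hpt := fun ω => hA.optGap_step_le hd hη hηL c (X ω) fun i => x i ω
  have i1 : Integrable (fun ω => errConst K Lf LJ * sqError K f (X ω)) P := hI.sqError.const_mul _
  have i2 : Integrable (fun ω => errConst K Lf LJ * sqError K f (X ω) +
      excess K hd Lf LJ f (X ω)) P := i1.add hI.excess
  have i3 : Integrable (fun ω => η / 2 * (errConst K Lf LJ * sqError K f (X ω) +
      excess K hd Lf LJ f (X ω))) P := i2.const_mul _
  have i4 : Integrable (fun ω => optGap K hd f ((X ω).u 0) + η / 2 * (errConst K Lf LJ *
      sqError K f (X ω) + excess K hd Lf LJ f (X ω))) P := hI.optGap.add i3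
  have j1 : Integrable (fun ω => η / 2 * ‖gradient (objective K hd f) ((X ω).u 0)‖ ^ 2) P :=
    (integrable_norm_gradient hA hd hX).const_mul _
  have j2 : Integrable (fun ω => η / 4 * ‖chainGrad K hd (X ω).v‖ ^ 2) P :=
    (integrable_norm_chainGrad hA hd hX hI).const_mul _
  have hi : Integrable
      (fun ω => optGap K hd f ((step K hd Lf val jac c η (X ω) fun i => x i ω).u 0)) P :=
    integrable_of_nonneg_of_le i4 (measurable_optGap hA hd hX') (fun _ => optGap_nonneg hbdd _)
      fun ω => by
        have h1 : 0 ≤ η / 2 * ‖gradient (objective K hd f) ((X ω).u 0)‖ ^ 2 := by positivity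
        have h2 : 0 ≤ η / 4 * ‖chainGrad K hd (X ω).v‖ ^ 2 := by positivity
        linarith [hpt ω]
  refine ⟨hi, ?_⟩
  have j3 : Integrable (fun ω =>
      optGap K hd f ((step K hd Lf val jac c η (X ω) fun i => x i ω).u 0) +
        η / 2 * ‖gradient (objective K hd f) ((X ω).u 0)‖ ^ 2) P := hi.add j1
  have h := integral_mono (j3.add j2) i4 hpt
  simp only [Pi.add_apply] at h
  rwa [integral_add j3 j2, integral_add hi j1, integral_const_mul, integral_const_mul,
    integral_add hI.optGap i3, integral_const_mul, integral_add i1 hI.excess,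
    integral_const_mul] at h

/-- Conditions on the parameters `c` and `η` of a stage. -/
structure Admissible (K : ℕ) (Lf LJ ℓf ℓJ : ℝ≥0) (c η : ℝ) : Prop where
  c_pos : 0 < c
  η_pos : 0 < η
  β_le_one : c * η ^ 2 ≤ 1
  move_le : moveConst K ℓf ℓJ * (c * η ^ 2) ≤ 1 / 2
  grad_le : η * gradConst K Lf LJ ≤ 1 / 4
  le_c : 16 * errConst K Lf LJ * moveConst K ℓf ℓJ ≤ c

theorem intState_step (hA : Assumptions K Lf LJ σf σJ ℓf ℓJ f val jac D) (hd : d K = 1)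
    (hbdd : BddBelow (Set.range (objective K hd f))) {c η : ℝ}
    (hc : Admissible K Lf LJ ℓf ℓJ c η) {𝓗 : ℕ → MeasurableSpace Ω} {x : (i : ℕ) → Ω → Ξ i}
    (hx : FreshSamples P K D 𝓗 x) (hX : MeasState (𝓗 0) K X) (hI : IntState K hd Lf LJ f P X) :
    IntState K hd Lf LJ f P (fun ω => step K hd Lf val jac c η (X ω) fun i => x i ω) := by
  have hX0 := hX.mono (hx.le 0 (Nat.zero_le K))
  have hX' := (measState_step hA hd hx hX c η).mono (hx.le K le_rfl)
  have := hc.c_pos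
  refine ⟨(optGap_step hA hd hbdd hX0 hI hc.η_pos.le hc.grad_le hX').1,
    (sqError_step hA hd hx hX (by positivity) hc.β_le_one hc.move_le hI.sqError
      (integrable_norm_chainGrad hA hd hX0 hI)).1, ?_⟩
  simp only [excess_step hA hd]
  exact integrable_const 0

/-- Decrease of `gap + λ * sqError` in one time step, for a suitable `λ`. -/
theorem lyapunov_step (hA : Assumptions K Lf LJ σf σJ ℓf ℓJ f val jac D) (hd : d K = 1)
    (hbdd : BddBelow (Set.range (objective K hd f))) {c η : ℝ}
    (hc : Admissible K Lf LJ ℓf ℓJ c η) {𝓗 : ℕ → MeasurableSpace Ω} {x : (i : ℕ) → Ω → Ξ i}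
    (hx : FreshSamples P K D 𝓗 x) (hX : MeasState (𝓗 0) K X) (hI : IntState K hd Lf LJ f P X) :
    ∫ ω, optGap K hd f ((step K hd Lf val jac c η (X ω) fun i => x i ω).u 0) ∂P +
        2 * errConst K Lf LJ / (c * η) *
          ∫ ω, sqError K f (step K hd Lf val jac c η (X ω) fun i => x i ω) ∂P +
        η / 2 * ∫ ω, ‖gradient (objective K hd f) ((X ω).u 0)‖ ^ 2 ∂P +
        η / 2 * (errConst K Lf LJ * ∫ ω, sqError K f (X ω) ∂P) ≤
      ∫ ω, optGap K hd f ((X ω).u 0) ∂P +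
        2 * errConst K Lf LJ / (c * η) * ∫ ω, sqError K f (X ω) ∂P +
        2 * η * errConst K Lf LJ * noiseConst K σf σJ ℓf ℓJ * (c * η ^ 2) +
        η / 2 * ∫ ω, excess K hd Lf LJ f (X ω) ∂P := by
  have hX0 := hX.mono (hx.le 0 (Nat.zero_le K))
  have hX' := (measState_step hA hd hx hX c η).mono (hx.le K le_rfl)
  have hc0 := hc.c_pos
  have hη0 := hc.η_pos
  have h1 := (optGap_step hA hd hbdd hX0 hI hc.η_pos.le hc.grad_le hX').2
  have h2 := (sqError_step hA hd hx hX (by positivity) hc.β_le_one hc.move_le hI.sqError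
      (integrable_norm_chainGrad hA hd hX0 hI)).2
  have hE := two_le_errConst K Lf LJ
  have hN : 0 ≤ ∫ ω, ‖chainGrad K hd (X ω).v‖ ^ 2 ∂P := integral_nonneg fun _ => sq_nonneg _
  set Φ := ∫ ω, sqError K f (X ω) ∂P
  set Φ' := ∫ ω, sqError K f (step K hd Lf val jac c η (X ω) fun i => x i ω) ∂P
  set N := ∫ ω, ‖chainGrad K hd (X ω).v‖ ^ 2 ∂P
  set E := errConst K Lf LJ
  set M := moveConst K ℓf ℓJ
  set S := noiseConst K σf σJ ℓf ℓJ
  -- The weight 2E/(cη) turns the contraction by c η²/2 into the gain η E Φ, twice the gradient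
  -- error η/2 E Φ; the surplus stays on the left.
  have h3 := mul_le_mul_of_nonneg_left h2 (show 0 ≤ 2 * E / (c * η) by positivity)
  have e3 : 2 * E / (c * η) * ((1 - c * η ^ 2 / 2) * Φ + S * (c * η ^ 2) ^ 2 + M * (η ^ 2 * N)) =
      2 * E / (c * η) * Φ - η * E * Φ + 2 * η * E * S * (c * η ^ 2) + 2 * E * M / c * (η * N) := by
    field_simp
  rw [e3] at h3
  -- The movement costs at most half of the η/4 ‖v‖² gained by descent.
  have h4 : 2 * E * M / c * (η * N) ≤ 1 / 8 * (η * N) := by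
    have : 2 * E * M / c ≤ 1 / 8 := by
      rw [div_le_iff₀ hc0]; have := hc.le_c; linarith
    gcongr
  have h5 : 0 ≤ η * N := by positivity
  linarith

/-- The quantity whose expectation halves in every stage. -/
def potential (K : ℕ) (hd : d K = 1) (Lf LJ : ℝ≥0) (f : (i : ℕ) → Vec (d i) → Vec (d (i + 1)))
    (μ : ℝ) (X : State d) : ℝ :=
  μ * optGap K hd f (X.u 0) + sqError K f X + excess K hd Lf LJ f X

theorem potential_integral {hd : d K = 1} (hI : IntState K hd Lf LJ f P X) (μ : ℝ) :
    Integrable (fun ω => potential K hd Lf LJ f μ (X ω)) P ∧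
      ∫ ω, potential K hd Lf LJ f μ (X ω) ∂P = μ * ∫ ω, optGap K hd f ((X ω).u 0) ∂P +
        ∫ ω, sqError K f (X ω) ∂P + ∫ ω, excess K hd Lf LJ f (X ω) ∂P := by
  have i1 : Integrable (fun ω => μ * optGap K hd f ((X ω).u 0)) P := hI.optGap.const_mul μ
  have i2 : Integrable (fun ω => μ * optGap K hd f ((X ω).u 0) + sqError K f (X ω)) P :=
    i1.add hI.sqError
  unfold potential
  refine ⟨i2.add hI.excess, ?_⟩
  rw [integral_add i2 hI.excess, integral_add i1 hI.sqError, integral_const_mul]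

/-- The potential summed over the time steps of a stage. -/
theorem sum_potential_le (hA : Assumptions K Lf LJ σf σJ ℓf ℓJ f val jac D) (hd : d K = 1)
    (hbdd : BddBelow (Set.range (objective K hd f))) {c η μ : ℝ}
    (hc : Admissible K Lf LJ ℓf ℓJ c η) {𝓗 : ℕ → ℕ → MeasurableSpace Ω}
    {x : ℕ → (i : ℕ) → Ω → Ξ i} {X : ℕ → Ω → State d}
    (hx : ∀ t, FreshSamples P K D (𝓗 t) (x t)) (hX : ∀ t, MeasState (𝓗 t 0) K (X t))
    (hstep : ∀ t, X (t + 1) = fun ω => step K hd Lf val jac c η (X t ω) fun i => x t i ω)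
    (hI : IntState K hd Lf LJ f P (X 0)) {W : Set (Vec (d 0))}
    (hPL : PLOn μ (objective K hd f) W) {T : ℕ} (hT : 0 < T)
    (hW : ∀ t < T, ∀ᵐ ω ∂P, (X t ω).u 0 ∈ W) :
    (∀ t, IntState K hd Lf LJ f P (X t)) ∧
      ∑ t ∈ Finset.range T, ∫ ω, potential K hd Lf LJ f μ (X t ω) ∂P ≤
        (∫ ω, optGap K hd f ((X 0 ω).u 0) ∂P) / η +
          2 * errConst K Lf LJ / (c * η ^ 2) * ∫ ω, sqError K f (X 0 ω) ∂P +
          T * (2 * errConst K Lf LJ * noiseConst K σf σJ ℓf ℓJ * (c * η ^ 2)) +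
          3 / 2 * ∫ ω, excess K hd Lf LJ f (X 0 ω) ∂P := by
  have hInt : ∀ t, IntState K hd Lf LJ f P (X t) := by
    intro t
    induction t with
    | zero => exact hI
    | succ t ih => rw [hstep t]; exact intState_step hA hd hbdd hc (hx t) (hX t) ih
  refine ⟨hInt, ?_⟩
  have hη0 := hc.η_pos
  have hc0 := hc.c_pos
  have hE := two_le_errConst K Lf LJ
  set E := errConst K Lf LJ
  set S := noiseConst K σf σJ ℓf ℓJ
  set g : ℕ → ℝ := fun t => ∫ ω, optGap K hd f ((X t ω).u 0) ∂P with hg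
  set Φ : ℕ → ℝ := fun t => ∫ ω, sqError K f (X t ω) ∂P with hΦ
  set r : ℕ → ℝ := fun t => ∫ ω, excess K hd Lf LJ f (X t ω) ∂P with hr
  have hg0 : ∀ t, 0 ≤ g t := fun t => integral_nonneg fun _ => optGap_nonneg hbdd _
  have hΦ0 : ∀ t, 0 ≤ Φ t := fun t => integral_nonneg fun _ => sqError_nonneg _ _ _
  have hrs : ∀ t, r (t + 1) = 0 := by
    intro t
    simp only [hr, hstep t, excess_step hA hd, integral_zero]
  have hr0 : 0 ≤ r 0 := integral_nonneg fun _ => excess_nonneg _ _ _ _ _ _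
  -- The only use of the PL inequality; it is needed just at the iterates, almost surely.
  have hpl : ∀ t < T, μ * g t ≤
      1 / 2 * ∫ ω, ‖gradient (objective K hd f) ((X t ω).u 0)‖ ^ 2 ∂P := by
    intro t ht
    rw [hg, ← integral_const_mul, ← integral_const_mul]
    refine integral_mono_ae ((hInt t).optGap.const_mul _)
      ((integrable_norm_gradient hA hd ((hX t).mono ((hx t).le 0 (Nat.zero_le K)))).const_mul _) ?_
    filter_upwards [hW t ht] with ω hω
    have := hPL _ hω
    simp only [optGap]
    linarith
  -- The one-step decrease divided by η. The excess has coefficient 3/2: 1/2 from the gradient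
  -- error, 1 from its share in the potential, added on both sides.
  have hstep' : ∀ t < T, g (t + 1) / η + 2 * E / (c * η ^ 2) * Φ (t + 1) +
      (μ * g t + Φ t + r t) ≤ g t / η + 2 * E / (c * η ^ 2) * Φ t + 2 * E * S * (c * η ^ 2) +
        3 / 2 * r t := by
    intro t ht
    have h := lyapunov_step hA hd hbdd hc (hx t) (hX t) (hInt t)
    have eg : ∫ ω, optGap K hd f ((step K hd Lf val jac c η (X t ω) fun i => x t i ω).u 0) ∂P =
        g (t + 1) := by simp only [hg, hstep t]
    have eΦ : ∫ ω, sqError K f (step K hd Lf val jac c η (X t ω) fun i => x t i ω) ∂P =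
        Φ (t + 1) := by simp only [hΦ, hstep t]
    rw [eg, eΦ] at h
    have h1 := hpl t ht
    have h2 := mul_le_mul_of_nonneg_right hE (hΦ0 t)
    have key : η * (g (t + 1) / η + 2 * E / (c * η ^ 2) * Φ (t + 1) + (μ * g t + Φ t + r t)) ≤
        η * (g t / η + 2 * E / (c * η ^ 2) * Φ t + 2 * E * S * (c * η ^ 2) + 3 / 2 * r t) := by
      have e1 : ∀ y, η * (2 * E / (c * η ^ 2) * y) = 2 * E / (c * η) * y := by
        intro y; field_simp
      have e2 : ∀ y, η * (y / η) = y := by intro y; field_simp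
      simp only [mul_add, e1, e2]
      have h3 := mul_le_mul_of_nonneg_left h1 hη0.le
      have h4 := mul_le_mul_of_nonneg_left h2 hη0.le
      simp only [hg, hΦ, hr] at *
      linarith
    exact le_of_mul_le_mul_left key hη0
  have hsum : ∀ n ≤ T, g n / η + 2 * E / (c * η ^ 2) * Φ n +
      ∑ t ∈ Finset.range n, (μ * g t + Φ t + r t) ≤
        g 0 / η + 2 * E / (c * η ^ 2) * Φ 0 + n * (2 * E * S * (c * η ^ 2)) +
          3 / 2 * ∑ t ∈ Finset.range n, r t := by
    intro n
    induction n with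
    | zero => intro _; simp
    | succ n ih =>
      intro hn
      have h1 := ih (by omega)
      have h2 := hstep' n hn
      rw [Finset.sum_range_succ, Finset.sum_range_succ]
      push_cast
      linarith
  have hfin := hsum T le_rfl
  -- Every state after the first one of the stage is projected, so only time 0 contributes.
  have hrT : ∑ t ∈ Finset.range T, r t = r 0 :=
    Finset.sum_eq_single_of_mem 0 (Finset.mem_range.2 hT) fun t _ ht => by
      obtain ⟨k, rfl⟩ := Nat.exists_eq_succ_of_ne_zero ht
      exact hrs k
  rw [hrT] at hfin
  simp only [(potential_integral (hInt _) μ).2]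
  have h6 : 0 ≤ g T / η := div_nonneg (hg0 T) hη0.le
  have h7 : 0 ≤ 2 * E / (c * η ^ 2) * Φ T := mul_nonneg (by positivity) (hΦ0 T)
  linarith

end Stage

/-! ### Histories of the samples and of the output indices -/

section History

variable {Ω : Type*} {Ξ : ℕ → Type*} [∀ i, MeasurableSpace (Ξ i)] {K : ℕ}

/-- The σ-algebra generated by a sample (left summand) or by an output index (right summand). -/
@[reducible]
def sourceSigma (K : ℕ) (ξ : ℕ → ℕ → (i : ℕ) → Ω → Ξ i) (τ : ℕ → Ω → ℕ) :
    (ℕ × ℕ × Fin K) ⊕ ℕ → MeasurableSpace Ω :=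
  Sum.elim
    (fun p : ℕ × ℕ × Fin K =>
      MeasurableSpace.comap (ξ p.1 p.2.1 p.2.2) (inferInstance : MeasurableSpace (Ξ p.2.2)))
    (fun s : ℕ => MeasurableSpace.comap (τ s) ⊤)

/-- The σ-algebra generated by a set of samples and indices. -/
@[reducible]
def history (K : ℕ) (ξ : ℕ → ℕ → (i : ℕ) → Ω → Ξ i) (τ : ℕ → Ω → ℕ)
    (A : Set ((ℕ × ℕ × Fin K) ⊕ ℕ)) : MeasurableSpace Ω :=
  ⨆ q ∈ A, sourceSigma K ξ τ q

/-- The samples and indices drawn before the sample of level `i` at time `t` of stage `s`. -/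
def before (K s t i : ℕ) : Set ((ℕ × ℕ × Fin K) ⊕ ℕ) :=
  {q | Sum.elim (fun p : ℕ × ℕ × Fin K => p.1 < s ∨ (p.1 = s ∧ (p.2.1 < t ∨
    (p.2.1 = t ∧ (p.2.2 : ℕ) < i)))) (fun s' => s' < s) q}

/-- The samples and indices drawn before the output index of stage `s`. -/
def beforeIndex (K s : ℕ) : Set ((ℕ × ℕ × Fin K) ⊕ ℕ) :=
  {q | Sum.elim (fun p : ℕ × ℕ × Fin K => p.1 ≤ s) (fun s' => s' < s) q}

theorem before_succ_level (s t i : ℕ) : before K s t i ⊆ before K s t (i + 1) := by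
  rintro (p | s') h
  · simp only [before, Set.mem_ofPred_eq, Sum.elim_inl] at h ⊢; omega
  · exact h

theorem before_last_level (s t : ℕ) : before K s t K ⊆ before K s (t + 1) 0 := by
  rintro (p | s') h
  · simp only [before, Set.mem_ofPred_eq, Sum.elim_inl] at h ⊢; omega
  · exact h

theorem before_subset_beforeIndex (s t i : ℕ) : before K s t i ⊆ beforeIndex K s := by
  rintro (p | s') h
  · simp only [before, beforeIndex, Set.mem_ofPred_eq, Sum.elim_inl] at h ⊢; omega
  · exact h

theorem beforeIndex_subset_before (s t i : ℕ) : beforeIndex K s ⊆ before K (s + 1) t i := by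
  rintro (p | s') h
  · simp only [before, beforeIndex, Set.mem_ofPred_eq, Sum.elim_inl] at h ⊢; omega
  · simp only [before, beforeIndex, Set.mem_ofPred_eq, Sum.elim_inr] at h ⊢; omega

variable {ξ : ℕ → ℕ → (i : ℕ) → Ω → Ξ i} {τ : ℕ → Ω → ℕ}

theorem history_mono {A B : Set ((ℕ × ℕ × Fin K) ⊕ ℕ)} (h : A ⊆ B) :
    history K ξ τ A ≤ history K ξ τ B :=
  biSup_mono fun _ hq => h hq

theorem measurable_sample_history {A : Set ((ℕ × ℕ × Fin K) ⊕ ℕ)} {s t i : ℕ} (hi : i < K)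
    (h : Sum.inl (s, t, ⟨i, hi⟩) ∈ A) : Measurable[history K ξ τ A] (ξ s t i) :=
  (comap_measurable (ξ s t i)).mono
    (le_biSup (sourceSigma K ξ τ) h : sourceSigma K ξ τ (Sum.inl (s, t, ⟨i, hi⟩)) ≤ _) le_rfl

theorem measurable_index_history {A : Set ((ℕ × ℕ × Fin K) ⊕ ℕ)} {s : ℕ} (h : Sum.inr s ∈ A) :
    Measurable[history K ξ τ A] (τ s) :=
  (comap_measurable (τ s)).mono
    (le_biSup (sourceSigma K ξ τ) h : sourceSigma K ξ τ (Sum.inr s) ≤ _) le_rfl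

variable {mΩ : MeasurableSpace Ω} {P : Measure Ω} {D : (i : ℕ) → Measure (Ξ i)} {T : ℕ → ℕ}

theorem IsSampling.sourceSigma_le (h : IsSampling P K D T ξ τ) (q : (ℕ × ℕ × Fin K) ⊕ ℕ) :
    sourceSigma K ξ τ q ≤ mΩ := by
  rcases q with p | s
  · exact (h.measurable_sample p.1 p.2.1 p.2.2 p.2.2.2).comap_le
  · exact (h.measurable_index s).comap_le

theorem IsSampling.history_le (h : IsSampling P K D T ξ τ) (A : Set ((ℕ × ℕ × Fin K) ⊕ ℕ)) :
    history K ξ τ A ≤ mΩ :=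
  iSup₂_le fun q _ => h.sourceSigma_le q

theorem IsSampling.indep_history (h : IsSampling P K D T ξ τ) {A : Set ((ℕ × ℕ × Fin K) ⊕ ℕ)}
    {q : (ℕ × ℕ × Fin K) ⊕ ℕ} (hq : q ∉ A) :
    Indep (history K ξ τ A) (sourceSigma K ξ τ q) P := by
  have h1 := indep_iSup_of_disjoint h.sourceSigma_le h.indep
    (Set.disjoint_singleton_right.2 hq)
  exact indep_of_indep_of_le_right h1
    (le_biSup (sourceSigma K ξ τ) (Set.mem_singleton q))

/-- The history of level i contains the samples of the same time at lower levels but not its own,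
matching the nested evaluation of the estimators. -/
theorem IsSampling.freshSamples (h : IsSampling P K D T ξ τ) (s t : ℕ) :
    FreshSamples P K D (fun i => history K ξ τ (before K s t i)) (fun i => ξ s t i) where
  le i _ := h.history_le _
  mono i _ := history_mono (before_succ_level s t i)
  measurable i hi := measurable_sample_history hi (by simp [before])
  law i hi := h.law_sample s t i hi
  indep i hi := h.indep_history (q := Sum.inl (s, t, ⟨i, hi⟩)) (by simp [before])

/-- The history taken here contains all samples of the stage, also those past the output index, so
that the whole trajectory is independent of that index. -/
theorem IsSampling.indep_index (h : IsSampling P K D T ξ τ) (s : ℕ) :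
    Indep (history K ξ τ (beforeIndex K s)) (MeasurableSpace.comap (τ s) ⊤) P :=
  h.indep_history (q := Sum.inr s) (by simp [beforeIndex])

end History

/-! ### The random trajectory -/

section Trajectory

variable {d : ℕ → ℕ} {Ω : Type*} {Ξ : ℕ → Type*} [∀ i, MeasurableSpace (Ξ i)]

/-- The random state in which stage `s` starts. -/
def stageStart (K : ℕ) (hd : d K = 1) (Lf : ℝ≥0)
    (val : (i : ℕ) → Vec (d i) → Ξ i → Vec (d (i + 1)))
    (jac : (i : ℕ) → Vec (d i) → Ξ i → Vec (d i) →L[ℝ] Vec (d (i + 1)))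
    (c : ℝ) (η : ℕ → ℝ) (w : Vec (d 0)) (ξ : ℕ → ℕ → (i : ℕ) → Ω → Ξ i) (τ : ℕ → Ω → ℕ)
    (s : ℕ) (ω : Ω) : State d :=
  stagewise K hd Lf val jac c η w (fun s t i => ξ s t i ω) (fun s => τ s ω) s

/-- The random state at time index `t` of stage `s`. -/
def stageState (K : ℕ) (hd : d K = 1) (Lf : ℝ≥0)
    (val : (i : ℕ) → Vec (d i) → Ξ i → Vec (d (i + 1)))
    (jac : (i : ℕ) → Vec (d i) → Ξ i → Vec (d i) →L[ℝ] Vec (d (i + 1)))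
    (c : ℝ) (η : ℕ → ℝ) (w : Vec (d 0)) (ξ : ℕ → ℕ → (i : ℕ) → Ω → Ξ i) (τ : ℕ → Ω → ℕ)
    (s t : ℕ) (ω : Ω) : State d :=
  smvr K hd Lf val jac c (η s) (stageStart K hd Lf val jac c η w ξ τ s ω) (fun t i => ξ s t i ω) t

variable {K : ℕ} {Lf LJ σf σJ ℓf ℓJ : ℝ≥0} {f : (i : ℕ) → Vec (d i) → Vec (d (i + 1))}
  {val : (i : ℕ) → Vec (d i) → Ξ i → Vec (d (i + 1))}
  {jac : (i : ℕ) → Vec (d i) → Ξ i → Vec (d i) →L[ℝ] Vec (d (i + 1))}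
  {D : (i : ℕ) → Measure (Ξ i)} {mΩ : MeasurableSpace Ω} {P : Measure Ω}

theorem measurable_initU {𝓗 : ℕ → MeasurableSpace Ω} {x : (i : ℕ) → Ω → Ξ i}
    (hA : Assumptions K Lf LJ σf σJ ℓf ℓJ f val jac D) (hx : FreshSamples P K D 𝓗 x)
    (w : Vec (d 0)) : ∀ i ≤ K, Measurable[𝓗 i] fun ω => initU val w (fun i => x i ω) i
  | 0, _ => measurable_const
  | i + 1, hi => (hA.measurable_val i hi).comp
      (((measurable_initU hA hx w i (by omega)).mono (hx.mono i hi) le_rfl).prodMk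
        (hx.measurable i hi))

theorem measurable_init_jac {𝓗 : ℕ → MeasurableSpace Ω} {x : (i : ℕ) → Ω → Ξ i}
    (hA : Assumptions K Lf LJ σf σJ ℓf ℓJ f val jac D) (hx : FreshSamples P K D 𝓗 x)
    (w : Vec (d 0)) {i : ℕ} (hi : i < K) :
    Measurable[𝓗 (i + 1)] fun ω => jac i (initU val w (fun i => x i ω) i) (x i ω) :=
  (hA.measurable_jac i hi).comp
    (((measurable_initU hA hx w i hi.le).mono (hx.mono i hi) le_rfl).prodMk (hx.measurable i hi))

theorem measState_init {𝓗 : ℕ → MeasurableSpace Ω} {x : (i : ℕ) → Ω → Ξ i}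
    (hA : Assumptions K Lf LJ σf σJ ℓf ℓJ f val jac D) (hx : FreshSamples P K D 𝓗 x)
    (w : Vec (d 0)) : MeasState (𝓗 K) K fun ω => initState val jac w fun i => x i ω where
  u i hi := (measurable_initU hA hx w i hi).mono (hx.le_last hi le_rfl) le_rfl
  v _ hi := (measurable_init_jac hA hx w hi).mono (hx.le_last hi le_rfl) le_rfl

theorem measurable_at_index {m : MeasurableSpace Ω} {E : Type*} [MeasurableSpace E] {σ : Ω → ℕ}
    (hσ : Measurable[m] σ) {g : ℕ → Ω → E} (hg : ∀ t, Measurable[m] (g t)) :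
    Measurable[m] fun ω => g (σ ω) ω := by
  have h : Measurable[Prod.instMeasurableSpace] fun q : Ω × ℕ => g q.2 q.1 :=
    measurable_from_prod_countable_left hg
  exact h.comp (measurable_id.prodMk hσ)

variable {c : ℝ} {η : ℕ → ℝ} {w : Vec (d 0)} {ξ : ℕ → ℕ → (i : ℕ) → Ω → Ξ i} {τ : ℕ → Ω → ℕ}
  {T : ℕ → ℕ}

/-- The state at index t has used samples up to index t and is therefore known before index t + 1.
The start has index 0, which explains the 1 in the hypothesis. -/
theorem measState_stageState_of_start (hA : Assumptions K Lf LJ σf σJ ℓf ℓJ f val jac D)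
    (hd : d K = 1) (hS : IsSampling P K D T ξ τ) {s : ℕ}
    (h : MeasState (history K ξ τ (before K s 1 0)) K (stageStart K hd Lf val jac c η w ξ τ s)) :
    ∀ t, MeasState (history K ξ τ (before K s (t + 1) 0)) K
      (stageState K hd Lf val jac c η w ξ τ s t)
  | 0 => h
  | t + 1 => (measState_step hA hd (hS.freshSamples s (t + 1))
      (measState_stageState_of_start hA hd hS h t) c (η s)).mono
        (history_mono (before_last_level s (t + 1)))

theorem measState_stageStart (hA : Assumptions K Lf LJ σf σJ ℓf ℓJ f val jac D)
    (hd : d K = 1) (hS : IsSampling P K D T ξ τ) : ∀ s,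
    MeasState (history K ξ τ (before K s 1 0)) K (stageStart K hd Lf val jac c η w ξ τ s)
  | 0 => (measState_init hA (hS.freshSamples 0 0) w).mono (history_mono (before_last_level 0 0))
  | s + 1 => by
    -- All states of stage s and its index `τ s` precede the samples of stage s + 1, so the state at
    -- that index does too.
    have h := fun t => (measState_stageState_of_start hA hd hS
      (measState_stageStart hA hd hS s) t).mono
        (history_mono ((before_subset_beforeIndex s (t + 1) 0).trans
          (beforeIndex_subset_before s 1 0)))
    have hτ : Measurable[history K ξ τ (before K (s + 1) 1 0)] (τ s) :=
      measurable_index_history (by simp [before])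
    exact ⟨fun i hi => measurable_at_index hτ fun t => (h t).u i hi,
      fun i hi => measurable_at_index hτ fun t => (h t).v i hi⟩

theorem measState_stageState (hA : Assumptions K Lf LJ σf σJ ℓf ℓJ f val jac D)
    (hd : d K = 1) (hS : IsSampling P K D T ξ τ) (s t : ℕ) :
    MeasState (history K ξ τ (before K s (t + 1) 0)) K
      (stageState K hd Lf val jac c η w ξ τ s t) :=
  measState_stageState_of_start hA hd hS (measState_stageStart hA hd hS s) t

variable [IsProbabilityMeasure P] [∀ i, IsProbabilityMeasure (D i)]

/-- One stage: the potential of the output is at most the average potential. -/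
theorem stage_bound (hA : Assumptions K Lf LJ σf σJ ℓf ℓJ f val jac D) (hd : d K = 1)
    (hbdd : BddBelow (Set.range (objective K hd f))) (hS : IsSampling P K D T ξ τ) {s : ℕ}
    (hT : 0 < T s) {μ : ℝ} (hc : Admissible K Lf LJ ℓf ℓJ c (η s))
    (hI : IntState K hd Lf LJ f P (stageStart K hd Lf val jac c η w ξ τ s)) {W : Set (Vec (d 0))}
    (hPL : PLOn μ (objective K hd f) W)
    (hW : ∀ t < T s, ∀ᵐ ω ∂P, (stageState K hd Lf val jac c η w ξ τ s t ω).u 0 ∈ W) :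
    IntState K hd Lf LJ f P (stageStart K hd Lf val jac c η w ξ τ (s + 1)) ∧
      T s * ∫ ω, potential K hd Lf LJ f μ (stageStart K hd Lf val jac c η w ξ τ (s + 1) ω) ∂P ≤
        (∫ ω, optGap K hd f ((stageStart K hd Lf val jac c η w ξ τ s ω).u 0) ∂P) / η s +
          2 * errConst K Lf LJ / (c * η s ^ 2) *
            ∫ ω, sqError K f (stageStart K hd Lf val jac c η w ξ τ s ω) ∂P +
          T s * (2 * errConst K Lf LJ * noiseConst K σf σJ ℓf ℓJ * (c * η s ^ 2)) +
          3 / 2 * ∫ ω, excess K hd Lf LJ f (stageStart K hd Lf val jac c η w ξ τ s ω) ∂P := by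
  have hM := measState_stageState (c := c) (η := η) (w := w) hA hd hS s
  obtain ⟨hInt, hsum⟩ := sum_potential_le hA hd hbdd hc
    (x := fun t i => ξ s (t + 1) i) (X := stageState K hd Lf val jac c η w ξ τ s)
    (fun t => hS.freshSamples s (t + 1)) hM (fun t => rfl) hI hPL hT hW
  have hM' : ∀ t, MeasState (history K ξ τ (beforeIndex K s)) K
      (stageState K hd Lf val jac c η w ξ τ s t) := fun t =>
    (hM t).mono (history_mono (before_subset_beforeIndex s (t + 1) 0))
  -- Used on the three components for integrability, and on the potential for the bound.
  have avg : ∀ {q : State d → ℝ},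
      (∀ t, Measurable[history K ξ τ (beforeIndex K s)] fun ω =>
        q (stageState K hd Lf val jac c η w ξ τ s t ω)) →
      (∀ t, Integrable (fun ω => q (stageState K hd Lf val jac c η w ξ τ s t ω)) P) →
      Integrable (fun ω => q (stageStart K hd Lf val jac c η w ξ τ (s + 1) ω)) P ∧
        T s * ∫ ω, q (stageStart K hd Lf val jac c η w ξ τ (s + 1) ω) ∂P =
          ∑ t ∈ Finset.range (T s), ∫ ω, q (stageState K hd Lf val jac c η w ξ τ s t ω) ∂P :=
    fun {q} h1 h2 => integral_random_index hT (hS.measurable_index s) (hS.uniform_index s)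
      (hS.indep_index s) (g := fun t ω => q (stageState K hd Lf val jac c η w ξ τ s t ω)) h1
      fun t _ => h2 t
  refine ⟨⟨?_, ?_, ?_⟩, ?_⟩
  · exact (avg (q := fun X => optGap K hd f (X.u 0)) (fun t => measurable_optGap hA hd (hM' t))
      fun t => (hInt t).optGap).1
  · exact (avg (fun t => measurable_sqError hA (hM' t)) fun t => (hInt t).sqError).1
  · exact (avg (fun t => measurable_excess hA hd (hM' t)) fun t => (hInt t).excess).1
  · rw [(avg (q := potential K hd Lf LJ f μ) (fun t =>
      (((measurable_optGap hA hd (hM' t)).const_mul μ).add (measurable_sqError hA (hM' t))).add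
        (measurable_excess hA hd (hM' t))) fun t => (potential_integral (hInt t) μ).1).2]
    exact hsum

/-! ### The initial state -/

/-- Bound of the squared error of the gradient estimate of the initial state. -/
def initConst (K : ℕ) (Lf σJ : ℝ≥0) : ℝ :=
  2 * ((Lf : ℝ) ^ K) ^ 2 + 2 * (2 * (σJ : ℝ) ^ 2 + 2 * (Lf : ℝ) ^ 2) ^ K

theorem initConst_nonneg (K : ℕ) (Lf σJ : ℝ≥0) : 0 ≤ initConst K Lf σJ := by
  unfold initConst; positivity

/-- Each estimator is compared with the truth at its own estimated input, so only the oracle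
variances enter and nothing propagates. -/
theorem init_sqError {𝓗 : ℕ → MeasurableSpace Ω} {x : (i : ℕ) → Ω → Ξ i}
    (hA : Assumptions K Lf LJ σf σJ ℓf ℓJ f val jac D) (hx : FreshSamples P K D 𝓗 x)
    (w : Vec (d 0)) :
    Integrable (fun ω => sqError K f (initState val jac w fun i => x i ω)) P ∧
      ∫ ω, sqError K f (initState val jac w fun i => x i ω) ∂P ≤
        K * ((σf : ℝ) ^ 2 + σJ ^ 2) := by
  have hval : ∀ i < K, _ := fun i hi => integral_fresh_le (hx.le i hi.le) (hx.law i hi)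
    (hx.measurable' hi) (hx.indep i hi) (measurable_initU hA hx w i hi.le)
    (h := fun z => ‖val i z.1 z.2 - f i z.1‖ ^ 2)
    (((hA.measurable_val i hi).sub ((hA.measurable_fun hi).comp measurable_fst)).norm.pow_const 2)
    (fun _ => sq_nonneg _) (B := fun _ => (σf : ℝ) ^ 2) (integrable_const _)
    (fun _ => by positivity) (fun ω => hA.variance_val i hi _)
  have hjac : ∀ i < K, _ := fun i hi => integral_fresh_le (hx.le i hi.le) (hx.law i hi)
    (hx.measurable' hi) (hx.indep i hi) (measurable_initU hA hx w i hi.le)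
    (h := fun z => frobSq (jac i z.1 z.2 - fderiv ℝ (f i) z.1))
    (continuous_frobSq.measurable.comp
      ((hA.measurable_jac i hi).sub ((hA.measurable_fderiv hi).comp measurable_fst)))
    (fun _ => frobSq_nonneg _) (B := fun _ => (σJ : ℝ) ^ 2) (integrable_const _)
    (fun _ => by positivity) (fun ω => hA.variance_jac i hi _)
  have h := integral_sqError (P := P) (K := K) (f := f)
    (X := fun ω => initState val jac w fun i => x i ω)
    (fun i hi => (hval i hi).1) (fun i hi => (hjac i hi).1)
  refine ⟨h.1, ?_⟩
  rw [h.2]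
  calc _ ≤ ∑ _i ∈ Finset.range K, ((σf : ℝ) ^ 2 + (σJ : ℝ) ^ 2) := by
        refine Finset.sum_le_sum fun i hi => add_le_add ?_ ?_
        · exact (hval i (Finset.mem_range.1 hi)).2.trans_eq (by simp)
        · exact (hjac i (Finset.mem_range.1 hi)).2.trans_eq (by simp)
    _ = _ := by rw [Finset.sum_const, Finset.card_range, nsmul_eq_mul]

/-- Given the lower levels, a Jacobian sample has second moment at most 2σJ² + 2Lf², whatever its
input; conditioning level by level multiplies these bounds. -/
theorem init_jacProd {𝓗 : ℕ → MeasurableSpace Ω} {x : (i : ℕ) → Ω → Ξ i}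
    (hA : Assumptions K Lf LJ σf σJ ℓf ℓJ f val jac D) (hx : FreshSamples P K D 𝓗 x)
    (w : Vec (d 0)) : ∀ n ≤ K,
    Integrable (fun ω => ‖jacProd (initState val jac w fun i => x i ω).v n‖ ^ 2) P ∧
      ∫ ω, ‖jacProd (initState val jac w fun i => x i ω).v n‖ ^ 2 ∂P ≤
        (2 * (σJ : ℝ) ^ 2 + 2 * (Lf : ℝ) ^ 2) ^ n
  | 0, _ => by
    have h1 : ‖ContinuousLinearMap.id ℝ (Vec (d 0))‖ ^ 2 ≤ 1 :=
      pow_le_one₀ (norm_nonneg _) ContinuousLinearMap.norm_id_le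
    simp only [jacProd]
    exact ⟨integrable_const _, by simpa using h1⟩
  | n + 1, hn => by
    have ih := init_jacProd hA hx w n (by omega)
    set M : ℝ := 2 * (σJ : ℝ) ^ 2 + 2 * (Lf : ℝ) ^ 2 with hM
    have hM0 : 0 ≤ M := by positivity
    have hJm : Measurable[𝓗 n] fun ω => jacProd (initState val jac w fun i => x i ω).v n :=
      measurable_jacProd (K := n) (fun i hi => (measurable_init_jac hA hx w (i := i)
        (by omega)).mono (hx.le_last (Nat.succ_le_of_lt hi) (by omega)) le_rfl) n le_rfl
    have hY := (measurable_initU hA hx w n (by omega)).prodMk hJm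
    have hj := hA.measurable_jac n hn
    have hjac : Measurable fun z : (Vec (d n) × (Vec (d 0) →L[ℝ] Vec (d n))) × Ξ n =>
        jac n z.1.1 z.2 :=
      hj.comp (by fun_prop : Measurable fun z : (Vec (d n) × (Vec (d 0) →L[ℝ] Vec (d n))) × Ξ n =>
        (z.1.1, z.2))
    have hbound : ∀ y, ∫⁻ ξ, ENNReal.ofReal (‖jac n y ξ‖ ^ 2) ∂(D n) ≤ ENNReal.ofReal M := by
      intro y
      have hpt : ∀ ξ, ‖jac n y ξ‖ ^ 2 ≤
          2 * frobSq (jac n y ξ - fderiv ℝ (f n) y) + 2 * (Lf : ℝ) ^ 2 := by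
        intro ξ
        have h1 : ‖jac n y ξ‖ ≤ ‖jac n y ξ - fderiv ℝ (f n) y‖ + ‖fderiv ℝ (f n) y‖ :=
          norm_le_norm_sub_add _ _
        have h2 := norm_fderiv_le_of_lipschitz ℝ (x₀ := y) (hA.lipschitz n hn)
        have h3 := norm_sq_le_frobSq (jac n y ξ - fderiv ℝ (f n) y)
        calc ‖jac n y ξ‖ ^ 2 ≤ (‖jac n y ξ - fderiv ℝ (f n) y‖ + ‖fderiv ℝ (f n) y‖) ^ 2 := by
              gcongr
          _ ≤ 2 * (‖jac n y ξ - fderiv ℝ (f n) y‖ ^ 2 + ‖fderiv ℝ (f n) y‖ ^ 2) := add_sq_le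
          _ ≤ 2 * (frobSq (jac n y ξ - fderiv ℝ (f n) y) + (Lf : ℝ) ^ 2) := by gcongr
          _ = _ := by ring
      calc ∫⁻ ξ, ENNReal.ofReal (‖jac n y ξ‖ ^ 2) ∂(D n)
          ≤ ∫⁻ ξ, (2 * ENNReal.ofReal (frobSq (jac n y ξ - fderiv ℝ (f n) y)) +
              ENNReal.ofReal (2 * (Lf : ℝ) ^ 2)) ∂(D n) := by
            refine lintegral_mono fun ξ => (ENNReal.ofReal_le_ofReal (hpt ξ)).trans ?_
            have := frobSq_nonneg (jac n y ξ - fderiv ℝ (f n) y)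
            rw [ENNReal.ofReal_add (by positivity) (by positivity),
              ENNReal.ofReal_mul (by norm_num)]
            simp
        _ = 2 * ∫⁻ ξ, ENNReal.ofReal (frobSq (jac n y ξ - fderiv ℝ (f n) y)) ∂(D n) +
              ENNReal.ofReal (2 * (Lf : ℝ) ^ 2) := by
            rw [lintegral_add_right _ measurable_const, lintegral_const_mul']
            · simp
            · simp
        _ ≤ 2 * ENNReal.ofReal ((σJ : ℝ) ^ 2) + ENNReal.ofReal (2 * (Lf : ℝ) ^ 2) := by
            gcongr
            exact hA.variance_jac n hn y
        _ = ENNReal.ofReal M := by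
            rw [hM, ENNReal.ofReal_add (by positivity) (by positivity),
              ENNReal.ofReal_mul (by norm_num)]
            simp
    have key := integral_fresh_le (hx.le n (by omega)) (hx.law n hn) (hx.measurable' hn)
      (hx.indep n hn) hY (h := fun z => ‖jac n z.1.1 z.2‖ ^ 2 * ‖z.1.2‖ ^ 2) (by fun_prop)
      (fun _ => by positivity)
      (B := fun ω => M * ‖jacProd (initState val jac w fun i => x i ω).v n‖ ^ 2)
      (ih.1.const_mul M) (fun _ => by positivity) (fun ω => by
        simp_rw [ENNReal.ofReal_mul (sq_nonneg _)]
        rw [lintegral_mul_const' _ _ ENNReal.ofReal_ne_top, ENNReal.ofReal_mul hM0]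
        gcongr
        exact hbound _)
    have hle : ∀ ω, ‖jacProd (initState val jac w fun i => x i ω).v (n + 1)‖ ^ 2 ≤
        ‖jac n (initU val w (fun i => x i ω) n) (x n ω)‖ ^ 2 *
          ‖jacProd (initState val jac w fun i => x i ω).v n‖ ^ 2 := by
      intro ω
      rw [← mul_pow]
      gcongr
      exact ContinuousLinearMap.opNorm_comp_le _ _
    have hmeas : Measurable fun ω => jacProd (initState val jac w fun i => x i ω).v (n + 1) :=
      measurable_jacProd (K := n + 1) (fun i hi => (measurable_init_jac hA hx w (i := i)
        (by omega)).mono (hx.le (i + 1) (by omega)) le_rfl) (n + 1) le_rfl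
    have hi : Integrable
        (fun ω => ‖jacProd (initState val jac w fun i => x i ω).v (n + 1)‖ ^ 2) P :=
      integrable_of_nonneg_of_le key.1 (hmeas.norm.pow_const 2) (fun _ => sq_nonneg _) hle
    refine ⟨hi, (integral_mono hi key.1 hle).trans (key.2.trans ?_)⟩
    rw [integral_const_mul, pow_succ, mul_comm]
    exact mul_le_mul_of_nonneg_right ih.2 hM0

theorem init_excess {𝓗 : ℕ → MeasurableSpace Ω} {x : (i : ℕ) → Ω → Ξ i}
    (hA : Assumptions K Lf LJ σf σJ ℓf ℓJ f val jac D) (hd : d K = 1)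
    (hx : FreshSamples P K D 𝓗 x) (w : Vec (d 0)) :
    Integrable (fun ω => excess K hd Lf LJ f (initState val jac w fun i => x i ω)) P ∧
      ∫ ω, excess K hd Lf LJ f (initState val jac w fun i => x i ω) ∂P ≤ initConst K Lf σJ := by
  have hj := init_jacProd hA hx w K le_rfl
  have hX := (measState_init hA hx w).mono (hx.le K le_rfl)
  have hle : ∀ ω, excess K hd Lf LJ f (initState val jac w fun i => x i ω) ≤
      2 * ((Lf : ℝ) ^ K) ^ 2 + 2 * ‖jacProd (initState val jac w fun i => x i ω).v K‖ ^ 2 := by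
    intro ω
    set X := initState val jac w fun i => x i ω
    refine (excess_le K hd Lf LJ f X).trans ?_
    have h1 := norm_gradient_objective_le hd hA.differentiable hA.lipschitz (X.u 0)
    have h2 := norm_chainGrad_le K hd X.v
    have h3 := norm_add_sq_le_two (-gradient (objective K hd f) (X.u 0)) (chainGrad K hd X.v)
    rw [neg_add_eq_sub, norm_neg] at h3
    refine h3.trans ?_
    gcongr
  have hi2 : Integrable (fun ω => 2 * ((Lf : ℝ) ^ K) ^ 2 +
      2 * ‖jacProd (initState val jac w fun i => x i ω).v K‖ ^ 2) P :=
    (integrable_const _).add (hj.1.const_mul 2)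
  have hi := integrable_of_nonneg_of_le hi2 (measurable_excess (Lf := Lf) (LJ := LJ) hA hd hX)
    (fun _ => excess_nonneg _ _ _ _ _ _) hle
  refine ⟨hi, (integral_mono hi hi2 hle).trans ?_⟩
  rw [integral_add (integrable_const _) (hj.1.const_mul 2)]
  simp only [integral_const_mul, integral_const, probReal_univ, one_smul]
  unfold initConst
  linarith [hj.2]

theorem init_intState (hA : Assumptions K Lf LJ σf σJ ℓf ℓJ f val jac D) (hd : d K = 1)
    (hS : IsSampling P K D T ξ τ) :
    IntState K hd Lf LJ f P (stageStart K hd Lf val jac c η w ξ τ 0) :=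
  ⟨integrable_const (optGap K hd f w), (init_sqError hA (hS.freshSamples 0 0) w).1,
    (init_excess hA hd (hS.freshSamples 0 0) w).1⟩

end Trajectory

/-! ### The parameters -/

section Parameters

variable {L₁ μ : ℝ}

/-- The product does not involve μ, so neither do the momentum parameters and step sizes. -/
theorem mul_epsStage (hμ : 0 < μ) (L₁ : ℝ) (s : ℕ) : μ * epsStage L₁ μ s = 8 * L₁ / 2 ^ s := by
  unfold epsStage; field_simp

theorem betaStage_succ (hL : 0 < L₁) (hμ : 0 < μ) (s : ℕ) :
    betaStage L₁ μ (s + 1) = 1 / (8 * L₁ * 2 ^ s) := by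
  rw [betaStage, mul_epsStage hμ, Ltwo]; field_simp; norm_num

theorem betaStage_pos (hL : 0 < L₁) (hμ : 0 < μ) : ∀ s, 0 < betaStage L₁ μ s
  | 0 => by unfold betaStage; positivity
  | s + 1 => by rw [betaStage_succ hL hμ]; positivity

theorem betaStage_le (hL : 0 < L₁) (hμ : 0 < μ) : ∀ s, betaStage L₁ μ s ≤ 1 / (2 * L₁)
  | 0 => le_rfl
  | s + 1 => by
    rw [betaStage_succ hL hμ]
    have : (1 : ℝ) ≤ 2 ^ s := one_le_pow₀ (by norm_num)
    apply one_div_le_one_div_of_le (by positivity)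
    nlinarith

theorem etaStage_pos (hL : 0 < L₁) (hμ : 0 < μ) (s : ℕ) : 0 < etaStage L₁ μ s :=
  Real.sqrt_pos.2 (div_pos (betaStage_pos hL hμ s) (by unfold cParam; positivity))

theorem cParam_mul_etaStage_sq (hL : 0 < L₁) (hμ : 0 < μ) (s : ℕ) :
    cParam L₁ * etaStage L₁ μ s ^ 2 = betaStage L₁ μ s := by
  have hc : 0 < cParam L₁ := by unfold cParam; positivity
  rw [etaStage, Real.sq_sqrt (div_nonneg (betaStage_pos hL hμ s).le hc.le)]
  field_simp

theorem etaStage_le (hL : 1 ≤ L₁) (hμ : 0 < μ) (s : ℕ) : etaStage L₁ μ s ≤ 1 / (4 * L₁) := by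
  have hL0 : 0 < L₁ := by linarith
  have h1 := betaStage_le hL0 hμ s
  have h2 : 1 / (2 * L₁) ≤ 1 := by rw [div_le_one (by positivity)]; linarith
  rw [etaStage, Real.sqrt_le_left (by positivity), cParam, div_le_iff₀ (by positivity)]
  have : (1 / (4 * L₁)) ^ 2 * (16 * L₁ ^ 2) = 1 := by field_simp; norm_num
  linarith

/-- All conditions reduce to β ≤ 1/(2 L₁) and η ≤ 1/(4 L₁), and to c = 16 L₁² ≥ 16 E M. -/
theorem admissible_stage {K : ℕ} {Lf LJ ℓf ℓJ : ℝ≥0} (hL : 1 ≤ L₁) (hμ : 0 < μ)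
    (hE : errConst K Lf LJ ≤ L₁) (hM : moveConst K ℓf ℓJ ≤ L₁) (hG : gradConst K Lf LJ ≤ L₁)
    (s : ℕ) : Admissible K Lf LJ ℓf ℓJ (cParam L₁) (etaStage L₁ μ s) := by
  have hL0 : 0 < L₁ := by linarith
  have h1 := betaStage_le hL0 hμ s
  have h0 := betaStage_pos hL0 hμ s
  have h2 : 1 / (2 * L₁) ≤ 1 := by rw [div_le_one (by positivity)]; linarith
  have hM0 := moveConst_nonneg K ℓf ℓJ
  have hG0 := gradConst_nonneg K Lf LJ
  have hE0 := two_le_errConst K Lf LJ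
  refine ⟨by unfold cParam; positivity, etaStage_pos hL0 hμ s, ?_, ?_, ?_, ?_⟩
  · rw [cParam_mul_etaStage_sq hL0 hμ]; linarith
  · rw [cParam_mul_etaStage_sq hL0 hμ]
    calc moveConst K ℓf ℓJ * betaStage L₁ μ s ≤ L₁ * (1 / (2 * L₁)) := by gcongr
      _ = 1 / 2 := by field_simp
  · have h3 := etaStage_le hL hμ s
    calc etaStage L₁ μ s * gradConst K Lf LJ ≤ 1 / (4 * L₁) * L₁ := by gcongr
      _ = 1 / 4 := by field_simp
  · unfold cParam
    calc 16 * errConst K Lf LJ * moveConst K ℓf ℓJ ≤ 16 * L₁ * L₁ := by gcongr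
      _ = _ := by ring

theorem lenStage_succ (K : ℕ) (σf σJ Δ : ℝ≥0) (hL : 0 < L₁) (hμ : 0 < μ) (s : ℕ) :
    lenStage K σf σJ Δ L₁ μ (s + 1) =
      ⌈max (256 * L₁ ^ 2 * 2 ^ s) (256 * L₁ ^ 2 / (μ * √(8 * L₁ / 2 ^ s)))⌉₊ := by
  have e1 : Ltwo L₁ ^ (3 / 2 : ℝ) = 512 * L₁ ^ 3 := by
    have h : Ltwo L₁ = (8 * L₁) ^ 2 := by unfold Ltwo; ring
    rw [h, ← Real.rpow_natCast, ← Real.rpow_mul (by positivity)]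
    norm_num
    ring
  have e2 : μ ^ (3 / 2 : ℝ) * √(epsStage L₁ μ s) = μ * √(8 * L₁ / 2 ^ s) := by
    rw [← mul_epsStage hμ, Real.sqrt_mul hμ.le, ← mul_assoc]
    congr 1
    rw [show (3 / 2 : ℝ) = 1 + 1 / 2 by norm_num, Real.rpow_add hμ, Real.rpow_one,
      ← Real.sqrt_eq_rpow]
  rw [lenStage, e1, e2, mul_epsStage hμ, Ltwo]
  congr 2
  · field_simp; norm_num
  · congr 1; ring

theorem lenStage_pos (K : ℕ) (σf σJ Δ : ℝ≥0) (hL : 0 < L₁) (hμ : 0 < μ) :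
    ∀ s, 0 < lenStage K σf σJ Δ L₁ μ s
  | 0 => by unfold lenStage; exact lt_max_of_lt_left one_pos
  | s + 1 => by
    rw [lenStage_succ K σf σJ Δ hL hμ]
    exact Nat.ceil_pos.2 (lt_max_of_lt_left (by positivity))

/-- The right-hand side of the bound of the first stage. -/
theorem first_stage_le {K : ℕ} {σf σJ Δ : ℝ≥0} {E S R g Φ r : ℝ} (hL : 1 ≤ L₁)
    (hE : 2 ≤ E) (hS : 0 ≤ S) (hEL : E ≤ L₁) (hSL : S ≤ L₁) (hRL : R ≤ L₁)
    (hg : g ≤ Δ) (hΦ : Φ ≤ K * ((σf : ℝ) ^ 2 + σJ ^ 2)) (hr : r ≤ R) :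
    g / etaStage L₁ μ 0 + 2 * E / betaStage L₁ μ 0 * Φ +
      lenStage K σf σJ Δ L₁ μ 0 * (2 * E * S * betaStage L₁ μ 0) + 3 / 2 * r ≤
        lenStage K σf σJ Δ L₁ μ 0 * (8 * L₁) := by
  have hL0 : 0 < L₁ := by linarith
  set T : ℝ := ((lenStage K σf σJ Δ L₁ μ 0 : ℕ) : ℝ) with hT
  have hT1 : 1 ≤ T := by rw [hT, lenStage]; exact_mod_cast le_max_left _ _
  have hTm : max (4 * L₁ * K * ((σf : ℝ) ^ 2 + (σJ : ℝ) ^ 2)) (2 * √(2 * L₁) * Δ) ≤ T := by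
    rw [hT, lenStage]
    exact (Nat.le_ceil _).trans (by exact_mod_cast le_max_right _ _)
  have hT2 := (le_max_left _ _).trans hTm
  have hT3 := (le_max_right _ _).trans hTm
  have hβ : betaStage L₁ μ 0 = 1 / (2 * L₁) := rfl
  have hη : etaStage L₁ μ 0 = 1 / (4 * L₁ * √(2 * L₁)) := by
    rw [etaStage, hβ, cParam, Real.sqrt_eq_iff_mul_self_eq (by positivity) (by positivity)]
    have := Real.mul_self_sqrt (show 0 ≤ 2 * L₁ by positivity)
    field_simp
    rw [Real.sq_sqrt (by positivity)]
    ring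
  -- The four terms cost at most 2, 1, 1 and 3/2 times L₁ T, within the budget 8 L₁ T. The two
  -- entries of the maximum defining T pay for the error and the gap.
  have h1 : g / etaStage L₁ μ 0 ≤ 2 * L₁ * T := by
    rw [hη, div_div_eq_mul_div, div_one]
    calc g * (4 * L₁ * √(2 * L₁)) ≤ Δ * (4 * L₁ * √(2 * L₁)) := by gcongr
      _ = 2 * L₁ * (2 * √(2 * L₁) * Δ) := by ring
      _ ≤ _ := by gcongr
  have h2 : 2 * E / betaStage L₁ μ 0 * Φ ≤ L₁ * T := by
    rw [hβ]
    calc 2 * E / (1 / (2 * L₁)) * Φ = E * (4 * L₁ * Φ) := by field_simp; ring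
      _ ≤ E * (4 * L₁ * (K * ((σf : ℝ) ^ 2 + σJ ^ 2))) := by gcongr
      _ ≤ E * T := by gcongr; linarith
      _ ≤ _ := by gcongr
  have h3 : 2 * E * S * betaStage L₁ μ 0 ≤ L₁ := by
    rw [hβ]
    calc 2 * E * S * (1 / (2 * L₁)) ≤ 2 * L₁ * L₁ * (1 / (2 * L₁)) := by gcongr
      _ = L₁ := by field_simp
  have h4 := mul_le_mul_of_nonneg_left h3 (show 0 ≤ T by linarith)
  have h5 : L₁ * 1 ≤ L₁ * T := by gcongr
  nlinarith

/-- The right-hand side of the bound of a later stage. -/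
theorem later_stage_le {K : ℕ} {σf σJ Δ : ℝ≥0} {E S g Φ r : ℝ} (hL : 1 ≤ L₁) (hμ : 0 < μ)
    (hE : 2 ≤ E) (hS : 0 ≤ S) (hEL : E ≤ L₁) (hSL : S ≤ L₁) {s : ℕ}
    (hg : μ * g ≤ 8 * L₁ / 2 ^ s) (hΦ : Φ ≤ 8 * L₁ / 2 ^ s) (hr : r ≤ 8 * L₁ / 2 ^ s) :
    g / etaStage L₁ μ (s + 1) + 2 * E / betaStage L₁ μ (s + 1) * Φ +
      lenStage K σf σJ Δ L₁ μ (s + 1) * (2 * E * S * betaStage L₁ μ (s + 1)) + 3 / 2 * r ≤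
        lenStage K σf σJ Δ L₁ μ (s + 1) * (8 * L₁ / 2 ^ (s + 1)) := by
  have hL0 : 0 < L₁ := by linarith
  have hp : (1 : ℝ) ≤ 2 ^ s := one_le_pow₀ (by norm_num)
  set T : ℝ := ((lenStage K σf σJ Δ L₁ μ (s + 1) : ℕ) : ℝ) with hT
  set q : ℝ := 8 * L₁ / 2 ^ s with hq
  have hq0 : 0 < q := by positivity
  have hTm : max (256 * L₁ ^ 2 * 2 ^ s) (256 * L₁ ^ 2 / (μ * √q)) ≤ T := by
    rw [hT, lenStage_succ K σf σJ Δ hL0 hμ]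
    exact Nat.le_ceil _
  have hT1 : 256 * L₁ ^ 2 * 2 ^ s ≤ T := (le_max_left _ _).trans hTm
  have hT2 : 256 * L₁ ^ 2 / (μ * √q) ≤ T := (le_max_right _ _).trans hTm
  have hβ : betaStage L₁ μ (s + 1) = q / (64 * L₁ ^ 2) := by
    rw [betaStage, mul_epsStage hμ, Ltwo]
  have hsq : √q * √q = q := Real.mul_self_sqrt hq0.le
  have hsq0 : 0 < √q := Real.sqrt_pos.2 hq0
  have hη : etaStage L₁ μ (s + 1) = √q / (32 * L₁ ^ 2) := by
    rw [etaStage, hβ, cParam, Real.sqrt_eq_iff_mul_self_eq (by positivity) (by positivity)]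
    field_simp
    rw [Real.sq_sqrt hq0.le]
    ring
  -- The budget is T q / 2. The gap and the error take T q / 8 each, the noise T q / 32, and the
  -- excess 3q/2 is small since T ≥ 256. The first entry of the maximum serves the error, the second
  -- the gap.
  have hTq : 2048 * L₁ ^ 3 ≤ T * q := by
    calc 2048 * L₁ ^ 3 = 256 * L₁ ^ 2 * 2 ^ s * q := by rw [hq]; field_simp; norm_num
      _ ≤ _ := by gcongr
  have h1 : g / etaStage L₁ μ (s + 1) ≤ T * q / 8 := by
    rw [hη, div_div_eq_mul_div, div_le_iff₀ hsq0]
    have h2 : 256 * L₁ ^ 2 ≤ T * (μ * √q) := by rwa [div_le_iff₀ (by positivity)] at hT2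
    have h3 : μ * (g * (32 * L₁ ^ 2)) ≤ μ * (T * q / 8 * √q) := by
      calc μ * (g * (32 * L₁ ^ 2)) = μ * g * (32 * L₁ ^ 2) := by ring
        _ ≤ q * (32 * L₁ ^ 2) := by gcongr
        _ = q / 8 * (256 * L₁ ^ 2) := by ring
        _ ≤ q / 8 * (T * (μ * √q)) := by gcongr
        _ = _ := by ring
    exact le_of_mul_le_mul_left h3 hμ
  have h2 : 2 * E / betaStage L₁ μ (s + 1) * Φ ≤ T * q / 8 := by
    rw [hβ]
    calc 2 * E / (q / (64 * L₁ ^ 2)) * Φ ≤ 2 * E / (q / (64 * L₁ ^ 2)) * q := by gcongr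
      _ ≤ 2 * L₁ / (q / (64 * L₁ ^ 2)) * q := by gcongr
      _ = 128 * L₁ ^ 3 := by field_simp; ring
      _ ≤ _ := by
        have : 0 < L₁ ^ 3 := by positivity
        linarith
  have h3 : 2 * E * S * betaStage L₁ μ (s + 1) ≤ q / 32 := by
    rw [hβ]
    calc 2 * E * S * (q / (64 * L₁ ^ 2)) ≤ 2 * L₁ * L₁ * (q / (64 * L₁ ^ 2)) := by gcongr
      _ = q / 32 := by field_simp; norm_num
  have hT0 : 256 ≤ T := by
    have : (1 : ℝ) ≤ L₁ ^ 2 := one_le_pow₀ hL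
    nlinarith
  have h4 := mul_le_mul_of_nonneg_left h3 (show 0 ≤ T by linarith)
  have h5 : 256 * q ≤ T * q := by gcongr
  have e : T * (8 * L₁ / 2 ^ (s + 1)) = T * q / 2 := by rw [hq, pow_succ]; field_simp
  rw [e]
  nlinarith

/-! ### The number of samples -/

/-- Geometric growth with ratio √2; the constant 3 works because √2 ≥ 4/3. -/
theorem sum_sqrt_two_pow_le (n : ℕ) :
    ∑ s ∈ Finset.range n, √((2 : ℝ) ^ s) ≤ 3 * √((2 : ℝ) ^ n) := by
  induction n with
  | zero => simp
  | succ n ih =>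
    rw [Finset.sum_range_succ, pow_succ, Real.sqrt_mul (by positivity)]
    have h : 4 / 3 ≤ √(2 : ℝ) := by
      rw [Real.le_sqrt (by norm_num) (by norm_num)]; norm_num
    nlinarith [Real.sqrt_nonneg ((2 : ℝ) ^ n)]

/-- The 1 added to the first coefficient pays for rounding up, as 1 ≤ 2^s. -/
theorem lenStage_succ_le (K : ℕ) (σf σJ Δ : ℝ≥0) (hL : 1 ≤ L₁) (hμ : 0 < μ) (s : ℕ) :
    (lenStage K σf σJ Δ L₁ μ (s + 1) : ℝ) ≤
      (1 + 256 * L₁ ^ 2) * 2 ^ s + 256 * L₁ ^ 2 / μ * √(2 ^ s) := by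
  have hL0 : 0 < L₁ := by linarith
  have hp : (1 : ℝ) ≤ 2 ^ s := one_le_pow₀ (by norm_num)
  rw [lenStage_succ K σf σJ Δ hL0 hμ]
  have h1 : 256 * L₁ ^ 2 / (μ * √(8 * L₁ / 2 ^ s)) ≤ 256 * L₁ ^ 2 / μ * √(2 ^ s) := by
    have h2 : 1 ≤ √(8 * L₁) := by rw [Real.one_le_sqrt]; linarith
    have h3 : 0 < √((2 : ℝ) ^ s) := by positivity
    rw [Real.sqrt_div' _ (by positivity)]
    calc 256 * L₁ ^ 2 / (μ * (√(8 * L₁) / √(2 ^ s)))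
        = 256 * L₁ ^ 2 / μ * √(2 ^ s) / √(8 * L₁) := by field_simp
      _ ≤ _ := div_le_self (by positivity) h2
  have h4 : 0 ≤ 256 * L₁ ^ 2 / μ * √((2 : ℝ) ^ s) := by positivity
  have h5 := (Nat.ceil_lt_add_one (a := max (256 * L₁ ^ 2 * 2 ^ s)
    (256 * L₁ ^ 2 / (μ * √(8 * L₁ / 2 ^ s)))) (le_max_of_le_left (by positivity))).le
  have h6 : max (256 * L₁ ^ 2 * 2 ^ s) (256 * L₁ ^ 2 / (μ * √(8 * L₁ / 2 ^ s))) ≤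
      256 * L₁ ^ 2 * 2 ^ s + 256 * L₁ ^ 2 / μ * √(2 ^ s) :=
    max_le (by linarith) (by nlinarith [sq_nonneg L₁])
  nlinarith

theorem two_pow_numStages_ge (hL : 0 < L₁) (hμ : 0 < μ) {ε : ℝ} (hε : 0 < ε) :
    16 * L₁ / (μ * ε) ≤ 2 ^ numStages L₁ μ ε := by
  have e : 2 * epsStage L₁ μ 0 / ε = 16 * L₁ / (μ * ε) := by
    unfold epsStage; field_simp; norm_num
  have hpos : 0 < 16 * L₁ / (μ * ε) := by positivity
  have h : Real.logb 2 (16 * L₁ / (μ * ε)) ≤ numStages L₁ μ ε := by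
    rw [numStages, e]
    exact (Nat.le_ceil _).trans (by exact_mod_cast le_max_right _ _)
  rw [Real.logb_le_iff_le_rpow (by norm_num) hpos, Real.rpow_natCast] at h
  exact h

theorem numStages_pos (L₁ μ ε : ℝ) : 0 < numStages L₁ μ ε :=
  lt_max_of_lt_left one_pos

/-- Rounding up overshoots by less than one stage. A single stage is excluded, because it may be due
to the maximum with 1 rather than to the logarithm. -/
theorem two_pow_le_of_numStages (hL : 0 < L₁) (hμ : 0 < μ) {ε : ℝ} (hε : 0 < ε) {n : ℕ}
    (hn : numStages L₁ μ ε = n + 1) (hn0 : 0 < n) : (2 : ℝ) ^ n ≤ 16 * L₁ / (μ * ε) := by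
  have e : 2 * epsStage L₁ μ 0 / ε = 16 * L₁ / (μ * ε) := by
    unfold epsStage; field_simp; norm_num
  have hpos : 0 < 16 * L₁ / (μ * ε) := by positivity
  have h : (n : ℝ) ≤ Real.logb 2 (16 * L₁ / (μ * ε)) := by
    rw [numStages, e] at hn
    have h1 : n < ⌈Real.logb 2 (16 * L₁ / (μ * ε))⌉₊ := by
      rcases max_choice 1 ⌈Real.logb 2 (16 * L₁ / (μ * ε))⌉₊ with h | h <;> omega
    exact (Nat.lt_ceil.1 h1).le
  rw [Real.le_logb_iff_rpow_le (by norm_num) hpos, Real.rpow_natCast] at h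
  exact h

/-- The constant of the sample complexity. -/
def complexityConst (K : ℕ) (σf σJ Δ : ℝ≥0) (L₁ : ℝ) : ℝ :=
  K * (lenStage K σf σJ Δ L₁ 1 0 + (1 + 256 * L₁ ^ 2) * (16 * L₁) + 3072 * L₁ ^ 3)

theorem numSamples_le (K : ℕ) (σf σJ Δ : ℝ≥0) (hL : 1 ≤ L₁) (hμ : 0 < μ) {ε : ℝ} (hε : 0 < ε)
    (hεμ : ε ≤ μ) : (numSamples K σf σJ Δ L₁ μ ε : ℝ) ≤
      complexityConst K σf σJ Δ L₁ * max 1 (1 / (μ * ε)) := by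
  have hL0 : 0 < L₁ := by linarith
  obtain ⟨n, hn⟩ := Nat.exists_eq_succ_of_ne_zero (numStages_pos L₁ μ ε).ne'
  have hμε : 0 < μ * ε := by positivity
  have h0 : (lenStage K σf σJ Δ L₁ μ 0 : ℝ) = lenStage K σf σJ Δ L₁ 1 0 := rfl
  set A : ℝ := ((lenStage K σf σJ Δ L₁ 1 0 : ℕ) : ℝ)
  have hA : 0 ≤ A := Nat.cast_nonneg _
  have hsum : ∑ s ∈ Finset.range n, (lenStage K σf σJ Δ L₁ μ (s + 1) : ℝ) ≤
      ((1 + 256 * L₁ ^ 2) * (16 * L₁) + 3072 * L₁ ^ 3) * (1 / (μ * ε)) := by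
    rcases Nat.eq_zero_or_pos n with rfl | hn0
    · simp; positivity
    have hp := two_pow_le_of_numStages hL0 hμ hε hn hn0
    have hgeom : ∑ s ∈ Finset.range n, (2 : ℝ) ^ s ≤ 2 ^ n := by
      have := geom_sum_eq (show (2 : ℝ) ≠ 1 by norm_num) n
      rw [this]; norm_num
    -- Here ε ≤ μ enters: it gives √(μ ε) ≤ μ, so 1/μ costs no more than the second factor 1/√(μ ε).
    have hsq : 1 / μ * √(2 ^ n) ≤ 4 * L₁ * (1 / (μ * ε)) := by
      have h1 : √((2 : ℝ) ^ n) ≤ 4 * L₁ / √(μ * ε) := by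
        calc √((2 : ℝ) ^ n) ≤ √(16 * L₁ / (μ * ε)) := Real.sqrt_le_sqrt hp
          _ = √(16 * L₁) / √(μ * ε) := Real.sqrt_div' _ hμε.le
          _ ≤ _ := by
            gcongr
            rw [Real.sqrt_le_left (by positivity)]
            nlinarith
      have h2 : 1 / μ ≤ 1 / √(μ * ε) := by
        apply one_div_le_one_div_of_le (by positivity)
        rw [Real.sqrt_le_left hμ.le]
        nlinarith
      calc 1 / μ * √(2 ^ n) ≤ 1 / √(μ * ε) * (4 * L₁ / √(μ * ε)) := by gcongr
        _ = 4 * L₁ * (1 / (√(μ * ε) * √(μ * ε))) := by field_simp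
        _ = _ := by rw [Real.mul_self_sqrt hμε.le]
    calc ∑ s ∈ Finset.range n, (lenStage K σf σJ Δ L₁ μ (s + 1) : ℝ)
        ≤ ∑ s ∈ Finset.range n, ((1 + 256 * L₁ ^ 2) * 2 ^ s + 256 * L₁ ^ 2 / μ * √(2 ^ s)) :=
          Finset.sum_le_sum fun s _ => lenStage_succ_le K σf σJ Δ hL hμ s
      _ = (1 + 256 * L₁ ^ 2) * ∑ s ∈ Finset.range n, 2 ^ s +
          256 * L₁ ^ 2 / μ * ∑ s ∈ Finset.range n, √(2 ^ s) := by
          rw [Finset.sum_add_distrib, Finset.mul_sum, Finset.mul_sum]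
      _ ≤ (1 + 256 * L₁ ^ 2) * (16 * L₁ / (μ * ε)) + 256 * L₁ ^ 2 / μ * (3 * √(2 ^ n)) := by
          gcongr
          · exact hgeom.trans hp
          · exact sum_sqrt_two_pow_le n
      _ = (1 + 256 * L₁ ^ 2) * (16 * L₁) * (1 / (μ * ε)) +
          768 * L₁ ^ 2 * (1 / μ * √(2 ^ n)) := by ring
      _ ≤ (1 + 256 * L₁ ^ 2) * (16 * L₁) * (1 / (μ * ε)) +
          768 * L₁ ^ 2 * (4 * L₁ * (1 / (μ * ε))) := by gcongr
      _ = _ := by ring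
  unfold numSamples complexityConst
  rw [hn, Finset.sum_range_succ']
  push_cast
  rw [h0, mul_assoc]
  gcongr
  calc _ ≤ ((1 + 256 * L₁ ^ 2) * (16 * L₁) + 3072 * L₁ ^ 3) * max 1 (1 / (μ * ε)) +
        A * max 1 (1 / (μ * ε)) := by
        refine add_le_add (hsum.trans ?_) (le_mul_of_one_le_right hA (le_max_left _ _))
        gcongr
        exact le_max_right _ _
    _ = _ := by ring

end Parameters

/-! ### Halving of the potential and the final estimate -/

section Main

variable {d : ℕ → ℕ} {Ω : Type*} {Ξ : ℕ → Type*} [∀ i, MeasurableSpace (Ξ i)]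
  {K : ℕ} {Lf LJ σf σJ ℓf ℓJ : ℝ≥0} {f : (i : ℕ) → Vec (d i) → Vec (d (i + 1))}
  {val : (i : ℕ) → Vec (d i) → Ξ i → Vec (d (i + 1))}
  {jac : (i : ℕ) → Vec (d i) → Ξ i → Vec (d i) →L[ℝ] Vec (d (i + 1))}
  {D : (i : ℕ) → Measure (Ξ i)} {mΩ : MeasurableSpace Ω} {P : Measure Ω}
  [IsProbabilityMeasure P] [∀ i, IsProbabilityMeasure (D i)] {w : Vec (d 0)}
  {ξ : ℕ → ℕ → (i : ℕ) → Ω → Ξ i} {τ : ℕ → Ω → ℕ}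

/-- Lower bound for `L₁`. -/
def minLone (K : ℕ) (Lf LJ σf σJ ℓf ℓJ : ℝ≥0) : ℝ :=
  1 + errConst K Lf LJ + moveConst K ℓf ℓJ + noiseConst K σf σJ ℓf ℓJ + gradConst K Lf LJ +
    initConst K Lf σJ

theorem potential_parts_le {hd : d K = 1} (hbdd : BddBelow (Set.range (objective K hd f)))
    {X : Ω → State d} (hI : IntState K hd Lf LJ f P X) {μ b : ℝ} (hμ : 0 < μ)
    (h : ∫ ω, potential K hd Lf LJ f μ (X ω) ∂P ≤ b) :
    μ * ∫ ω, optGap K hd f ((X ω).u 0) ∂P ≤ b ∧ ∫ ω, sqError K f (X ω) ∂P ≤ b ∧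
      ∫ ω, excess K hd Lf LJ f (X ω) ∂P ≤ b := by
  rw [(potential_integral hI μ).2] at h
  have h1 : 0 ≤ μ * ∫ ω, optGap K hd f ((X ω).u 0) ∂P :=
    mul_nonneg hμ.le (integral_nonneg fun _ => optGap_nonneg hbdd _)
  have h2 : 0 ≤ ∫ ω, sqError K f (X ω) ∂P := integral_nonneg fun _ => sqError_nonneg _ _ _
  have h3 : 0 ≤ ∫ ω, excess K hd Lf LJ f (X ω) ∂P :=
    integral_nonneg fun _ => excess_nonneg _ _ _ _ _ _
  exact ⟨by linarith, by linarith, by linarith⟩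

/-- The expected potential halves in every stage. -/
theorem potential_stageStart_le (hA : Assumptions K Lf LJ σf σJ ℓf ℓJ f val jac D) (hd : d K = 1)
    (hbdd : BddBelow (Set.range (objective K hd f))) {L₁ μ : ℝ} {Δ : ℝ≥0}
    (hL : minLone K Lf LJ σf σJ ℓf ℓJ ≤ L₁) (hμ : 0 < μ) (hΔ : optGap K hd f w ≤ Δ)
    (hS : IsSampling P K D (lenStage K σf σJ Δ L₁ μ) ξ τ) {W : Set (Vec (d 0))}
    (hPL : PLOn μ (objective K hd f) W) {N : ℕ}
    (hW : ∀ s < N, ∀ t < lenStage K σf σJ Δ L₁ μ s, ∀ᵐ ω ∂P,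
      (stageState K hd Lf val jac (cParam L₁) (etaStage L₁ μ) w ξ τ s t ω).u 0 ∈ W) :
    ∀ s < N, IntState K hd Lf LJ f P
        (stageStart K hd Lf val jac (cParam L₁) (etaStage L₁ μ) w ξ τ (s + 1)) ∧
      ∫ ω, potential K hd Lf LJ f μ
        (stageStart K hd Lf val jac (cParam L₁) (etaStage L₁ μ) w ξ τ (s + 1) ω) ∂P ≤
          8 * L₁ / 2 ^ s := by
  have hE := two_le_errConst K Lf LJ
  have hM0 := moveConst_nonneg K ℓf ℓJ
  have hN0 := noiseConst_nonneg K σf σJ ℓf ℓJ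
  have hG0 := gradConst_nonneg K Lf LJ
  have hR0 := initConst_nonneg K Lf σJ
  unfold minLone at hL
  have hL1 : 1 ≤ L₁ := by linarith
  have hL0 : 0 < L₁ := by linarith
  have hadm := admissible_stage (Lf := Lf) (LJ := LJ) (ℓf := ℓf) (ℓJ := ℓJ) (K := K) hL1 hμ
    (by linarith) (by linarith) (by linarith)
  intro s
  induction s with
  | zero =>
    intro hs
    obtain ⟨hI, hb⟩ := stage_bound hA hd hbdd hS (lenStage_pos K σf σJ Δ hL0 hμ 0) (hadm 0)
      (init_intState hA hd hS) hPL (hW 0 hs)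
    refine ⟨hI, ?_⟩
    have hT : (0 : ℝ) < lenStage K σf σJ Δ L₁ μ 0 := by
      exact_mod_cast lenStage_pos K σf σJ Δ hL0 hμ 0
    rw [cParam_mul_etaStage_sq hL0 hμ] at hb
    have hg : ∫ ω, optGap K hd f ((stageStart K hd Lf val jac (cParam L₁) (etaStage L₁ μ) w ξ τ
        0 ω).u 0) ∂P ≤ Δ := by
      have e : ∀ ω, (stageStart K hd Lf val jac (cParam L₁) (etaStage L₁ μ) w ξ τ 0 ω).u 0 = w :=
        fun _ => rfl
      simpa [e] using hΔ
    have h := hb.trans (first_stage_le hL1 hE hN0 (by linarith) (by linarith)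
      (show initConst K Lf σJ ≤ L₁ by linarith) hg (init_sqError hA (hS.freshSamples 0 0) w).2
      (init_excess hA hd (hS.freshSamples 0 0) w).2)
    rw [pow_zero, div_one]
    exact le_of_mul_le_mul_left h hT
  | succ s ih =>
    intro hs
    obtain ⟨hI', hp⟩ := ih (by omega)
    obtain ⟨hI, hb⟩ := stage_bound hA hd hbdd hS (lenStage_pos K σf σJ Δ hL0 hμ (s + 1))
      (hadm (s + 1)) hI' hPL (hW (s + 1) hs)
    refine ⟨hI, ?_⟩
    have hT : (0 : ℝ) < lenStage K σf σJ Δ L₁ μ (s + 1) := by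
      exact_mod_cast lenStage_pos K σf σJ Δ hL0 hμ (s + 1)
    rw [cParam_mul_etaStage_sq hL0 hμ] at hb
    obtain ⟨h1, h2, h3⟩ := potential_parts_le hbdd hI' hμ hp
    exact le_of_mul_le_mul_left (hb.trans (later_stage_le hL1 hμ hE hN0 (by linarith)
      (by linarith) h1 h2 h3)) hT

end Main

end

theorem theorem2 (K : ℕ) (hK : 1 ≤ K) (Lf LJ σf σJ ℓf ℓJ : ℝ≥0) :
    ∃ L₀ : ℝ, 0 < L₀ ∧ ∀ L₁ : ℝ, L₀ ≤ L₁ → ∀ Δ : ℝ≥0, ∃ C : ℝ,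
      ∀ (d : ℕ → ℕ) (hd : d K = 1)
        (Ξ : ℕ → Type*) [∀ i, MeasurableSpace (Ξ i)]
        (D : (i : ℕ) → Measure (Ξ i)) [∀ i, IsProbabilityMeasure (D i)]
        (f : (i : ℕ) → Vec (d i) → Vec (d (i + 1)))
        (val : (i : ℕ) → Vec (d i) → Ξ i → Vec (d (i + 1)))
        (jac : (i : ℕ) → Vec (d i) → Ξ i → Vec (d i) →L[ℝ] Vec (d (i + 1)))
        (w₁ : Vec (d 0)),
        Assumptions K Lf LJ σf σJ ℓf ℓJ f val jac D →
        BddBelow (Set.range (objective K hd f)) →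
        objective K hd f w₁ - ⨅ w, objective K hd f w ≤ Δ →
        ∀ (μ : ℝ) (W : Set (Vec (d 0))), 0 < μ → PLOn μ (objective K hd f) W →
        ∀ (Ω : Type*) [MeasurableSpace Ω] (P : Measure Ω) [IsProbabilityMeasure P]
          (ξ : ℕ → ℕ → (i : ℕ) → Ω → Ξ i) (τ : ℕ → Ω → ℕ),
          IsSampling P K D (lenStage K σf σJ Δ L₁ μ) ξ τ →
        ∀ ε : ℝ, 0 < ε → ε ≤ μ →
          (∀ᵐ ω ∂P, ∀ s < numStages L₁ μ ε, ∀ t < lenStage K σf σJ Δ L₁ μ s,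
            iterate K hd Lf val jac (cParam L₁) (etaStage L₁ μ) w₁
              (fun s t i => ξ s t i ω) (fun s => τ s ω) s t ∈ W) →
          let gap : Ω → ℝ := fun ω =>
            objective K hd f
              ((stagewise K hd Lf val jac (cParam L₁) (etaStage L₁ μ) w₁
                (fun s t i => ξ s t i ω) (fun s => τ s ω) (numStages L₁ μ ε)).u 0) -
              ⨅ w, objective K hd f w
          (Integrable gap P ∧ ∫ ω, gap ω ∂P ≤ ε) ∧
            (numSamples K σf σJ Δ L₁ μ ε : ℝ) ≤ C * max 1 (1 / (μ * ε)) := by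
  have hE := two_le_errConst K Lf LJ
  have hM0 := moveConst_nonneg K ℓf ℓJ
  have hN0 := noiseConst_nonneg K σf σJ ℓf ℓJ
  have hG0 := gradConst_nonneg K Lf LJ
  have hR0 := initConst_nonneg K Lf σJ
  have hmin : 1 ≤ minLone K Lf LJ σf σJ ℓf ℓJ := by unfold minLone; linarith
  refine ⟨minLone K Lf LJ σf σJ ℓf ℓJ, by linarith, fun L₁ hL Δ =>
    ⟨complexityConst K σf σJ Δ L₁, ?_⟩⟩
  intro d hd Ξ _ D _ f val jac w₁ hA hbdd hΔ μ W hμ hPL Ω _ P _ ξ τ hS ε hε hεμ hW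
  have hL1 : 1 ≤ L₁ := hmin.trans hL
  have hL0 : 0 < L₁ := by linarith
  refine ⟨?_, numSamples_le K σf σJ Δ hL1 hμ hε hεμ⟩
  obtain ⟨n, hn⟩ := Nat.exists_eq_succ_of_ne_zero (numStages_pos L₁ μ ε).ne'
  have hW' : ∀ s < numStages L₁ μ ε, ∀ t < lenStage K σf σJ Δ L₁ μ s, ∀ᵐ ω ∂P,
      (stageState K hd Lf val jac (cParam L₁) (etaStage L₁ μ) w₁ ξ τ s t ω).u 0 ∈ W := by
    intro s hs t ht
    filter_upwards [hW] with ω hω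
    exact hω s hs t ht
  obtain ⟨hI, hp⟩ := potential_stageStart_le hA hd hbdd hL hμ hΔ hS hPL hW' n (by omega)
  obtain ⟨h1, -, -⟩ := potential_parts_le hbdd hI hμ hp
  have hpow := two_pow_numStages_ge hL0 hμ hε
  rw [hn] at hpow ⊢
  refine ⟨hI.optGap, ?_⟩
  -- With n + 1 stages the last potential bound is 8 L₁/2^n = 16 L₁/2^(n+1), which the number of
  -- stages brings below μ ε. The factor 2 in the logarithm compensates for this shift.
  have h2 : 8 * L₁ / 2 ^ n ≤ μ * ε := by
    rw [div_le_iff₀ (by positivity)] at hpow ⊢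
    rw [Nat.succ_eq_add_one, pow_succ] at hpow
    linarith
  exact le_of_mul_le_mul_left (h1.trans h2) hμ
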